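/- **Setting.** Let $n,k\ge 0$ and $T\ge 1$ be integers and let $A_{t,ij}=A_{t,ji}$ ($1\le t\le T$, $1\le i\le j\le n$) be observed nonnegative integer counts. For $Z=(z_1,\dots,z_n)^\top\in\mathbb R^{n\times k}$ and $\alpha=(\alpha_{it})\in\mathbb R^{n\times T}$ put $$L(Z,\alpha)=\sum_{t=1}^T\sum_{1\le i\le j\le n}\bigl\{A_{t,ij}(\alpha_{it}+\alpha_{jt}+\langle z_i,z_j\rangle)-\exp(\alpha_{it}+\alpha_{jt}+\langle z_i,z_j\rangle)\bigr\},$$ the log-likelihood (up to a constant) of independent counts $A_{t,ij}\sim\mathrm{Poisson}\{\exp(\alpha_{it}+\alpha_{jt}+\langle z_i,z_j\rangle)\}$. Let $Z_v=(z_1^\top,\dots,z_n^\top)^\top\in\mathbb R^{nk}$, let $\alpha_v\in\mathbb R^{nT}$ be the vectorization of $\alpha$, let $\operatorname{mat}$ be the inverse of $Z\mapsto Z_v$, and let $\dot L_Z,\dot L_\alpha,\ddot L_{Z,Z},\ddot L_{Z,\alpha},\ddot L_{\alpha,Z},\ddot L_{\alpha,\alpha}$ be the first and second partial derivatives of $L$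 with respect to $Z_v,\alpha_v$. With expectations under the parameters $(Z,\alpha)$, put $$S_{eff}=\dot L_Z-\mathbb E(\dot L_Z\dot L_\alpha^\top)\{\mathbb E(\dot L_\alpha\dot L_\alpha^\top)\}^{-1}\dot L_\alpha,\qquad I_{eff}=\mathbb E(S_{eff}S_{eff}^\top),\qquad H_{eff}=\ddot L_{Z,Z}-\ddot L_{Z,\alpha}\ddot L_{\alpha,\alpha}^{-1}\ddot L_{\alpha,Z}.$$ Let $\mathbb R_0^{n\times k}=\{Z\in\mathbb R^{n\times k}:1_n^\top Z=0,\ \det(Z^\top Z)\ne0\}$, with the Riemannian metric $g_Z(X,Y)=\operatorname{tr}(X^\top Y)$, and let $\mathcal M=\mathbb R_0^{n\times k}/\mathcal O(k)$ be the quotient by $Z\sim ZQ$, $Q\in\mathcal O(k)$, with the induced smooth structure (of dimension $nk-k(k+1)/2$), the induced Riemannian metric, its Riemannian (Levi-Civita) connection, and the exponential retraction $R_{p}(\nu)=\operatorname{Exp}_{p}(\nu)$, which is defined when the geodesic leaving $p$ with velocity $\nu$ exists on $[0,1]$. Assume that $\hat\alpha(Z)=\operatorname{argmax}_\alpha L(Z,\alpha)$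 exists for every $Z\in\mathbb R_0^{n\times k}$, and let $pL_Q([Z])=L(Z,\hat\alpha(Z))$. A Newton–Raphson update of $f:\mathcal M\to\mathbb R$ at $p$ is a point $R_p(\nu)$ with $\nu\in T_p\mathcal M$, $\operatorname{Hess}f(p)[\nu]=-\operatorname{Grad}f(p)$. **Proposition.** Let $\check Z\in\mathbb R_0^{n\times k}$, $\check\alpha\in\mathbb R^{n\times T}$, and let $\check{\mathcal U}$ be any matrix whose columns form a basis of the column space of $I_{eff}(\check Z,\check\alpha)$. Then $\operatorname{Hess}pL_Q([\check Z])$ is bijective if and only if $\check{\mathcal U}^\top H_{eff}\{\check Z,\hat\alpha(\check Z)\}\check{\mathcal U}$ is invertible. In that case put $$\bar\nu=-\check{\mathcal U}\bigl[\check{\mathcal U}^\top H_{eff}\{\check Z,\hat\alpha(\check Z)\}\check{\mathcal U}\bigr]^{-1}\check{\mathcal U}^\top S_{eff}\{\check Z,\hat\alpha(\check Z)\}.$$ Then $\operatorname{mat}(\bar\nu)$ is a tangent vector to $\mathbb R_0^{n\times k}$ in the horizontal space at $\check Z$ and is the horizontal lift of the unique solution $\nu\in T_{[\check Z]}\mathcal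 M$ of the Newton equation for $pL_Q$ at $[\check Z]$. The Newton–Raphson update of $pL_Q$ at $[\check Z]$ exists if and only if $\operatorname{mat}(\check Z_v+t\bar\nu)\in\mathbb R_0^{n\times k}$ for all $t\in[0,1]$, and it then equals $$R_{[\check Z]}(\nu)=[\operatorname{mat}(\check Z_v+\bar\nu)].$$ -/

import Mathlib

open Matrix Set Topology
open scoped ContDiff MatrixOrder Manifold

noncomputable section

namespace LatentSpace

/-! ### The orthogonal polar factor of an invertible matrix, and its smoothness -/

section PolarFactor
attribute [local instance] Matrix.linftyOpNormedRing Matrix.linftyOpNormedAlgebra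

variable {k : ℕ}

/-- The orthogonal factor `Bᵀ (B Bᵀ)^(-1/2)`: for invertible `B` it is the unique orthogonal `Q` such
that `B Q` is symmetric positive definite. -/
@[irreducible] def polarFactor (B : Matrix (Fin k) (Fin k) ℝ) : Matrix (Fin k) (Fin k) ℝ :=
  Bᵀ * (CFC.sqrt (B * Bᵀ))⁻¹

lemma posDef_iff_dot (A : Matrix (Fin k) (Fin k) ℝ) :
    A.PosDef ↔ Aᵀ = A ∧ ∀ x : Fin k → ℝ, x ≠ 0 → 0 < x ⬝ᵥ A *ᵥ x := by
  rw [Matrix.posDef_iff_dotProduct_mulVec]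
  simp [Matrix.IsHermitian, Matrix.conjTranspose_eq_transpose_of_trivial]

lemma eventually_dot_pos {A : Matrix (Fin k) (Fin k) ℝ}
    (hA : ∀ x : Fin k → ℝ, x ≠ 0 → 0 < x ⬝ᵥ A *ᵥ x) :
    ∀ᶠ A' in 𝓝 A, ∀ x : Fin k → ℝ, x ≠ 0 → 0 < x ⬝ᵥ A' *ᵥ x := by
  have hc : Continuous fun p : Matrix (Fin k) (Fin k) ℝ × (Fin k → ℝ) => p.2 ⬝ᵥ p.1 *ᵥ p.2 := by
    fun_prop
  have h1 : ∀ᶠ A' in 𝓝 A, ∀ x ∈ Metric.sphere (0 : Fin k → ℝ) 1, 0 < x ⬝ᵥ A' *ᵥ x := by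
    refine (isCompact_sphere (0 : Fin k → ℝ) 1).eventually_forall_of_forall_eventually ?_
    intro x hx
    have hx0 : x ≠ 0 := by
      rintro rfl
      simp at hx
    exact hc.continuousAt.eventually (lt_mem_nhds (hA x hx0))
  filter_upwards [h1] with A' h x hx
  have hn : 0 < ‖x‖ := norm_pos_iff.2 hx
  have := h (‖x‖⁻¹ • x) (by simp [norm_smul, hn.ne'])
  rw [Matrix.mulVec_smul, dotProduct_smul, smul_dotProduct, smul_smul, smul_eq_mul] at this
  exact (pos_iff_pos_of_mul_pos this).1 (by positivity)

lemma sylvester_injective {S X : Matrix (Fin k) (Fin k) ℝ} (hS : S.PosDef)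
    (h : S * X + X * S = 0) : X = 0 := by
  rw [posDef_iff_dot] at hS
  have hnn : ∀ x : Fin k → ℝ, 0 ≤ x ⬝ᵥ S *ᵥ x := fun x => by
    by_cases hx : x = 0
    · simp [hx]
    · exact (hS.2 x hx).le
  have e1 : (Xᵀ * (S * X)).trace = ∑ j, X.col j ⬝ᵥ S *ᵥ X.col j := by
    simp only [Matrix.trace, Matrix.diag, Matrix.mul_apply, dotProduct, mulVec, Matrix.col,
      Matrix.transpose_apply]
  have e2 : (Xᵀ * (X * S)).trace = ∑ i, X.row i ⬝ᵥ S *ᵥ X.row i := by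
    rw [Matrix.trace_mul_comm, Matrix.mul_assoc]
    simp only [Matrix.trace, Matrix.diag, Matrix.mul_apply, dotProduct, mulVec, Matrix.row,
      Matrix.transpose_apply]
  have e3 : ∑ j, X.col j ⬝ᵥ S *ᵥ X.col j + ∑ i, X.row i ⬝ᵥ S *ᵥ X.row i = 0 := by
    rw [← e1, ← e2, ← Matrix.trace_add, ← Matrix.mul_add, h]; simp
  have e4 : ∑ j, X.col j ⬝ᵥ S *ᵥ X.col j = 0 := by
    have a := Finset.sum_nonneg (s := Finset.univ) fun j _ => hnn (X.col j)
    have b := Finset.sum_nonneg (s := Finset.univ) fun j _ => hnn (X.row j)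
    linarith
  ext i j
  rw [Finset.sum_eq_zero_iff_of_nonneg fun j _ => hnn _] at e4
  by_contra hij
  refine absurd (e4 j (Finset.mem_univ _)) (hS.2 _ fun h0 => hij ?_).ne'
  exact congrFun h0 i

lemma contDiffAt_sqrt {G : Type*} [NormedAddCommGroup G] [NormedSpace ℝ G]
    {X : G → Matrix (Fin k) (Fin k) ℝ} {x : G} (hX : ContDiffAt ℝ ∞ X x)
    (hs : ∀ y, (X y)ᵀ = X y) (hp : (X x).PosDef) :
    ContDiffAt ℝ ∞ (fun y => CFC.sqrt (X y)) x := by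
  set S : Matrix (Fin k) (Fin k) ℝ := CFC.sqrt (X x) with hSdef
  have hSS : S * S = X x := CFC.sqrt_mul_sqrt_self _ hp.posSemidef.nonneg
  have hSp : S.PosDef := by
    rw [(CFC.sqrt_nonneg (X x)).posSemidef.posDef_iff_isUnit]
    exact isUnit_of_mul_isUnit_left (hSS ▸ hp.isUnit)
  let D : Matrix (Fin k) (Fin k) ℝ →ₗ[ℝ] Matrix (Fin k) (Fin k) ℝ :=
    LinearMap.mulLeft ℝ S + LinearMap.mulRight ℝ S
  have hDinj : Function.Injective D := by
    rw [injective_iff_map_eq_zero]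
    intro Y hY
    exact sylvester_injective hSp hY
  let D' : Matrix (Fin k) (Fin k) ℝ ≃L[ℝ] Matrix (Fin k) (Fin k) ℝ :=
    (LinearEquiv.ofInjectiveEndo D hDinj).toContinuousLinearEquiv
  let f : Matrix (Fin k) (Fin k) ℝ → Matrix (Fin k) (Fin k) ℝ := fun Y => Y * Y
  have hfc : ContDiffAt ℝ ∞ f S := contDiffAt_id.mul contDiffAt_id
  have hfd : HasFDerivAt f (D' : Matrix (Fin k) (Fin k) ℝ →L[ℝ] Matrix (Fin k) (Fin k) ℝ) S := by
    have := (hasFDerivAt_id (𝕜 := ℝ) S).mul' (hasFDerivAt_id (𝕜 := ℝ) S)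
    refine this.congr_fderiv ?_
    ext1 Y
    rfl
  have hst : HasStrictFDerivAt f (D' : Matrix (Fin k) (Fin k) ℝ →L[ℝ] Matrix (Fin k) (Fin k) ℝ) S :=
    hfc.hasStrictFDerivAt' hfd (by simp)
  let e := hst.toOpenPartialHomeomorph f
  have heS : S ∈ e.source := hst.mem_toOpenPartialHomeomorph_source
  have hef : ∀ Y, e Y = Y * Y := fun Y => rfl
  have heX : X x ∈ e.target := by
    have := e.map_source heS
    rwa [hef, hSS] at this
  have hsymm : e.symm (X x) = S := by rw [← hSS, ← hef, e.left_inv heS]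
  have hgc : ContDiffAt ℝ ∞ e.symm (X x) :=
    e.contDiffAt_symm heX (hsymm ▸ hfd) (hsymm ▸ hfc)
  have hcomp : ContDiffAt ℝ ∞ (fun y => e.symm (X y)) x := hgc.comp x hX
  refine hcomp.congr_of_eventuallyEq ?_
  have c1 : ∀ᶠ y in 𝓝 x, X y ∈ e.target :=
    hX.continuousAt.eventually (e.open_target.mem_nhds heX)
  have hc : ContinuousAt (fun y => e.symm (X y)) x := hcomp.continuousAt
  have c2 : ∀ᶠ y in 𝓝 x, (e.symm (X y))ᵀ ∈ e.source := by
    have : ContinuousAt (fun y => (e.symm (X y))ᵀ) x := by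
      exact (continuous_id.matrix_transpose.continuousAt).comp hc
    refine this.eventually (e.open_source.mem_nhds ?_)
    simp only [hsymm, ((posDef_iff_dot S).1 hSp).1]
    exact heS
  have c3 : ∀ᶠ y in 𝓝 x, ∀ v : Fin k → ℝ, v ≠ 0 → 0 < v ⬝ᵥ (e.symm (X y)) *ᵥ v := by
    have h := eventually_dot_pos ((posDef_iff_dot S).1 hSp).2
    rw [← hsymm] at h
    exact hc.eventually h
  filter_upwards [c1, c2, c3] with y h1 h2 h3
  have hsq : e.symm (X y) * e.symm (X y) = X y := e.right_inv h1
  have hsym : (e.symm (X y))ᵀ = e.symm (X y) := by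
    refine e.injOn h2 (e.map_target h1) ?_
    rw [hef, hef, ← Matrix.transpose_mul, hsq, hs]
  exact CFC.sqrt_unique hsq ((posDef_iff_dot _).2 ⟨hsym, h3⟩).posSemidef.nonneg

end PolarFactor
section PolarFactor2
attribute [local instance] Matrix.linftyOpNormedRing Matrix.linftyOpNormedAlgebra
variable {k : ℕ}

lemma mul_transpose_posDef {B : Matrix (Fin k) (Fin k) ℝ} (hB : B.det ≠ 0) :
    (B * Bᵀ).PosDef := by
  have h : (B * Bᵀ).PosSemidef := by
    simpa [conjTranspose_eq_transpose_of_trivial] using posSemidef_self_mul_conjTranspose B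
  rw [h.posDef_iff_isUnit, Matrix.isUnit_iff_isUnit_det, det_mul, det_transpose]
  exact (mul_ne_zero hB hB).isUnit

lemma sqrt_mul_transpose {B : Matrix (Fin k) (Fin k) ℝ} (hB : B.det ≠ 0) :
    (CFC.sqrt (B * Bᵀ)).PosDef ∧ CFC.sqrt (B * Bᵀ) * CFC.sqrt (B * Bᵀ) = B * Bᵀ := by
  have hp := mul_transpose_posDef hB
  have hSS : CFC.sqrt (B * Bᵀ) * CFC.sqrt (B * Bᵀ) = B * Bᵀ :=
    CFC.sqrt_mul_sqrt_self _ hp.posSemidef.nonneg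
  refine ⟨?_, hSS⟩
  rw [(CFC.sqrt_nonneg (B * Bᵀ)).posSemidef.posDef_iff_isUnit]
  exact isUnit_of_mul_isUnit_left (hSS ▸ hp.isUnit)

lemma mul_polarFactor {B : Matrix (Fin k) (Fin k) ℝ} (hB : B.det ≠ 0) :
    (B * polarFactor B).PosDef := by
  obtain ⟨hS, hSS⟩ := sqrt_mul_transpose hB
  have : B * polarFactor B = CFC.sqrt (B * Bᵀ) := by
    rw [polarFactor]
    generalize CFC.sqrt (B * Bᵀ) = S at *
    rw [← Matrix.mul_assoc, ← hSS, Matrix.mul_assoc,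
      Matrix.mul_nonsing_inv _ ((Matrix.isUnit_iff_isUnit_det _).1 hS.isUnit), Matrix.mul_one]
  rwa [this]

lemma polarFactor_mem {B : Matrix (Fin k) (Fin k) ℝ} (hB : B.det ≠ 0) :
    polarFactor B ∈ orthogonalGroup (Fin k) ℝ := by
  obtain ⟨hS, hSS⟩ := sqrt_mul_transpose hB
  have hu := (Matrix.isUnit_iff_isUnit_det _).1 hS.isUnit
  have hst := ((posDef_iff_dot _).1 hS).1
  rw [mem_orthogonalGroup_iff']
  rw [polarFactor]
  generalize CFC.sqrt (B * Bᵀ) = S at *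
  rw [transpose_mul, transpose_transpose, transpose_nonsing_inv, hst]
  rw [Matrix.mul_assoc, ← Matrix.mul_assoc B, ← hSS, Matrix.mul_assoc, Matrix.mul_nonsing_inv _ hu,
    Matrix.mul_one, Matrix.nonsing_inv_mul _ hu]

lemma polarFactor_mul (B : Matrix (Fin k) (Fin k) ℝ) {R : Matrix (Fin k) (Fin k) ℝ}
    (hR : R ∈ orthogonalGroup (Fin k) ℝ) : polarFactor (B * R) = Rᵀ * polarFactor B := by
  have h := (mem_orthogonalGroup_iff (Fin k) ℝ).1 hR
  have : B * R * (B * R)ᵀ = B * Bᵀ := by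
    rw [transpose_mul, Matrix.mul_assoc, ← Matrix.mul_assoc R, h, Matrix.one_mul]
  rw [polarFactor, polarFactor, this, transpose_mul, Matrix.mul_assoc]

lemma polarFactor_of_posDef {B : Matrix (Fin k) (Fin k) ℝ} (hB : B.PosDef) :
    polarFactor B = 1 := by
  have ht := ((posDef_iff_dot B).1 hB).1
  have : CFC.sqrt (B * Bᵀ) = B := by
    rw [ht]
    exact CFC.sqrt_unique rfl hB.posSemidef.nonneg
  rw [polarFactor, this, ht, Matrix.mul_nonsing_inv _ ((Matrix.isUnit_iff_isUnit_det _).1 hB.isUnit)]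

lemma contDiffAt_polarFactor {G : Type*} [NormedAddCommGroup G] [NormedSpace ℝ G]
    {B : G → Matrix (Fin k) (Fin k) ℝ} {x : G} (hB : ContDiffAt ℝ ∞ B x) (hx : (B x).det ≠ 0) :
    ContDiffAt ℝ ∞ (fun y => polarFactor (B y)) x := by
  have hT : ContDiffAt ℝ ∞ (fun y => (B y)ᵀ) x :=
    ((Matrix.transposeLinearEquiv (Fin k) (Fin k) ℝ ℝ).toContinuousLinearEquiv.contDiff).contDiffAt.comp
      x hB
  obtain ⟨hS, -⟩ := sqrt_mul_transpose hx
  have hsq : ContDiffAt ℝ ∞ (fun y => CFC.sqrt (B y * (B y)ᵀ)) x :=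
    contDiffAt_sqrt (hB.mul hT) (fun y => by simp) (mul_transpose_posDef hx)
  obtain ⟨u, hu⟩ := hS.isUnit
  have hinv : ContDiffAt ℝ ∞ (fun y => Ring.inverse (CFC.sqrt (B y * (B y)ᵀ))) x := by
    have h := contDiffAt_ringInverse ℝ (n := ∞) u
    rw [hu] at h
    exact h.comp x hsq
  simp only [polarFactor, Matrix.nonsing_inv_eq_ringInverse]
  exact hT.mul hinv

end PolarFactor2

/-! ### The parameter space and its quotient -/

/-- Vectorized `n × k` matrices `Z_v`; the Euclidean inner product is `tr(Z₁ᵀ Z₂)`. -/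
abbrev Vec (n k : ℕ) : Type := EuclideanSpace ℝ (Fin n × Fin k)

/-- The matrix `mat(Z_v)` of a vectorized matrix. -/
def mat {n k : ℕ} : Vec n k →ₗ[ℝ] Matrix (Fin n) (Fin k) ℝ where
  toFun v := Matrix.of fun i j => v (i, j)
  map_add' _ _ := rfl
  map_smul' _ _ := rfl

/-- The matrices with `1ₙᵀ Z = 0`. -/
def Centered (n k : ℕ) : Submodule ℝ (Vec n k) where
  carrier := {Z | ∀ j, ∑ i, mat Z i j = 0}
  add_mem' {a b} ha hb j := by simp [Finset.sum_add_distrib, ha j, hb j]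
  zero_mem' j := by simp
  smul_mem' c a ha j := by simp [← Finset.mul_sum, ha j]

section QuotientManifold
attribute [local instance] Matrix.linftyOpNormedRing Matrix.linftyOpNormedAlgebra

variable {n k : ℕ}

/-- `Wᵀ Z`. -/
def crossGram (W Z : Centered n k) : Matrix (Fin k) (Fin k) ℝ := (mat (W : Vec n k))ᵀ * mat (Z : Vec n k)

/-- `Z ↦ Wᵀ Z` as a linear map. -/
def crossGramL (W : Centered n k) : Centered n k →ₗ[ℝ] Matrix (Fin k) (Fin k) ℝ where
  toFun := crossGram W
  map_add' a b := by simp [crossGram, Matrix.mul_add]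
  map_smul' c a := by simp [crossGram]

/-- `Z Q`. -/
def rmul (Z : Centered n k) (Q : Matrix (Fin k) (Fin k) ℝ) : Centered n k :=
  ⟨WithLp.toLp 2 fun p => (mat (Z : Vec n k) * Q) p.1 p.2, fun j => by
    have h : ∀ l, ∑ i, mat (Z : Vec n k) i l = 0 := Z.2
    change ∑ i, (mat (Z : Vec n k) * Q) i j = 0
    simp only [Matrix.mul_apply]
    rw [Finset.sum_comm]
    simp [← Finset.sum_mul, h]⟩

lemma mat_rmul (Z : Centered n k) (Q : Matrix (Fin k) (Fin k) ℝ) :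
    mat (rmul Z Q : Vec n k) = mat (Z : Vec n k) * Q := rfl

lemma mat_injective : Function.Injective (mat : Vec n k → Matrix (Fin n) (Fin k) ℝ) := by
  intro a b h
  ext ⟨i, j⟩
  exact congrFun (congrFun h i) j

lemma centered_ext {a b : Centered n k} (h : mat (a : Vec n k) = mat (b : Vec n k)) : a = b :=
  Subtype.ext (mat_injective h)

lemma crossGram_rmul (W Z : Centered n k) (Q : Matrix (Fin k) (Fin k) ℝ) :
    crossGram W (rmul Z Q) = crossGram W Z * Q := by
  rw [crossGram, mat_rmul, crossGram, Matrix.mul_assoc]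

lemma rmul_rmul (Z : Centered n k) (Q R : Matrix (Fin k) (Fin k) ℝ) :
    rmul (rmul Z Q) R = rmul Z (Q * R) :=
  centered_ext (by simp only [mat_rmul, Matrix.mul_assoc])

lemma rmul_one (Z : Centered n k) : rmul Z 1 = Z := centered_ext (by simp only [mat_rmul, Matrix.mul_one])

lemma contDiff_crossGram (W : Centered n k) : ContDiff ℝ ∞ (crossGram W) :=
  (crossGramL W).toContinuousLinearMap.contDiff

lemma contDiffAt_rmul {G : Type*} [NormedAddCommGroup G] [NormedSpace ℝ G]
    {Z : G → Centered n k} {Q : G → Matrix (Fin k) (Fin k) ℝ} {x : G}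
    (hZ : ContDiffAt ℝ ∞ Z x) (hQ : ContDiffAt ℝ ∞ Q x) :
    ContDiffAt ℝ ∞ (fun y => rmul (Z y) (Q y)) x := by
  let b : Centered n k →ₗ[ℝ] Matrix (Fin k) (Fin k) ℝ →ₗ[ℝ] Centered n k :=
    LinearMap.mk₂ ℝ rmul
      (fun a b c => centered_ext (by simp [mat_rmul, Matrix.add_mul]))
      (fun a b c => centered_ext (by simp [mat_rmul]))
      (fun a b c => centered_ext (by simp [mat_rmul, Matrix.mul_add]))
      (fun a b c => centered_ext (by simp [mat_rmul]))
  let b' : Centered n k →L[ℝ] Matrix (Fin k) (Fin k) ℝ →L[ℝ] Centered n k :=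
    LinearMap.toContinuousLinearMap (LinearMap.toContinuousLinearMap.toLinearMap ∘ₗ b)
  exact (b'.contDiff.contDiffAt.comp x hZ).clm_apply hQ

/-- `ℝ₀^{n×k}`: the centered matrices with `det (Zᵀ Z) ≠ 0`, an open subset of the linear space of
centered matrices. -/
def R0 (n k : ℕ) : TopologicalSpace.Opens (Centered n k) where
  carrier := {Z | ((mat (Z : Vec n k))ᵀ * mat (Z : Vec n k)).det ≠ 0}
  is_open' := by
    refine isOpen_ne.preimage (Continuous.matrix_det ?_)
    have h : Continuous fun Z : Centered n k => mat (Z : Vec n k) :=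
      ((mat : Vec n k →ₗ[ℝ] _).comp (Centered n k).subtype).continuous_of_finiteDimensional
    exact h.matrix_transpose.matrix_mul h

lemma mem_R0 {Z : Centered n k} : Z ∈ R0 n k ↔ (crossGram Z Z).det ≠ 0 := Iff.rfl

lemma mem_R0_of_gram {W Z : Centered n k} (h : (crossGram W Z).det ≠ 0) : Z ∈ R0 n k := by
  rw [mem_R0]
  intro h0
  obtain ⟨x, hx, hx0⟩ := Matrix.exists_mulVec_eq_zero_iff.2 h0
  have h1 : mat (Z : Vec n k) *ᵥ x = 0 := by
    rw [← dotProduct_self_eq_zero, Matrix.dotProduct_mulVec, Matrix.vecMul_mulVec, ← Matrix.dotProduct_mulVec]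
    rw [crossGram] at hx0
    simp [hx0]
  refine h (Matrix.exists_mulVec_eq_zero_iff.1 ⟨x, hx, ?_⟩)
  rw [crossGram, ← Matrix.mulVec_mulVec, h1, Matrix.mulVec_zero]

lemma rmul_mem_R0 {Z : Centered n k} (hZ : Z ∈ R0 n k) {Q : Matrix (Fin k) (Fin k) ℝ}
    (hQ : Q ∈ orthogonalGroup (Fin k) ℝ) : rmul Z Q ∈ R0 n k := by
  have h := (mem_orthogonalGroup_iff (Fin k) ℝ).1 hQ
  have hd : Q.det ≠ 0 := fun h0 => by
    have := congrArg Matrix.det h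
    simp [h0] at this
  refine mem_R0_of_gram (W := Z) ?_
  rw [crossGram_rmul, det_mul]
  exact mul_ne_zero hZ hd

/-- `Z₁ ∼ Z₂` if and only if `Z₂ = Z₁ Q` for some `Q ∈ O(k)`. -/
def rotationSetoid (n k : ℕ) : Setoid (R0 n k) where
  r Z₁ Z₂ := ∃ Q ∈ orthogonalGroup (Fin k) ℝ,
    mat ((Z₂ : Centered n k) : Vec n k) = mat ((Z₁ : Centered n k) : Vec n k) * Q
  iseqv :=
    { refl := fun Z => ⟨1, Submonoid.one_mem _, by simp⟩
      symm := fun {Z₁ Z₂} ⟨Q, hQ, h⟩ => ⟨Qᵀ, by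
        rw [mem_orthogonalGroup_iff, transpose_transpose]
        exact (mem_orthogonalGroup_iff' (Fin k) ℝ).1 hQ, by
        rw [h, Matrix.mul_assoc, (mem_orthogonalGroup_iff (Fin k) ℝ).1 hQ, Matrix.mul_one]⟩
      trans := fun {Z₁ Z₂ Z₃} ⟨Q, hQ, h⟩ ⟨R, hR, h'⟩ => ⟨Q * R, Submonoid.mul_mem _ hQ hR, by
        rw [h', h, Matrix.mul_assoc]⟩ }

/-- The quotient `ℝ₀^{n×k} / O(k)`, with the quotient topology. -/
abbrev QuotM (n k : ℕ) : Type := Quotient (rotationSetoid n k)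

/-- The class `[Z]`. -/
def cls (Z : R0 n k) : QuotM n k := Quotient.mk (rotationSetoid n k) Z

lemma cls_surjective : Function.Surjective (cls : R0 n k → QuotM n k) := Quotient.exists_rep

lemma cls_eq_iff {Z₁ Z₂ : R0 n k} : cls Z₁ = cls Z₂ ↔
    ∃ Q ∈ orthogonalGroup (Fin k) ℝ, (Z₂ : Centered n k) = rmul Z₁ Q := by
  constructor
  · intro h
    obtain ⟨Q, hQ, h⟩ := Quotient.exact h
    exact ⟨Q, hQ, centered_ext h⟩
  · rintro ⟨Q, hQ, h⟩
    exact Quotient.sound ⟨Q, hQ, by rw [h, mat_rmul]⟩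

lemma isQuotientMap_cls : IsQuotientMap (cls : R0 n k → QuotM n k) := isQuotientMap_quotient_mk'

/-! The smooth structure of the quotient. The slice through `W` is the set of the centered `Z` with
`Wᵀ Z` symmetric positive definite, an open subset of the linear space of the centered `Z` with
`Wᵀ Z` symmetric (the orthogonal complement of the tangent space of the orbit of `W`). Each class
`[Z]` with `Wᵀ Z` invertible meets it in exactly one point; in orthonormal coordinates of that linear
space this gives a chart of the quotient, centered at `[W]`. -/

/-- The centered `V` with `Wᵀ V` symmetric. -/
def slice (W : Centered n k) : Submodule ℝ (Centered n k) where
  carrier := {V | (crossGram W V)ᵀ = crossGram W V}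
  add_mem' {a b} ha hb := by
    have e : crossGram W (a + b) = crossGram W a + crossGram W b := (crossGramL W).map_add a b
    simp only [Set.mem_ofPred_eq] at *
    rw [e, transpose_add, ha, hb]
  zero_mem' := by
    have e : crossGram W 0 = 0 := (crossGramL W).map_zero
    simp [e]
  smul_mem' c a ha := by
    have e : crossGram W (c • a) = c • crossGram W a := (crossGramL W).map_smul c a
    simp only [Set.mem_ofPred_eq] at *
    rw [e, transpose_smul, ha]

lemma card_lt_pairs (k : ℕ) :
    2 * Fintype.card {p : Fin k × Fin k // p.1 < p.2} + k = k * k := by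
  have h1 : Fintype.card {p : Fin k × Fin k // p.1 < p.2}
      = (Finset.univ.filter fun p : Fin k × Fin k => p.1 < p.2).card := Fintype.card_subtype _
  have h2 : (Finset.univ.filter fun p : Fin k × Fin k => p.1 < p.2).card
      = (Finset.univ.filter fun p : Fin k × Fin k => p.2 < p.1).card :=
    Finset.card_bij (fun p _ => p.swap) (by simp) (by simp) (by simp)
  have h3 : (Finset.univ.filter fun p : Fin k × Fin k => p.1 = p.2).card = k := by
    have : (Finset.univ.filter fun p : Fin k × Fin k => p.1 = p.2) = Finset.univ.diag := by
      ext ⟨a, b⟩; simp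
    rw [this, Finset.diag_card]; simp
  have h4 : (Finset.univ : Finset (Fin k × Fin k)).card = k * k := by simp
  have h5 : (Finset.univ : Finset (Fin k × Fin k)).card =
      (Finset.univ.filter fun p : Fin k × Fin k => p.1 < p.2).card +
      ((Finset.univ.filter fun p : Fin k × Fin k => p.2 < p.1).card +
      (Finset.univ.filter fun p : Fin k × Fin k => p.1 = p.2).card) := by
    rw [← Finset.card_union_of_disjoint, ← Finset.card_union_of_disjoint]
    · congr 1
      ext ⟨a, b⟩
      simp only [Finset.mem_univ, Finset.mem_union, Finset.mem_filter, true_and, true_iff]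
      rcases lt_trichotomy a b with h | h | h <;> simp [h]
    · rw [Finset.disjoint_left]
      rintro ⟨a, b⟩ ha hb
      simp at ha hb
      rcases hb with hb | hb
      · exact lt_asymm ha hb
      · exact ha.ne hb
    · rw [Finset.disjoint_left]
      rintro ⟨a, b⟩ ha hb
      simp at ha hb
      exact ha.ne' hb
  omega

lemma finrank_slice (W : R0 n k) :
    Module.finrank ℝ (slice (W : Centered n k)) = n * k - k * (k + 1) / 2 := by
  let s : Vec n k →ₗ[ℝ] (Fin k → ℝ) :=
    { toFun := fun v j => ∑ i, mat v i j
      map_add' := fun a b => by ext j; simp [Finset.sum_add_distrib]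
      map_smul' := fun c a => by ext j; simp [Finset.mul_sum] }
  have hs : LinearMap.ker s = Centered n k := by
    ext v
    rw [LinearMap.mem_ker, funext_iff]
    rfl
  have hsurj : Function.Surjective s := by
    intro c
    rcases Nat.eq_zero_or_pos n with hn | hn
    · subst hn
      have hk : k = 0 := by
        by_contra hk
        have : Nonempty (Fin k) := ⟨⟨0, Nat.pos_of_ne_zero hk⟩⟩
        refine W.2 ?_
        have : (mat ((W : Centered 0 k) : Vec 0 k))ᵀ * mat ((W : Centered 0 k) : Vec 0 k) = 0 := by
          ext i j; simp [Matrix.mul_apply]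
        rw [this, Matrix.det_zero]
      subst hk
      exact ⟨0, Subsingleton.elim _ _⟩
    · refine ⟨WithLp.toLp 2 fun p => if p.1 = ⟨0, hn⟩ then c p.2 else 0, ?_⟩
      ext j
      change ∑ i : Fin n, (if i = ⟨0, hn⟩ then c j else 0) = c j
      simp
  let a : Centered n k →ₗ[ℝ] ({p : Fin k × Fin k // p.1 < p.2} → ℝ) :=
    { toFun := fun V p => crossGram W V p.1.1 p.1.2 - crossGram W V p.1.2 p.1.1
      map_add' := fun x y => by
        have e : crossGram W (x + y) = crossGram W x + crossGram W y := (crossGramL (W : Centered n k)).map_add x y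
        ext p; simp [e]; ring
      map_smul' := fun c x => by
        have e : crossGram W (c • x) = c • crossGram W x := (crossGramL (W : Centered n k)).map_smul c x
        ext p; simp [e]; ring }
  have ha : LinearMap.ker a = slice (W : Centered n k) := by
    ext V
    rw [LinearMap.mem_ker, funext_iff]
    change (∀ p : {p : Fin k × Fin k // p.1 < p.2}, _ - _ = (0 : ℝ)) ↔ (crossGram W V)ᵀ = crossGram W V
    constructor
    · intro h
      ext i j
      rw [Matrix.transpose_apply]
      rcases lt_trichotomy i j with hij | hij | hij
      · have := h ⟨(i, j), hij⟩
        dsimp only at this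
        linarith
      · rw [hij]
      · have := h ⟨(j, i), hij⟩
        dsimp only at this
        linarith
    · intro h p
      have := congrFun (congrFun h p.1.1) p.1.2
      rw [Matrix.transpose_apply] at this
      rw [this, sub_self]
  have hasurj : Function.Surjective a := by
    intro c
    let B : Matrix (Fin k) (Fin k) ℝ := Matrix.of fun i j => if h : i < j then c ⟨(i, j), h⟩ else 0
    have hu : IsUnit (crossGram (W : Centered n k) W).det := (mem_R0.1 W.2).isUnit
    refine ⟨rmul W ((crossGram (W : Centered n k) W)⁻¹ * B), ?_⟩
    ext p
    have e : crossGram (W : Centered n k) (rmul W ((crossGram (W : Centered n k) W)⁻¹ * B)) = B := by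
      rw [crossGram_rmul, ← Matrix.mul_assoc, Matrix.mul_nonsing_inv _ hu, Matrix.one_mul]
    change crossGram _ _ _ _ - crossGram _ _ _ _ = _
    rw [e]
    simp [B, p.2, not_lt.2 p.2.le]
  have r1 := LinearMap.finrank_range_add_finrank_ker s
  have r2 := LinearMap.finrank_range_add_finrank_ker a
  rw [LinearMap.range_eq_top.2 hsurj, finrank_top, hs] at r1
  rw [LinearMap.range_eq_top.2 hasurj, finrank_top, ha] at r2
  simp only [Module.finrank_fintype_fun_eq_card, Fintype.card_fin, finrank_euclideanSpace,
    Fintype.card_prod] at r1 r2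
  have hc := card_lt_pairs k
  have hd : k * (k + 1) / 2 = Fintype.card {p : Fin k × Fin k // p.1 < p.2} + k := by
    rw [Nat.mul_add, ← hc]
    omega
  omega

/-- The model space, of dimension `nk - k(k+1)/2`. -/
abbrev Model (n k : ℕ) : Type := EuclideanSpace ℝ (Fin (n * k - k * (k + 1) / 2))

/-- An orthonormal basis of the slice space. -/
@[irreducible] def sliceBasis (W : R0 n k) :
    OrthonormalBasis (Fin (n * k - k * (k + 1) / 2)) ℝ (slice (W : Centered n k)) :=
  (stdOrthonormalBasis ℝ (slice (W : Centered n k))).reindex (finCongr (finrank_slice W))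

/-- The isometric parametrization of the slice space. -/
def param (W : R0 n k) : Model n k →L[ℝ] Centered n k :=
  (slice (W : Centered n k)).subtypeL ∘L
    ((sliceBasis W).repr.symm.toContinuousLinearEquiv : Model n k →L[ℝ] _)

/-- The coordinates of the orthogonal projection to the slice space. -/
def coord (W : R0 n k) : Centered n k →L[ℝ] Model n k :=
  ((sliceBasis W).repr.toContinuousLinearEquiv : _ →L[ℝ] Model n k) ∘L
    (slice (W : Centered n k)).orthogonalProjectionOnto

lemma param_mem (W : R0 n k) (y : Model n k) : param W y ∈ slice (W : Centered n k) :=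
  ((sliceBasis W).repr.symm y).2

lemma coord_param (W : R0 n k) (y : Model n k) : coord W (param W y) = y := by
  simp [coord, param]

lemma param_coord (W : R0 n k) {V : Centered n k} (hV : V ∈ slice (W : Centered n k)) :
    param W (coord W V) = V := by
  have h : (slice (W : Centered n k)).orthogonalProjectionOnto V = ⟨V, hV⟩ :=
    Submodule.orthogonalProjectionOnto_mem_subspace_eq_self (⟨V, hV⟩ : slice (W : Centered n k))
  simp only [coord, param, ContinuousLinearMap.comp_apply, h]
  exact congrArg Subtype.val ((sliceBasis W).repr.symm_apply_apply ⟨V, hV⟩)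

/-- The representative of `[Z]` in the slice through `W`. -/
def align (W : R0 n k) (Z : Centered n k) : Centered n k :=
  rmul Z (polarFactor (crossGram W Z))

lemma align_rmul (W : R0 n k) (Z : Centered n k) {Q : Matrix (Fin k) (Fin k) ℝ}
    (hQ : Q ∈ orthogonalGroup (Fin k) ℝ) : align W (rmul Z Q) = align W Z := by
  rw [align, crossGram_rmul, polarFactor_mul _ hQ, rmul_rmul, ← Matrix.mul_assoc,
    (mem_orthogonalGroup_iff (Fin k) ℝ).1 hQ, Matrix.one_mul, align]

lemma crossGram_align {W : R0 n k} {Z : Centered n k} (h : (crossGram W Z).det ≠ 0) :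
    (crossGram W (align W Z)).PosDef := by
  rw [align, crossGram_rmul]
  exact mul_polarFactor h

lemma align_mem_slice {W : R0 n k} {Z : Centered n k} (h : (crossGram W Z).det ≠ 0) :
    align W Z ∈ slice (W : Centered n k) :=
  ((posDef_iff_dot _).1 (crossGram_align h)).1

lemma align_of_posDef {W : R0 n k} {Z : Centered n k} (h : (crossGram W Z).PosDef) :
    align W Z = Z := by
  rw [align, polarFactor_of_posDef h, rmul_one]

lemma contDiffAt_align (W : R0 n k) {Z : Centered n k} (h : (crossGram W Z).det ≠ 0) :
    ContDiffAt ℝ ∞ (align W) Z :=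
  contDiffAt_rmul contDiffAt_id (contDiffAt_polarFactor (contDiff_crossGram _).contDiffAt h)

lemma det_ne_zero_of_posDef {B : Matrix (Fin k) (Fin k) ℝ} (h : B.PosDef) : B.det ≠ 0 := h.det_pos.ne'

/-- The inverse of the chart at `W`. -/
def sliceMap (W : R0 n k) (y : Model n k) : QuotM n k :=
  open Classical in if h : param W y ∈ R0 n k then cls ⟨param W y, h⟩ else cls W

/-- The chart at `W`, as a function. -/
def sliceCoord (W : R0 n k) : QuotM n k → Model n k :=
  Quotient.lift (fun Z : R0 n k => coord W (align W Z)) fun Z₁ Z₂ h => by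
    obtain ⟨Q, hQ, h⟩ := cls_eq_iff.1 (Quotient.sound h)
    simp only [h, align_rmul W _ hQ]

lemma sliceCoord_cls (W Z : R0 n k) : sliceCoord W (cls Z) = coord W (align W Z) := rfl

/-- The domain of the chart at `W`. -/
def sliceSource (W : R0 n k) : Set (QuotM n k) :=
  {p | ∃ Z : R0 n k, cls Z = p ∧ (crossGram (W : Centered n k) (Z : Centered n k)).det ≠ 0}

lemma mem_sliceSource {W Z : R0 n k} : cls Z ∈ sliceSource W ↔ (crossGram (W : Centered n k) (Z : Centered n k)).det ≠ 0 := by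
  constructor
  · rintro ⟨Z', h, h'⟩
    obtain ⟨Q, hQ, h⟩ := cls_eq_iff.1 h
    rw [h, crossGram_rmul, det_mul]
    refine mul_ne_zero h' fun h0 => ?_
    have := congrArg Matrix.det ((mem_orthogonalGroup_iff (Fin k) ℝ).1 hQ)
    simp [h0] at this
  · intro h
    exact ⟨Z, rfl, h⟩

/-- The range of the chart at `W`. -/
def sliceTarget (W : R0 n k) : Set (Model n k) := {y | (crossGram W (param W y)).PosDef}

lemma sliceMap_of_mem {W : R0 n k} {y : Model n k} (h : param W y ∈ R0 n k) :
    sliceMap W y = cls ⟨param W y, h⟩ := dif_pos h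

lemma mem_R0_of_target {W : R0 n k} {y : Model n k} (h : y ∈ sliceTarget W) : param W y ∈ R0 n k :=
  mem_R0_of_gram (det_ne_zero_of_posDef h)

lemma isOpen_sliceSource (W : R0 n k) : IsOpen (sliceSource W) := by
  rw [← isQuotientMap_cls.isOpen_preimage]
  have : cls ⁻¹' sliceSource W = {Z : R0 n k | (crossGram (W : Centered n k) (Z : Centered n k)).det ≠ 0} := by
    ext Z; exact mem_sliceSource
  rw [this]
  exact isOpen_ne.preimage
    (((contDiff_crossGram (W : Centered n k)).continuous.comp continuous_subtype_val).matrix_det)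

lemma isOpen_sliceTarget (W : R0 n k) : IsOpen (sliceTarget W) := by
  rw [isOpen_iff_mem_nhds]
  intro y hy
  have hc : ContinuousAt (fun y => crossGram W (param W y)) y :=
    ((contDiff_crossGram (W : Centered n k)).continuous.comp (param W).continuous).continuousAt
  filter_upwards [hc.eventually (eventually_dot_pos ((posDef_iff_dot _).1 hy).2)] with z hz
  exact (posDef_iff_dot _).2 ⟨param_mem W z, hz⟩

lemma param_sliceCoord {W Z : R0 n k}
    (h : (crossGram (W : Centered n k) (Z : Centered n k)).det ≠ 0) :
    param W (sliceCoord W (cls Z)) = align W Z := by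
  rw [sliceCoord_cls, param_coord W (align_mem_slice h)]

lemma sliceCoord_mem {W : R0 n k} {p : QuotM n k} (hp : p ∈ sliceSource W) :
    sliceCoord W p ∈ sliceTarget W := by
  obtain ⟨Z, rfl⟩ := cls_surjective p
  have h := mem_sliceSource.1 hp
  have h' := crossGram_align h
  rw [← param_sliceCoord h] at h'
  exact h'

lemma sliceMap_mem {W : R0 n k} {y : Model n k} (hy : y ∈ sliceTarget W) :
    sliceMap W y ∈ sliceSource W := by
  rw [sliceMap_of_mem (mem_R0_of_target hy), mem_sliceSource]
  exact det_ne_zero_of_posDef hy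

lemma sliceMap_eq {W : R0 n k} {y : Model n k} {Z : R0 n k} (h : param W y = Z) :
    sliceMap W y = cls Z := by
  obtain ⟨Z, hZ⟩ := Z
  subst h
  exact sliceMap_of_mem hZ

lemma rmul_polarFactor_mem {W Z : R0 n k}
    (h : (crossGram (W : Centered n k) (Z : Centered n k)).det ≠ 0) :
    rmul (Z : Centered n k) (polarFactor (crossGram (W : Centered n k) (Z : Centered n k))) ∈
      R0 n k :=
  rmul_mem_R0 Z.2 (polarFactor_mem h)

lemma cls_eq_of_align {W Z Y : R0 n k} (hY : (Y : Centered n k) = align W Z)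
    (h : (crossGram (W : Centered n k) (Z : Centered n k)).det ≠ 0) : cls Y = cls Z := by
  rw [eq_comm, cls_eq_iff]
  rw [hY, align]
  exact ⟨_, polarFactor_mem h, rfl⟩

lemma exists_align {W Z : R0 n k}
    (h : (crossGram (W : Centered n k) (Z : Centered n k)).det ≠ 0) :
    ∃ Y : R0 n k, (Y : Centered n k) = align W Z := by
  rw [align]
  exact ⟨⟨_, rmul_polarFactor_mem h⟩, rfl⟩

lemma sliceMap_sliceCoord {W : R0 n k} {p : QuotM n k} (hp : p ∈ sliceSource W) :
    sliceMap W (sliceCoord W p) = p := by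
  obtain ⟨Z, rfl⟩ := cls_surjective p
  have h := mem_sliceSource.1 hp
  obtain ⟨Y, hY⟩ := exists_align h
  rw [← cls_eq_of_align hY h]
  apply sliceMap_eq
  rw [cls_eq_of_align hY h, hY, param_sliceCoord h]

lemma sliceCoord_sliceMap {W : R0 n k} {y : Model n k} (hy : y ∈ sliceTarget W) :
    sliceCoord W (sliceMap W y) = y := by
  rw [sliceMap_of_mem (mem_R0_of_target hy), sliceCoord_cls]
  change coord W (align W (param W y)) = y
  rw [align_of_posDef hy, coord_param]

lemma continuousOn_sliceCoord (W : R0 n k) : ContinuousOn (sliceCoord W) (sliceSource W) := by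
  rw [isQuotientMap_cls.continuousOn_isOpen_iff (isOpen_sliceSource W)]
  intro Z hZ
  have h := (contDiffAt_align W (mem_sliceSource.1 hZ)).continuousAt
  exact ((coord W).continuous.continuousAt.comp
    (h.comp (continuous_subtype_val.continuousAt))).continuousWithinAt

lemma continuousOn_sliceMap (W : R0 n k) : ContinuousOn (sliceMap W) (sliceTarget W) := by
  rw [continuousOn_iff_continuous_domRestrict]
  have : (sliceTarget W).domRestrict (sliceMap W) =
      fun y => cls ⟨param W y.1, mem_R0_of_target y.2⟩ := by
    ext y
    exact sliceMap_of_mem (mem_R0_of_target y.2)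
  rw [this]
  exact isQuotientMap_cls.continuous.comp
    (((param W).continuous.comp continuous_subtype_val).subtype_mk _)

/-- The chart at `W`. -/
def sliceChart (W : R0 n k) : OpenPartialHomeomorph (QuotM n k) (Model n k) where
  toFun := sliceCoord W
  invFun := sliceMap W
  source := sliceSource W
  target := sliceTarget W
  map_source' _ h := sliceCoord_mem h
  map_target' _ h := sliceMap_mem h
  left_inv' _ h := sliceMap_sliceCoord h
  right_inv' _ h := sliceCoord_sliceMap h
  continuousOn_toFun := continuousOn_sliceCoord W
  continuousOn_invFun := continuousOn_sliceMap W
  open_source := isOpen_sliceSource W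
  open_target := isOpen_sliceTarget W

instance instChartedSpaceQuotM : ChartedSpace (Model n k) (QuotM n k) where
  atlas := range sliceChart
  chartAt p := sliceChart p.out
  mem_chart_source p := by
    have h : cls p.out = p := Quotient.out_eq p
    have h' : cls p.out ∈ sliceSource p.out := mem_sliceSource.2 (mem_R0.1 p.out.2)
    rw [h] at h'
    exact h'
  chart_mem_atlas p := mem_range_self _

/-- The quotient is a smooth manifold. -/
instance instIsManifoldQuotM : IsManifold 𝓘(ℝ, Model n k) ∞ (QuotM n k) := by
  refine isManifold_of_contDiffOn _ _ _ ?_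
  rintro _ _ ⟨W, rfl⟩ ⟨W', rfl⟩
  simp only [modelWithCornersSelf_coe, modelWithCornersSelf_coe_symm, Function.comp_id,
    Function.id_comp, preimage_id, range_id, inter_univ]
  intro y hy
  rw [OpenPartialHomeomorph.trans_source] at hy
  have hy1 : y ∈ sliceTarget W := hy.1
  have hy2 : sliceMap W y ∈ sliceSource W' := hy.2
  rw [sliceMap_of_mem (mem_R0_of_target hy1), mem_sliceSource] at hy2
  have hsm : ContDiffAt ℝ ∞ (fun y => coord W' (align W' (param W y))) y :=
    (coord W').contDiff.contDiffAt.comp y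
      ((contDiffAt_align W' hy2).comp y (param W).contDiff.contDiffAt)
  refine (hsm.congr_of_eventuallyEq ?_).contDiffWithinAt
  filter_upwards [(isOpen_sliceTarget W).mem_nhds hy1] with z hz
  change sliceCoord W' (sliceMap W z) = _
  rw [sliceMap_of_mem (mem_R0_of_target hz), sliceCoord_cls]

/-- The projection `Z ↦ [Z]` is smooth. -/
lemma contMDiff_cls : ContMDiff 𝓘(ℝ, Centered n k) 𝓘(ℝ, Model n k) ∞
    (cls : R0 n k → QuotM n k) := by
  intro Z
  rw [contMDiffAt_iff_target]
  refine ⟨isQuotientMap_cls.continuous.continuousAt, ?_⟩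
  have hm : cls Z ∈ sliceSource (cls Z).out := mem_chart_source (Model n k) (cls Z)
  have h := mem_sliceSource.1 hm
  have h1 : ContMDiffAt 𝓘(ℝ, Centered n k) 𝓘(ℝ, Model n k) ∞
     (fun Y : R0 n k => coord (cls Z).out (align (cls Z).out Y)) Z := by
    have a := ((coord (cls Z).out).contDiff.contDiffAt (n := ∞)).comp (Z : Centered n k) (contDiffAt_align (cls Z).out h)
    exact a.contMDiffAt.comp Z (contMDiff_subtype_val Z)
  exact h1

end QuotientManifold

/-! ### Riemannian geometry in charts

A metric tensor on a manifold `M` modelled on `E` is a field of bilinear forms on the tangent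
spaces.  In Mathlib the tangent space at `p` is `E`, identified with the tangent space through the
chart at `p`.  The Riemannian (Levi-Civita) connection is given by the Christoffel symbols. -/
section Riemannian

variable {E : Type*} [NormedAddCommGroup E] [NormedSpace ℝ E]
  {M : Type*} [TopologicalSpace M] [ChartedSpace E M]

/-- A field of continuous bilinear forms on the tangent spaces of `M`. -/
abbrev MetricTensor (E : Type*) [NormedAddCommGroup E] [NormedSpace ℝ E]
    (M : Type*) [TopologicalSpace M] [ChartedSpace E M] : Type _ :=
  ∀ p : M, TangentSpace 𝓘(ℝ, E) p →L[ℝ] TangentSpace 𝓘(ℝ, E) p →L[ℝ] ℝ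

/-- The coordinate expression of the metric in the chart at `p`, at the coordinate point `y`:
the pull-back of `g` under the inverse of the chart. -/
def chartMetric (g : MetricTensor E M) (p : M) (y : E) : E →L[ℝ] E →L[ℝ] ℝ :=
  let D : E →L[ℝ] E := mfderiv 𝓘(ℝ, E) 𝓘(ℝ, E) (chartAt E p).symm y
  let G : E →L[ℝ] E →L[ℝ] ℝ := g ((chartAt E p).symm y)
  G.bilinearComp D D

/-- The Christoffel symbol `Γ(u, v)` in the chart at `p`, at the coordinate point `y`: the vector
with `g (Γ(u, v), w) = (∂_u g (v, w) + ∂_v g (u, w) - ∂_w g (u, v)) / 2` for all `w`. -/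
def christoffel (g : MetricTensor E M) (p : M) (y u v : E) : E :=
  (chartMetric g p y).inverse
    ((1 / 2 : ℝ) • (fderiv ℝ (chartMetric g p) y u v + fderiv ℝ (chartMetric g p) y v u
      - fderiv ℝ (fun y' => chartMetric g p y' u v) y))

/-- The coordinate expression of a vector field in the chart at `p`. -/
def vectorInChart (X : ∀ q : M, TangentSpace 𝓘(ℝ, E) q) (p : M) (y : E) : E :=
  mfderiv 𝓘(ℝ, E) 𝓘(ℝ, E) (chartAt E p) ((chartAt E p).symm y) (X ((chartAt E p).symm y))

/-- The Levi-Civita covariant derivative `∇_u X` at `p`, computed in the chart at `p`. -/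
def leviCivita (g : MetricTensor E M) (X : ∀ q : M, TangentSpace 𝓘(ℝ, E) q) (p : M)
    (u : TangentSpace 𝓘(ℝ, E) p) : TangentSpace 𝓘(ℝ, E) p :=
  let y : E := chartAt E p p
  let u' : E := u
  (fderiv ℝ (vectorInChart X p) y u' + christoffel g p y u' (vectorInChart X p y) : E)

/-- The Riemannian gradient: `g (Grad f, v) = df (v)`. -/
def riemGrad (g : MetricTensor E M) (f : M → ℝ) (p : M) : TangentSpace 𝓘(ℝ, E) p :=
  (g p).inverse (mvfderiv 𝓘(ℝ, E) f p)

/-- The Riemannian Hessian, as the endomorphism `ξ ↦ ∇_ξ Grad f` of the tangent space. -/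
def riemHess (g : MetricTensor E M) (f : M → ℝ) (p : M) (ξ : TangentSpace 𝓘(ℝ, E) p) :
    TangentSpace 𝓘(ℝ, E) p :=
  leviCivita g (riemGrad g f) p ξ

/-- `γ` is a geodesic on `s`: it is twice continuously differentiable near every `t ∈ s`, and
its acceleration `γ'' + Γ(γ', γ')`, computed in the chart at `γ t`, vanishes. -/
def IsGeodesicOn (g : MetricTensor E M) (γ : ℝ → M) (s : Set ℝ) : Prop :=
  ∀ t ∈ s, ContMDiffAt 𝓘(ℝ, ℝ) 𝓘(ℝ, E) 2 γ t ∧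
    let c : ℝ → E := fun τ => chartAt E (γ t) (γ τ)
    deriv (deriv c) t + christoffel g (γ t) (c t) (deriv c t) (deriv c t) = 0

/-- The graph of the exponential retraction `R_p(ν) = Exp_p(ν)`: the geodesic which leaves `p` with
velocity `ν` exists on `[0, 1]` and reaches `q` at time `1`. -/
def IsExp (g : MetricTensor E M) (v : TangentBundle 𝓘(ℝ, E) M) (q : M) : Prop :=
  ∃ γ : ℝ → M, IsGeodesicOn g γ (Icc 0 1) ∧
    tangentMap 𝓘(ℝ, ℝ) 𝓘(ℝ, E) γ ⟨0, (1 : ℝ)⟩ = v ∧ γ 1 = q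

/-- `q` is a Newton-Raphson update of `f` at `p`, with the exponential retraction: `q = R_p(ν)` for
a tangent vector `ν` with `Hess f (p) [ν] = - Grad f (p)`. -/
def IsNewtonUpdate (g : MetricTensor E M) (f : M → ℝ) (p q : M) : Prop :=
  ∃ ν : TangentSpace 𝓘(ℝ, E) p, riemHess g f p ν = -riemGrad g f p ∧ IsExp g ⟨p, ν⟩ q

end Riemannian

/-! ### The quotient metric -/
section QuotientMetric

variable {n k : ℕ}

/-- The differential of the projection `Z ↦ [Z]`; the tangent space of the open subset
`ℝ₀^{n×k}` of the space of centered matrices is the space of centered matrices. -/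
def dcls (Z : R0 n k) : Centered n k →L[ℝ] TangentSpace 𝓘(ℝ, Model n k) (cls Z) :=
  mfderiv 𝓘(ℝ, Centered n k) 𝓘(ℝ, Model n k) (cls : R0 n k → QuotM n k) Z

/-- The horizontal space at `Z`: the orthogonal complement, for `g_Z(X, Y) = tr(Xᵀ Y)`, of the
vertical space `ker d[·]_Z`. -/
def horizontal (Z : R0 n k) : Submodule ℝ (Centered n k) := (LinearMap.ker (dcls Z).toLinearMap)ᗮ

/-- The horizontal lift at `Z` of a tangent vector at `[Z]`. -/
def horizontalLift (Z : R0 n k) : TangentSpace 𝓘(ℝ, Model n k) (cls Z) →L[ℝ] Centered n k :=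
  (horizontal Z).subtypeL ∘L ((dcls Z) ∘L (horizontal Z).subtypeL).inverse

/-- The Riemannian metric induced on the quotient: the trace inner product of horizontal lifts (at
a representative of the class; right multiplication by `O(k)` is isometric, so that the
representative does not matter). -/
def quotMetric (n k : ℕ) : MetricTensor (Model n k) (QuotM n k) := fun p =>
  let L : Model n k →L[ℝ] Centered n k := horizontalLift p.out
  (innerSL ℝ : Centered n k →L[ℝ] Centered n k →L[ℝ] ℝ).bilinearComp L L

end QuotientMetric

/-! ### The Poisson latent space model -/
section PoissonModel

variable {n k T : ℕ}

/-- The pairs `i ≤ j` of nodes. -/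
abbrev NodePair (n : ℕ) : Type := {p : Fin n × Fin n // p.1 ≤ p.2}

/-- The observed counts `A_{t,ij}`, `i ≤ j` (with `A_{t,ji} = A_{t,ij}`). -/
abbrev Data (n T : ℕ) : Type := Fin T × NodePair n → ℕ

/-- `α_{it} + α_{jt} + ⟨z_i, z_j⟩`; the vectorized `α` has the coordinate `α_{it}` at `(t, i)`. -/
def linPred (z : Vec n k) (α : Vec T n) (s : Fin T × NodePair n) : ℝ :=
  α (s.1, s.2.1.1) + α (s.1, s.2.1.2) + ∑ l, z (s.2.1.1, l) * z (s.2.1.2, l)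

/-- The log-likelihood `L(Z, α)`. -/
def logLik (A : Data n T) (z : Vec n k) (α : Vec T n) : ℝ :=
  ∑ t : Fin T, ∑ p : NodePair n,
    ((A (t, p) : ℝ) * linPred z α (t, p) - Real.exp (linPred z α (t, p)))

/-- The law of the data: independent Poisson counts with means `exp(α_{it} + α_{jt} + ⟨z_i, z_j⟩)`. -/
def dataLaw (z : Vec n k) (α : Vec T n) : MeasureTheory.Measure (Data n T) :=
  MeasureTheory.Measure.pi fun s =>
    ProbabilityTheory.poissonMeasure (Real.toNNReal (Real.exp (linPred z α s)))

/-- `∂L/∂Z_v`. -/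
def scoreZ (A : Data n T) (z : Vec n k) (α : Vec T n) : Fin n × Fin k → ℝ := fun a =>
  lineDeriv ℝ (fun z' => logLik A z' α) z (EuclideanSpace.single a 1)

/-- `∂L/∂α_v`. -/
def scoreAlpha (A : Data n T) (z : Vec n k) (α : Vec T n) : Fin T × Fin n → ℝ := fun b =>
  lineDeriv ℝ (fun α' => logLik A z α') α (EuclideanSpace.single b 1)

/-- `E(L̇_Z L̇_αᵀ)`, the expectation being taken under the parameters `(Z, α)`. -/
def infoZAlpha (z : Vec n k) (α : Vec T n) : Matrix (Fin n × Fin k) (Fin T × Fin n) ℝ :=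
  Matrix.of fun a b => ∫ A, scoreZ A z α a * scoreAlpha A z α b ∂dataLaw z α

/-- `E(L̇_α L̇_αᵀ)`. -/
def infoAlpha (z : Vec n k) (α : Vec T n) : Matrix (Fin T × Fin n) (Fin T × Fin n) ℝ :=
  Matrix.of fun a b => ∫ A, scoreAlpha A z α a * scoreAlpha A z α b ∂dataLaw z α

/-- The efficient score `L̇_Z - E(L̇_Z L̇_αᵀ) E(L̇_α L̇_αᵀ)⁻¹ L̇_α`. -/
def Seff (A : Data n T) (z : Vec n k) (α : Vec T n) : Fin n × Fin k → ℝ :=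
  scoreZ A z α - (infoZAlpha z α * (infoAlpha z α)⁻¹) *ᵥ scoreAlpha A z α

/-- The efficient Fisher information `E(S_eff S_effᵀ)`. -/
def Ieff (z : Vec n k) (α : Vec T n) : Matrix (Fin n × Fin k) (Fin n × Fin k) ℝ :=
  Matrix.of fun a b => ∫ A, Seff A z α a * Seff A z α b ∂dataLaw z α

/-- `L̈_{Z,Z}`. -/
def hessZZ (A : Data n T) (z : Vec n k) (α : Vec T n) :
    Matrix (Fin n × Fin k) (Fin n × Fin k) ℝ :=
  Matrix.of fun a b => lineDeriv ℝ (fun z' => scoreZ A z' α a) z (EuclideanSpace.single b 1)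

/-- `L̈_{Z,α}`. -/
def hessZAlpha (A : Data n T) (z : Vec n k) (α : Vec T n) :
    Matrix (Fin n × Fin k) (Fin T × Fin n) ℝ :=
  Matrix.of fun a b => lineDeriv ℝ (fun α' => scoreZ A z α' a) α (EuclideanSpace.single b 1)

/-- `L̈_{α,Z}`. -/
def hessAlphaZ (A : Data n T) (z : Vec n k) (α : Vec T n) :
    Matrix (Fin T × Fin n) (Fin n × Fin k) ℝ :=
  Matrix.of fun a b => lineDeriv ℝ (fun z' => scoreAlpha A z' α a) z (EuclideanSpace.single b 1)

/-- `L̈_{α,α}`. -/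
def hessAlphaAlpha (A : Data n T) (z : Vec n k) (α : Vec T n) :
    Matrix (Fin T × Fin n) (Fin T × Fin n) ℝ :=
  Matrix.of fun a b => lineDeriv ℝ (fun α' => scoreAlpha A z α' a) α (EuclideanSpace.single b 1)

/-- `H_eff = L̈_{Z,Z} - L̈_{Z,α} L̈_{α,α}⁻¹ L̈_{α,Z}`; minus the observed efficient information. -/
def Heff (A : Data n T) (z : Vec n k) (α : Vec T n) :
    Matrix (Fin n × Fin k) (Fin n × Fin k) ℝ :=
  hessZZ A z α - hessZAlpha A z α * (hessAlphaAlpha A z α)⁻¹ * hessAlphaZ A z α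

/-- `α̂(Z)`, the maximizer of `α ↦ L(Z, α)` (unique if it exists, by strict concavity). -/
def alphaHat (A : Data n T) (z : Vec n k) : Vec T n :=
  Classical.epsilon fun α => IsMaxOn (fun α' => logLik A z α') univ α

/-- The profile log-likelihood `pL(Z) = L(Z, α̂(Z))`. -/
def profileLogLik (A : Data n T) (z : Vec n k) : ℝ := logLik A z (alphaHat A z)

lemma logLik_rotate (A : Data n T) {z₁ z₂ : Vec n k} {Q : Matrix (Fin k) (Fin k) ℝ}
    (hQ : Q ∈ orthogonalGroup (Fin k) ℝ) (h : mat z₂ = mat z₁ * Q) (α : Vec T n) :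
    logLik A z₂ α = logLik A z₁ α := by
  have hG : mat z₂ * (mat z₂)ᵀ = mat z₁ * (mat z₁)ᵀ := by
    rw [h, transpose_mul, Matrix.mul_assoc, ← Matrix.mul_assoc Q,
      (mem_orthogonalGroup_iff (Fin k) ℝ).1 hQ, Matrix.one_mul]
  have hl : ∀ s, linPred z₂ α s = linPred z₁ α s := by
    intro s
    have e := congrFun (congrFun hG s.2.1.1) s.2.1.2
    rw [Matrix.mul_apply, Matrix.mul_apply] at e
    unfold linPred
    exact congrArg _ e
  simp only [logLik, hl]

/-- The function `pL_Q([Z]) = pL(Z)` on the quotient. -/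
def profileQuot (A : Data n T) : QuotM n k → ℝ :=
  Quotient.lift (fun Z : R0 n k => profileLogLik A ((Z : Centered n k) : Vec n k))
    fun Z₁ Z₂ h => by
      obtain ⟨Q, hQ, h⟩ := h
      have e : ∀ α, logLik A ((Z₂ : Centered n k) : Vec n k) α
          = logLik A ((Z₁ : Centered n k) : Vec n k) α := logLik_rotate A hQ h
      simp only [profileLogLik, alphaHat, e]

/-- The columns of `U` form a basis of the column space of `I`. -/
def IsColumnBasis {ι κ : Type*} [Fintype κ] {r : ℕ} (U : Matrix ι (Fin r) ℝ)
    (I : Matrix ι κ ℝ) : Prop :=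
  LinearIndependent ℝ U.col ∧
    Submodule.span ℝ (range U.col) = Submodule.span ℝ (range I.col)

/-- `ν̄ = -U (Uᵀ H U)⁻¹ Uᵀ S`, in vectorized form. -/
def newtonVector {r : ℕ} (U : Matrix (Fin n × Fin k) (Fin r) ℝ)
    (H : Matrix (Fin n × Fin k) (Fin n × Fin k) ℝ) (S : Fin n × Fin k → ℝ) : Vec n k :=
  WithLp.toLp 2 (-((U * (Uᵀ * H * U)⁻¹ * Uᵀ) *ᵥ S))

end PoissonModel

end LatentSpace

end

open LatentSpace

noncomputable section

namespace LatentSpace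

/-! ### The horizontal and vertical spaces, and rotation invariance -/

section Rotation
attribute [local instance] Matrix.linftyOpNormedRing Matrix.linftyOpNormedAlgebra

variable {n k : ℕ}

/-! The tangent space of the orbit of `Z` consists of the `ZΩ` with `Ω` skew. Its orthogonal
complement among the centered matrices, the horizontal space, is `slice Z`: the `V` with `ZᵀV`
symmetric (`slice_eq`, `horizontal_eq`). The proof combines three independent facts.

Geometry. The chart at `[W]` uses linear coordinates on the slice through a representative `W`. A
vector that is horizontal at `W` has at a nearby point `Y` of the slice a vertical part of size
`O(‖Y - W‖)`. The quotient metric differs from the flat one by a product of two such parts, hence to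
second order only, and the Christoffel symbols vanish at the center of every chart
(`christoffel_self`). So gradient, Hessian and acceleration at a point are those of the flat slice:
for a rotation invariant `f` the Riemannian Hessian is the ordinary second derivative of `f`
restricted to horizontal vectors (`riemHess_quot`, `inner_hessMap`). Moreover a horizontal line `Z +
tV` stays horizontal and is affine in the chart at each of its points, so that it projects to a
geodesic (`isGeodesicOn_line`). That no other geodesic has the same initial velocity, even if the
line leaves `ℝ₀^{n×k}`, is seen through the Gram matrix `ZZᵀ`, which separates the classes. Along a
geodesic with horizontal velocity `X` its second derivative is `2XXᵀ`, a locally Lipschitz function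
of the Gram matrix and its first derivative (`exists_gram_estimate`). Grönwall's inequality
identifies it with the Gram matrix of the line (`gram_geodesic_eq_line`), and equality of Gram
matrices forces the line to keep full rank.

Statistics. The efficient score is a matrix `N` times the centered counts, whose covariance is a
positive diagonal matrix `D`, so the efficient information is `N D Nᵀ`. Its kernel is `ker Nᵀ`, the
directions of `Z` whose effect on the linear predictor can be imitated by a change of `α`. The
orthogonal complement of these directions is exactly `slice Z`, whatever `α` is
(`mem_span_Ieff_iff`). Thus the columns of `U` form a basis of the horizontal space.

Calculus. The log-likelihood is strictly concave in `α`, so `α̂(Z)` is the only critical point, and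
it is smooth by the implicit function theorem. The envelope theorem and a Schur complement give the
first and second derivatives of the profile likelihood as `S_eff` and `H_eff` at `α̂`
(`fderiv_profileLogLik`, `fderiv_fderiv_profileLogLik`).

In the basis `U` the Newton equation therefore reads `UᵀHU w = -UᵀS`, and the exponential map
follows the line `Z + tV` with `V = U w`. -/

lemma inner_eq_trace (a b : Centered n k) : inner ℝ a b = (crossGram a b).trace := by
  rw [Submodule.coe_inner, PiLp.inner_apply, Fintype.sum_prod_type_right]
  simp only [Matrix.trace, Matrix.diag, crossGram, Matrix.mul_apply, Matrix.transpose_apply]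
  exact Finset.sum_congr rfl fun j _ => Finset.sum_congr rfl fun i _ => mul_comm _ _

lemma rmul_crossGram (Z V : Centered n k) (Q : Matrix (Fin k) (Fin k) ℝ) :
    crossGram (rmul Z Q) V = Qᵀ * crossGram Z V := by
  rw [crossGram, mat_rmul, crossGram, transpose_mul, Matrix.mul_assoc]

lemma transpose_crossGram (Z V : Centered n k) : (crossGram Z V)ᵀ = crossGram V Z := by
  rw [crossGram, crossGram, transpose_mul, transpose_transpose]

lemma orth_mul_transpose {Q : Matrix (Fin k) (Fin k) ℝ} (hQ : Q ∈ orthogonalGroup (Fin k) ℝ) :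
    Q * Qᵀ = 1 := (mem_orthogonalGroup_iff (Fin k) ℝ).1 hQ

lemma orth_transpose_mul {Q : Matrix (Fin k) (Fin k) ℝ} (hQ : Q ∈ orthogonalGroup (Fin k) ℝ) :
    Qᵀ * Q = 1 := (mem_orthogonalGroup_iff' (Fin k) ℝ).1 hQ

lemma inner_rmul_rmul {Q : Matrix (Fin k) (Fin k) ℝ} (hQ : Q ∈ orthogonalGroup (Fin k) ℝ)
    (a b : Centered n k) : inner ℝ (rmul a Q) (rmul b Q) = inner ℝ a b := by
  rw [inner_eq_trace, inner_eq_trace, crossGram_rmul, rmul_crossGram, Matrix.trace_mul_comm,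
    ← Matrix.mul_assoc, orth_mul_transpose hQ, Matrix.one_mul]

/-- `(Z, Q) ↦ Z Q` as a continuous bilinear map. -/
def rmulL : Centered n k →L[ℝ] Matrix (Fin k) (Fin k) ℝ →L[ℝ] Centered n k :=
  LinearMap.toContinuousLinearMap (LinearMap.toContinuousLinearMap.toLinearMap ∘ₗ
    LinearMap.mk₂ ℝ rmul
      (fun a b c => centered_ext (by simp [mat_rmul, Matrix.add_mul]))
      (fun a b c => centered_ext (by simp [mat_rmul]))
      (fun a b c => centered_ext (by simp [mat_rmul, Matrix.mul_add]))
      (fun a b c => centered_ext (by simp [mat_rmul])))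

lemma rmulL_apply (Z : Centered n k) (Q : Matrix (Fin k) (Fin k) ℝ) : rmulL Z Q = rmul Z Q := rfl

/-- `Z ↦ Z Q` as a continuous linear map. -/
def rmulRight (Q : Matrix (Fin k) (Fin k) ℝ) : Centered n k →L[ℝ] Centered n k := rmulL.flip Q

lemma rmulRight_apply (Z : Centered n k) (Q : Matrix (Fin k) (Fin k) ℝ) :
    rmulRight Q Z = rmul Z Q := rfl

/-- The skew-symmetric matrices. -/
def skew (k : ℕ) : Submodule ℝ (Matrix (Fin k) (Fin k) ℝ) where
  carrier := {Ω | Ωᵀ = -Ω}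
  add_mem' {a b} ha hb := by
    simp only [Set.mem_ofPred_eq] at *
    rw [transpose_add, ha, hb, neg_add]
  zero_mem' := by simp
  smul_mem' c a ha := by
    simp only [Set.mem_ofPred_eq] at *
    rw [transpose_smul, ha, smul_neg]

/-- The tangent space at `Z` of the orbit of `Z`. -/
def vertical (Z : Centered n k) : Submodule ℝ (Centered n k) :=
  (skew k).map (rmulL Z).toLinearMap

/-- The inner product of `ZΩ` and `V` is `tr(Ωᵀ ZᵀV)`, and the symmetric matrices are the trace
complement of the skew ones. -/
lemma slice_eq (Z : Centered n k) : slice Z = (vertical Z)ᗮ := by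
  ext V
  rw [Submodule.mem_orthogonal]
  constructor
  · rintro hV _ ⟨Ω, hΩ, rfl⟩
    have hV : (crossGram Z V)ᵀ = crossGram Z V := hV
    have hΩ : Ωᵀ = -Ω := hΩ
    change inner ℝ (rmul Z Ω) V = 0
    rw [inner_eq_trace, rmul_crossGram]
    have h1 : (Ωᵀ * crossGram Z V).trace = -(Ωᵀ * crossGram Z V).trace := by
      conv_lhs => rw [← trace_transpose, transpose_mul, hV, transpose_transpose, trace_mul_comm]
      rw [hΩ, Matrix.neg_mul, trace_neg, neg_neg]
    linarith
  -- Testing against `Ω = B - Bᵀ` with `B = ZᵀV` gives `‖B - Bᵀ‖² = 2 tr((B - Bᵀ)ᵀB) = 0`.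
  · intro h
    have h1 := h (rmul Z (crossGram Z V - (crossGram Z V)ᵀ))
      ⟨crossGram Z V - (crossGram Z V)ᵀ, by
        change _ᵀ = -_
        rw [transpose_sub, transpose_transpose, neg_sub], rfl⟩
    rw [inner_eq_trace, rmul_crossGram] at h1
    change (crossGram Z V)ᵀ = crossGram Z V
    generalize crossGram Z V = B at *
    have h2 : ((B - Bᵀ)ᵀ * (B - Bᵀ)).trace = 0 := by
      have e : ((B - Bᵀ)ᵀ * Bᵀ).trace = - ((B - Bᵀ)ᵀ * B).trace := by
        rw [← trace_transpose, transpose_mul, transpose_transpose, transpose_transpose,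
          trace_mul_comm, ← trace_neg, ← Matrix.neg_mul, transpose_sub, transpose_transpose, neg_sub]
      rw [Matrix.mul_sub, trace_sub, e, h1]
      simp
    have h3 : B - Bᵀ = 0 := by
      have := (Matrix.trace_conjTranspose_mul_self_eq_zero_iff (A := B - Bᵀ)).1
      rw [conjTranspose_eq_transpose_of_trivial] at this
      exact this h2
    exact (sub_eq_zero.1 h3).symm

lemma slice_orthogonal (Z : Centered n k) : (slice Z)ᗮ = vertical Z := by
  rw [slice_eq, Submodule.orthogonal_orthogonal]

lemma mem_slice_iff {Z V : Centered n k} : V ∈ slice Z ↔ (crossGram Z V)ᵀ = crossGram Z V := Iff.rfl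

lemma self_mem_slice (Z : Centered n k) : Z ∈ slice Z := transpose_crossGram Z Z

lemma rmul_mem_slice {Z V : Centered n k} (hV : V ∈ slice Z) (Q : Matrix (Fin k) (Fin k) ℝ) :
    rmul V Q ∈ slice (rmul Z Q) := by
  rw [mem_slice_iff] at *
  rw [crossGram_rmul, rmul_crossGram, transpose_mul, transpose_mul, transpose_transpose, hV,
    Matrix.mul_assoc]

end Rotation

/-- Supplies the curves `t ↦ Z exp(tΩ)` inside an orbit, with velocity `ZΩ` at `t = 0`. -/
lemma exp_mem_orthogonalGroup {k : ℕ} {Ω : Matrix (Fin k) (Fin k) ℝ} (hΩ : Ω ∈ skew k) :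
    NormedSpace.exp Ω ∈ orthogonalGroup (Fin k) ℝ := by
  have hΩ : Ωᵀ = -Ω := hΩ
  have hu : IsUnit (NormedSpace.exp Ω) := Matrix.isUnit_exp Ω
  rw [mem_orthogonalGroup_iff, ← Matrix.exp_transpose, hΩ, Matrix.exp_neg,
    Matrix.mul_nonsing_inv _ ((Matrix.isUnit_iff_isUnit_det _).1 hu)]

/-! ### Derivatives of rotation invariant maps and of the alignment -/

section Invariance
attribute [local instance] Matrix.linftyOpNormedRing Matrix.linftyOpNormedAlgebra

variable {n k : ℕ}

/-- Functions of the orbits. -/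
def RotationInvariant {E : Type*} (g : Centered n k → E) : Prop :=
  ∀ Z, ∀ Q ∈ orthogonalGroup (Fin k) ℝ, g (rmul Z Q) = g Z

lemma rotationInvariant_align (W : R0 n k) : RotationInvariant (align W) :=
  fun Z _ hQ => align_rmul W Z hQ

section Invariant
variable {E : Type*} [NormedAddCommGroup E] [NormedSpace ℝ E] {g : Centered n k → E}

/-- `g` is constant along the curve `t ↦ Z exp(tΩ)`. -/
lemma RotationInvariant.fderiv_vertical (hg : RotationInvariant g) {Z V : Centered n k}
    (hd : DifferentiableAt ℝ g Z) (hV : V ∈ vertical Z) : fderiv ℝ g Z V = 0 := by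
  obtain ⟨Ω, hΩ, rfl⟩ := hV
  have h1 : HasDerivAt (fun t : ℝ => rmulL Z (NormedSpace.exp (t • Ω))) (rmulL Z Ω) 0 := by
    have := hasDerivAt_exp_smul_const Ω (0 : ℝ)
    rw [zero_smul, NormedSpace.exp_zero, one_mul] at this
    exact (rmulL Z).hasFDerivAt.comp_hasDerivAt 0 this
  have h0 : rmulL Z (NormedSpace.exp ((0 : ℝ) • Ω)) = Z := by
    rw [zero_smul, NormedSpace.exp_zero, rmulL_apply, rmul_one]
  have h2 : HasDerivAt (g ∘ fun t : ℝ => rmulL Z (NormedSpace.exp (t • Ω)))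
      (fderiv ℝ g Z (rmulL Z Ω)) 0 := by
    refine HasFDerivAt.comp_hasDerivAt 0 ?_ h1
    rw [h0]
    exact hd.hasFDerivAt
  have h3 : (g ∘ fun t : ℝ => rmulL Z (NormedSpace.exp (t • Ω))) = fun _ => g Z := by
    ext t
    exact hg Z _ (exp_mem_orthogonalGroup ((skew k).smul_mem t hΩ))
  rw [h3] at h2
  exact h2.unique (hasDerivAt_const _ _)

lemma RotationInvariant.fderiv_rmul (hg : RotationInvariant g) {Z : Centered n k}
    {Q : Matrix (Fin k) (Fin k) ℝ} (hQ : Q ∈ orthogonalGroup (Fin k) ℝ)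
    (hd : DifferentiableAt ℝ g (rmul Z Q)) (V : Centered n k) :
    fderiv ℝ g (rmul Z Q) (rmul V Q) = fderiv ℝ g Z V := by
  have h1 : g = g ∘ rmulRight Q := by
    ext Z
    exact (hg Z Q hQ).symm
  have h2 : HasFDerivAt (g ∘ rmulRight Q) ((fderiv ℝ g (rmul Z Q)).comp (rmulRight Q)) Z :=
    HasFDerivAt.comp Z (g := g) hd.hasFDerivAt (rmulRight Q).hasFDerivAt
  rw [← h1] at h2
  rw [h2.fderiv]
  rfl

end Invariant

/-- Adjointness of `coord` and `param`; it moves pairings from the model space to the centered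
matrices. -/
lemma inner_coord (W : R0 n k) (x : Centered n k) (v : Model n k) :
    inner ℝ (coord W x) v = inner ℝ x (param W v) := by
  have h : inner ℝ (coord W x) v
      = inner ℝ ((slice (W : Centered n k)).orthogonalProjectionOnto x)
        ((sliceBasis W).repr.symm v) := by
    conv_lhs => rw [← (sliceBasis W).repr.apply_symm_apply v]
    exact (sliceBasis W).repr.inner_map_map _ _
  rw [h, real_inner_comm, Submodule.inner_orthogonalProjectionOnto_eq_of_mem_left, real_inner_comm]
  rfl

lemma inner_param_param (W : R0 n k) (u v : Model n k) :
    inner ℝ (param W u) (param W v) = inner ℝ u v := by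
  rw [← inner_coord, coord_param]

lemma norm_param (W : R0 n k) (u : Model n k) : ‖param W u‖ = ‖u‖ := by
  rw [@norm_eq_sqrt_real_inner _ _ _ (param W u), inner_param_param, ← norm_eq_sqrt_real_inner]

lemma coord_of_mem_vertical (W : R0 n k) {x : Centered n k} (hx : x ∈ vertical (W : Centered n k)) :
    coord W x = 0 := by
  rw [← slice_orthogonal] at hx
  refine ext_inner_right ℝ fun v => ?_
  rw [inner_coord, inner_zero_left]
  exact Submodule.inner_left_of_mem_orthogonal (param_mem W v) hx

/-- Positivity of the quadratic form is an open condition, and symmetry is membership in the slice.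
Near `Y` the alignment is therefore trivial on the slice. -/
lemma eventually_crossGram_posDef (W : R0 n k) {Y : Centered n k}
    (h : (crossGram (W : Centered n k) Y).PosDef) :
    ∀ᶠ Z in 𝓝 Y, Z ∈ slice (W : Centered n k) → (crossGram (W : Centered n k) Z).PosDef := by
  have hc := (contDiff_crossGram (W : Centered n k)).continuous.continuousAt (x := Y)
  filter_upwards [hc.eventually (eventually_dot_pos ((posDef_iff_dot _).1 h).2)] with Z hZ hs
  exact (posDef_iff_dot _).2 ⟨hs, hZ⟩

lemma crossGram_self_posDef (W : R0 n k) : (crossGram (W : Centered n k) W).PosDef := by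
  have h : (crossGram (W : Centered n k) W).PosSemidef := by
    simpa [conjTranspose_eq_transpose_of_trivial] using!
      posSemidef_conjTranspose_mul_self (mat ((W : Centered n k) : Vec n k))
  rw [h.posDef_iff_isUnit, Matrix.isUnit_iff_isUnit_det]
  exact (mem_R0.1 W.2).isUnit

lemma align_self (W : R0 n k) : align W W = W := align_of_posDef (crossGram_self_posDef W)

lemma differentiableAt_align (W : R0 n k) {Z : Centered n k} (h : (crossGram W Z).det ≠ 0) :
    DifferentiableAt ℝ (align W) Z := (contDiffAt_align W h).differentiableAt (by simp)

/-- The alignment is the identity on the slice. -/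
lemma fderiv_align_of_mem_slice (W : R0 n k) {Y h : Centered n k} (hY : Y ∈ slice (W : Centered n k))
    (hp : (crossGram (W : Centered n k) Y).PosDef) (hh : h ∈ slice (W : Centered n k)) :
    fderiv ℝ (align W) Y h = h := by
  have hl : HasDerivAt (fun t : ℝ => Y + t • h) h 0 := by
    simpa using ((hasDerivAt_id (0 : ℝ)).smul_const h).const_add Y
  have h0 : Y + (0 : ℝ) • h = Y := by simp
  have h1 : HasDerivAt (align W ∘ fun t : ℝ => Y + t • h) (fderiv ℝ (align W) Y h) 0 := by
    refine HasFDerivAt.comp_hasDerivAt 0 ?_ hl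
    rw [h0]
    exact (differentiableAt_align W (det_ne_zero_of_posDef hp)).hasFDerivAt
  have h2 : (align W ∘ fun t : ℝ => Y + t • h) =ᶠ[𝓝 0] fun t : ℝ => Y + t • h := by
    have hc : Filter.Tendsto (fun t : ℝ => Y + t • h) (𝓝 0) (𝓝 Y) := by
      have := hl.continuousAt.tendsto
      rwa [h0] at this
    filter_upwards [hc.eventually (eventually_crossGram_posDef W hp)] with t ht
    exact align_of_posDef (ht (Submodule.add_mem _ hY (Submodule.smul_mem _ _ hh)))
  exact (h1.congr_of_eventuallyEq h2.symm).unique hl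

lemma exists_slice_add_vertical (Z x : Centered n k) :
    ∃ s ∈ slice Z, ∃ v ∈ vertical Z, x = s + v := by
  obtain ⟨s, hs, v, hv, h⟩ := (slice Z).exists_add_mem_mem_orthogonal x
  rw [slice_orthogonal] at hv
  exact ⟨s, hs, v, hv, h⟩

/-- At `W` the derivative of the alignment is the orthogonal projection to the slice: it fixes slice
vectors and, by invariance, kills vertical ones. -/
lemma coord_fderiv_align_self (W : R0 n k) (x : Centered n k) :
    coord W (fderiv ℝ (align W) W x) = coord W x := by
  obtain ⟨s, hs, v, hv, rfl⟩ := exists_slice_add_vertical (W : Centered n k) x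
  rw [map_add, fderiv_align_of_mem_slice W (self_mem_slice _) (crossGram_self_posDef W) hs,
    (rotationInvariant_align W).fderiv_vertical (differentiableAt_align W (mem_R0.1 W.2)) hv,
    add_zero, map_add, coord_of_mem_vertical W hv, add_zero]

end Invariance


/-! ### The differentials of the projection and of the charts -/

section Charts
attribute [local instance] Matrix.linftyOpNormedRing Matrix.linftyOpNormedAlgebra

variable {n k : ℕ}

lemma cls_out (p : QuotM n k) : cls p.out = p := Quotient.out_eq p

/-- The chart at `[Z]` is built on the chosen representative `(cls Z).out`, not on `Z`; this
rotation `Q` carries computations from one to the other. -/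
lemma exists_out_cls_eq (Z : R0 n k) :
    ∃ Q ∈ orthogonalGroup (Fin k) ℝ, ((cls Z).out : Centered n k) = rmul Z Q :=
  cls_eq_iff.1 (cls_out (cls Z)).symm

lemma crossGram_det_of_cls_mem {W Z : R0 n k} (h : cls Z = cls W) :
    (crossGram (W : Centered n k) (Z : Centered n k)).det ≠ 0 := by
  rw [← mem_sliceSource, h, mem_sliceSource]
  exact mem_R0.1 W.2

lemma crossGram_out_det (Z : R0 n k) :
    (crossGram ((cls Z).out : Centered n k) (Z : Centered n k)).det ≠ 0 :=
  crossGram_det_of_cls_mem (cls_out (cls Z)).symm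

lemma chartAt_symm_R0 (Z : R0 n k) {Y : Centered n k} (hY : Y ∈ R0 n k) :
    (chartAt (Centered n k) Z).symm Y = ⟨Y, hY⟩ := by
  refine (chartAt (Centered n k) Z).left_inv (x := ⟨Y, hY⟩) ?_
  rw [TopologicalSpace.Opens.chartAt_eq, OpenPartialHomeomorph.subtypeRestr_source]
  exact mem_univ _

lemma hasFDerivAt_coord_align (W : R0 n k) {Z : Centered n k}
    (h : (crossGram (W : Centered n k) Z).det ≠ 0) :
    HasFDerivAt (fun Y => coord W (align W Y)) (coord W ∘L fderiv ℝ (align W) Z) Z :=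
  (coord W).hasFDerivAt.comp Z (differentiableAt_align W h).hasFDerivAt

/-- The differential of the projection, in the coordinates of the tangent space at `[Z]`. -/
def dproj (Z : R0 n k) : Centered n k →L[ℝ] Model n k :=
  coord (cls Z).out ∘L fderiv ℝ (align (cls Z).out) (Z : Centered n k)

/-- The tangent space at `[Z]` is read in the chart at `[Z]`, where the projection is `Y ↦ coord
(align Y)`. -/
lemma dcls_eq (Z : R0 n k) : dcls Z = dproj Z := by
  refine HasMFDerivAt.mfderiv ⟨contMDiff_cls.continuous.continuousAt, ?_⟩
  have h : HasFDerivAt (writtenInExtChartAt 𝓘(ℝ, Centered n k) 𝓘(ℝ, Model n k) Z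
      (cls : R0 n k → QuotM n k)) (dproj Z) (Z : Centered n k) := by
    refine (hasFDerivAt_coord_align _ (crossGram_out_det Z)).congr_of_eventuallyEq ?_
    filter_upwards [(R0 n k).isOpen.mem_nhds Z.2] with Y hY
    simp only [writtenInExtChartAt, mfld_simps]
    rw [chartAt_symm_R0 Z hY]
    rfl
  exact h.hasFDerivWithinAt

/-- The differential of the projection, computed at the representative that the chart uses. -/
lemma dproj_apply {Z : R0 n k} {Q : Matrix (Fin k) (Fin k) ℝ} (hQ : Q ∈ orthogonalGroup (Fin k) ℝ)
    (h : ((cls Z).out : Centered n k) = rmul Z Q) (V : Centered n k) :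
    dproj Z V = coord (cls Z).out (rmul V Q) := by
  have h1 := (rotationInvariant_align (cls Z).out).fderiv_rmul hQ (Z := Z) (by
    rw [← h]
    exact differentiableAt_align _ (mem_R0.1 (cls Z).out.2)) V
  rw [← h] at h1
  change coord _ (fderiv ℝ (align (cls Z).out) (Z : Centered n k) V) = _
  rw [← h1, coord_fderiv_align_self]

lemma param_dproj {Z : R0 n k} {Q : Matrix (Fin k) (Fin k) ℝ} (hQ : Q ∈ orthogonalGroup (Fin k) ℝ)
    (h : ((cls Z).out : Centered n k) = rmul Z Q) {V : Centered n k}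
    (hV : V ∈ slice (Z : Centered n k)) :
    param (cls Z).out (dproj Z V) = rmul V Q := by
  rw [dproj_apply hQ h]
  refine param_coord _ ?_
  rw [h]
  exact rmul_mem_slice hV Q

lemma dproj_vertical (Z : R0 n k) {V : Centered n k} (hV : V ∈ vertical (Z : Centered n k)) :
    dproj Z V = 0 := by
  change coord _ (fderiv ℝ (align (cls Z).out) (Z : Centered n k) V) = _
  rw [(rotationInvariant_align (cls Z).out).fderiv_vertical
    (differentiableAt_align _ (crossGram_out_det Z)) hV, map_zero]

/-- The submersion is isometric on horizontal vectors. One horizontal argument suffices, since the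
vertical part of the other contributes to neither side. -/
lemma inner_dproj {Z : R0 n k} {V V' : Centered n k} (hV : V ∈ slice (Z : Centered n k)) :
    inner ℝ (dproj Z V) (dproj Z V') = inner ℝ V V' := by
  obtain ⟨Q, hQ, h⟩ := exists_out_cls_eq Z
  rw [dproj_apply hQ h V', real_inner_comm, inner_coord, param_dproj hQ h hV, inner_rmul_rmul hQ,
    real_inner_comm]

lemma dproj_injOn {Z : R0 n k} {V : Centered n k} (hV : V ∈ slice (Z : Centered n k))
    (h : dproj Z V = 0) : V = 0 := by
  rw [← inner_self_eq_zero (𝕜 := ℝ), ← inner_dproj hV, h, inner_zero_left]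

lemma ker_dproj (Z : R0 n k) : LinearMap.ker (dproj Z).toLinearMap = vertical (Z : Centered n k) := by
  ext V
  constructor
  · intro hV
    have hV : dproj Z V = 0 := hV
    obtain ⟨s, hs, v, hv, rfl⟩ := exists_slice_add_vertical (Z : Centered n k) V
    rw [map_add, dproj_vertical Z hv, add_zero] at hV
    rw [dproj_injOn hs hV, zero_add]
    exact hv
  · exact dproj_vertical Z

lemma horizontal_eq (Z : R0 n k) : horizontal Z = slice (Z : Centered n k) := by
  rw [slice_eq, ← ker_dproj]
  exact congrArg (fun D : Centered n k →L[ℝ] Model n k => (LinearMap.ker D.toLinearMap)ᗮ) (dcls_eq Z)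

lemma dproj_surjOn (Z : R0 n k) (ξ : Model n k) :
    ∃ V ∈ slice (Z : Centered n k), dproj Z V = ξ := by
  obtain ⟨Q, hQ, h⟩ := exists_out_cls_eq Z
  -- The chart's representative is `ZQ`; its slice vector is rotated back to `Z`.
  refine ⟨rmul (param (cls Z).out ξ) Qᵀ, ?_, ?_⟩
  · have h1 := rmul_mem_slice (param_mem (cls Z).out ξ) Qᵀ
    rwa [h, rmul_rmul, orth_mul_transpose hQ, rmul_one] at h1
  · rw [dproj_apply hQ h, rmul_rmul, orth_transpose_mul hQ, rmul_one, coord_param]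

/-- The restriction of the differential of the projection to the horizontal space. -/
def dprojEquiv (Z : R0 n k) : horizontal Z ≃L[ℝ] Model n k :=
  LinearEquiv.toContinuousLinearEquiv
    (LinearEquiv.ofBijective ((dproj Z).toLinearMap ∘ₗ (horizontal Z).subtype) ⟨by
      rw [← LinearMap.ker_eq_bot, LinearMap.ker_eq_bot']
      rintro ⟨V, hV⟩ h0
      rw [horizontal_eq] at hV
      exact Subtype.ext (dproj_injOn hV h0), by
      intro ξ
      obtain ⟨V, hV, h⟩ := dproj_surjOn Z ξ
      rw [← horizontal_eq] at hV
      exact ⟨⟨V, hV⟩, h⟩⟩)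

/-- `ContinuousLinearMap.inverse` has a junk value on noninvertible maps; `dprojEquiv` shows that
the genuine inverse is meant here. -/
lemma horizontalLift_eq (Z : R0 n k) : horizontalLift Z =
    (horizontal Z).subtypeL ∘L ((dprojEquiv Z).symm : Model n k →L[ℝ] horizontal Z) := by
  have h : (dproj Z) ∘L (horizontal Z).subtypeL = (dprojEquiv Z : horizontal Z →L[ℝ] Model n k) :=
    rfl
  rw [← ContinuousLinearMap.inverse_equiv, ← h]
  exact congrArg (fun D : Centered n k →L[ℝ] Model n k =>
    (horizontal Z).subtypeL ∘L (D ∘L (horizontal Z).subtypeL).inverse) (dcls_eq Z)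

/-- In the tangent coordinates at `p` the horizontal lift to `p.out` is `param p.out`, an isometry.
-/
lemma quotMetric_eq (p : QuotM n k) : quotMetric n k p = innerSL ℝ (E := Model n k) := by
  have hL : ∀ u : Model n k, horizontalLift p.out u = param p.out u := by
    intro u
    obtain ⟨V, hV, h⟩ := dproj_surjOn p.out u
    have e1 : horizontalLift p.out u = V := by
      have hV' := hV
      rw [← horizontal_eq] at hV'
      have e : (dprojEquiv p.out) ⟨V, hV'⟩ = u := h
      have e2 : (dprojEquiv p.out).symm u = ⟨V, hV'⟩ := by
        rw [← e, ContinuousLinearEquiv.symm_apply_apply]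
      rw [horizontalLift_eq]
      exact congrArg Subtype.val e2
    have e3 : dproj p.out V = coord p.out V := by
      have := coord_fderiv_align_self p.out V
      conv_rhs => rw [← this]
      rw [dproj, cls_out]
      rfl
    rw [e1, ← h, e3, param_coord _ hV]
  refine ContinuousLinearMap.ext fun (u : Model n k) => ContinuousLinearMap.ext fun (v : Model n k) => ?_
  change inner ℝ (horizontalLift p.out u) (horizontalLift p.out v) = inner ℝ u v
  rw [hL, hL, inner_param_param]

end Charts

/-! ### The metric in the charts -/

section ChartMetric
attribute [local instance] Matrix.linftyOpNormedRing Matrix.linftyOpNormedAlgebra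

variable {n k : ℕ}

/-- The derivative takes values in the tangent space at the image point, which has its own chart;
hence `dproj` at `param p.out y` appears instead of the identity. -/
lemma mfderiv_chart_symm (p : QuotM n k) {y : Model n k} (hy : y ∈ sliceTarget p.out) :
    mfderiv 𝓘(ℝ, Model n k) 𝓘(ℝ, Model n k) (chartAt (Model n k) p).symm y
      = dproj ⟨param p.out y, mem_R0_of_target hy⟩ ∘L param p.out := by
  refine HasMFDerivAt.mfderiv ⟨(chartAt (Model n k) p).continuousAt_symm hy, ?_⟩
  have h : HasFDerivAt (writtenInExtChartAt 𝓘(ℝ, Model n k) 𝓘(ℝ, Model n k) y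
      (chartAt (Model n k) p).symm)
      (dproj ⟨param p.out y, mem_R0_of_target hy⟩ ∘L param p.out) y := by
    have h1 : HasFDerivAt (fun y' => sliceCoord (sliceMap p.out y).out (sliceMap p.out y'))
        (dproj ⟨param p.out y, mem_R0_of_target hy⟩ ∘L param p.out) y := by
      rw [sliceMap_of_mem (mem_R0_of_target hy)]
      have h2 := (hasFDerivAt_coord_align _
        (crossGram_out_det ⟨param p.out y, mem_R0_of_target hy⟩)).comp y (param p.out).hasFDerivAt
      refine h2.congr_of_eventuallyEq ?_
      filter_upwards [(isOpen_sliceTarget p.out).mem_nhds hy] with y' hy'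
      rw [sliceMap_of_mem (mem_R0_of_target hy'), sliceCoord_cls]
      rfl
    exact h1
  exact h.hasFDerivWithinAt

/-- Chain rule for the chart at `p` after the projection. It expresses in one fixed chart vectors
given in the tangent coordinates at nearby points. -/
lemma mfderiv_chart_dproj (p : QuotM n k) {Y : R0 n k}
    (hY : (crossGram (p.out : Centered n k) (Y : Centered n k)).det ≠ 0) (x : Centered n k) :
    (mfderiv 𝓘(ℝ, Model n k) 𝓘(ℝ, Model n k) (chartAt (Model n k) p) (cls Y) :
      Model n k →L[ℝ] Model n k) (dproj Y x) = coord p.out (fderiv ℝ (align p.out) Y x) := by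
  have hs : cls Y ∈ (chartAt (Model n k) p).source := mem_sliceSource.2 hY
  have h1 : MDifferentiableAt 𝓘(ℝ, Model n k) 𝓘(ℝ, Model n k) (chartAt (Model n k) p) (cls Y) :=
    mdifferentiableAt_atlas (chart_mem_atlas _ p) hs
  have h2 : MDifferentiableAt 𝓘(ℝ, Centered n k) 𝓘(ℝ, Model n k) (cls : R0 n k → QuotM n k) Y :=
    (contMDiff_cls Y).mdifferentiableAt (by simp)
  have h3 := mfderiv_comp Y h1 h2
  have h4 : mfderiv 𝓘(ℝ, Centered n k) 𝓘(ℝ, Model n k) (chartAt (Model n k) p ∘ (cls : R0 n k → QuotM n k)) Y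
      = coord p.out ∘L fderiv ℝ (align p.out) (Y : Centered n k) := by
    refine HasMFDerivAt.mfderiv ⟨(h1.comp Y h2).continuousAt, ?_⟩
    have h : HasFDerivAt (writtenInExtChartAt 𝓘(ℝ, Centered n k) 𝓘(ℝ, Model n k) Y
        (chartAt (Model n k) p ∘ (cls : R0 n k → QuotM n k)))
        (coord p.out ∘L fderiv ℝ (align p.out) (Y : Centered n k)) (Y : Centered n k) := by
      refine (hasFDerivAt_coord_align _ hY).congr_of_eventuallyEq ?_
      filter_upwards [(R0 n k).isOpen.mem_nhds Y.2] with Z hZ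
      simp only [writtenInExtChartAt, mfld_simps]
      rw [chartAt_symm_R0 Y hZ]
      rfl
    exact h.hasFDerivWithinAt
  have h5 : mfderiv 𝓘(ℝ, Centered n k) 𝓘(ℝ, Model n k) (cls : R0 n k → QuotM n k) Y = dproj Y :=
    dcls_eq Y
  rw [h4, h5] at h3
  exact (DFunLike.congr_fun h3 x).symm

lemma chartMetric_apply (p : QuotM n k) {y : Model n k} (hy : y ∈ sliceTarget p.out)
    (u v : Model n k) : chartMetric (quotMetric n k) p y u v
      = inner ℝ (dproj ⟨param p.out y, mem_R0_of_target hy⟩ (param p.out u))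
        (dproj ⟨param p.out y, mem_R0_of_target hy⟩ (param p.out v)) := by
  have h : chartMetric (quotMetric n k) p y = (innerSL ℝ (E := Model n k)).bilinearComp
      (dproj ⟨param p.out y, mem_R0_of_target hy⟩ ∘L param p.out)
      (dproj ⟨param p.out y, mem_R0_of_target hy⟩ ∘L param p.out) := by
    have h1 := mfderiv_chart_symm p hy
    have h2 := quotMetric_eq ((chartAt (Model n k) p).symm y)
    exact congrArg₂ (fun (G : Model n k →L[ℝ] Model n k →L[ℝ] ℝ) (D : Model n k →L[ℝ] Model n k) =>
      G.bilinearComp D D) h2 h1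
  rw [h]
  rfl

/-- The vertical part at `Y` of a vector that is horizontal at `W` is of the order of `Y - W`. -/
lemma exists_vertical_bound (W : R0 n k) : ∃ C : ℝ, 0 ≤ C ∧ ∀ᶠ Y in 𝓝 (W : Centered n k),
    ∀ x ∈ slice (W : Centered n k), ∀ s ∈ slice Y, ∀ v ∈ vertical Y, x = s + v →
      ‖v‖ ≤ C * ‖Y - W‖ * ‖x‖ := by
  obtain ⟨a, ha0, ha⟩ := (ContinuousLinearMap.isBoundedBilinearMap
    (rmulL : Centered n k →L[ℝ] Matrix (Fin k) (Fin k) ℝ →L[ℝ] Centered n k)).bound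
  obtain ⟨b, hb0, hb⟩ :=
    ((crossGramL (W : Centered n k)).toContinuousLinearMap.isBoundedLinearMap).bound
  set c := ‖(crossGram (W : Centered n k) W)⁻¹‖ + 1 with hc
  have hc0 : 0 ≤ c := by positivity
  -- `a` bounds the product `(Z, Ω) ↦ ZΩ`, `b` bounds `Wᵀ·`, and `c` bounds `(WᵀY)⁻¹` for `Y` near
  -- `W`.
  refine ⟨a * (c * b), by positivity, ?_⟩
  have hcont : ContinuousAt (fun Y : Centered n k => (crossGram (W : Centered n k) Y)⁻¹) W := by
    have h1 := NormedRing.inverse_continuousAt (crossGram_self_posDef W).isUnit.unit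
    simp only [Matrix.nonsing_inv_eq_ringInverse]
    exact ContinuousAt.comp (f := crossGram (W : Centered n k)) h1
      (contDiff_crossGram (W : Centered n k)).continuous.continuousAt
  have e1 : ∀ᶠ Y in 𝓝 (W : Centered n k), ‖(crossGram (W : Centered n k) Y)⁻¹‖ < c :=
    hcont.norm.eventually (gt_mem_nhds (lt_add_one _))
  have e2 : ∀ᶠ Y in 𝓝 (W : Centered n k), (crossGram (W : Centered n k) Y).det ≠ 0 :=
    ((contDiff_crossGram (W : Centered n k)).continuous.matrix_det.continuousAt).eventually
      (isOpen_ne.mem_nhds (mem_R0.1 W.2))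
  filter_upwards [e1, e2] with Y h1 h2 x hx s hs v hv hxs
  obtain ⟨Ω, hΩ, rfl⟩ := hv
  change ‖rmul Y Ω‖ ≤ _
  have hxs : x = s + rmul Y Ω := hxs
  have hi1 : inner ℝ (rmul Y Ω) s = 0 := by
    rw [slice_eq] at hs
    exact hs _ ⟨Ω, hΩ, rfl⟩
  have hi2 : inner ℝ (rmul (W : Centered n k) Ω) x = 0 := by
    rw [slice_eq] at hx
    exact hx _ ⟨Ω, hΩ, rfl⟩
  have hsub : rmul (Y - (W : Centered n k)) Ω = rmul Y Ω - rmul (W : Centered n k) Ω := by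
    rw [← rmulRight_apply, map_sub]
    rfl
  -- `x` is orthogonal to `WΩ` and its vertical part at `Y` is `YΩ`, so only the difference `(Y -
  -- W)Ω` pairs with `x`. This yields the factor `‖Y - W‖`.
  have hsq : ‖rmul Y Ω‖ * ‖rmul Y Ω‖ = inner ℝ (rmul (Y - (W : Centered n k)) Ω) x := by
    rw [hsub, inner_sub_left, hi2, hxs, inner_add_right, hi1, real_inner_self_eq_norm_mul_norm]
    ring
  -- `Ω` is recovered from `YΩ` as `(WᵀY)⁻¹ Wᵀ(YΩ)`.
  have hΩn : ‖Ω‖ ≤ c * b * ‖rmul Y Ω‖ := by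
    have e : Ω = (crossGram (W : Centered n k) Y)⁻¹ * crossGram (W : Centered n k) (rmul Y Ω) := by
      rw [crossGram_rmul, ← Matrix.mul_assoc, Matrix.nonsing_inv_mul _ h2.isUnit, Matrix.one_mul]
    calc ‖Ω‖ = ‖(crossGram (W : Centered n k) Y)⁻¹ * crossGram (W : Centered n k) (rmul Y Ω)‖ :=
          congrArg _ e
      _ ≤ ‖(crossGram (W : Centered n k) Y)⁻¹‖ * ‖crossGram (W : Centered n k) (rmul Y Ω)‖ :=
          norm_mul_le _ _
      _ ≤ c * (b * ‖rmul Y Ω‖) := by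
          gcongr
          exact hb _
      _ = c * b * ‖rmul Y Ω‖ := by ring
  have hle : ‖rmul (Y - (W : Centered n k)) Ω‖ ≤ a * ‖Y - W‖ * ‖Ω‖ := ha _ _
  have hfin : ‖rmul Y Ω‖ * ‖rmul Y Ω‖ ≤ (a * (c * b) * ‖Y - W‖ * ‖x‖) * ‖rmul Y Ω‖ := by
    rw [hsq]
    calc inner ℝ (rmul (Y - (W : Centered n k)) Ω) x ≤ ‖rmul (Y - (W : Centered n k)) Ω‖ * ‖x‖ := real_inner_le_norm _ _
      _ ≤ (a * ‖Y - W‖ * (c * b * ‖rmul Y Ω‖)) * ‖x‖ := by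
          gcongr
          refine hle.trans ?_
          gcongr
      _ = _ := by ring
  rcases (norm_nonneg (rmul Y Ω)).eq_or_lt with h0 | h0
  · rw [← h0]
    positivity
  · exact le_of_mul_le_mul_right hfin h0

/-- The center of the chart at `p`. -/
lemma param_chartAt_self (p : QuotM n k) : param p.out (chartAt (Model n k) p p) = p.out := by
  have h : chartAt (Model n k) p p = coord p.out (align p.out p.out) := by
    conv_lhs => arg 2; rw [← cls_out p]
    exact sliceCoord_cls p.out p.out
  rw [h, align_self, param_coord _ (self_mem_slice _)]

lemma chartAt_self_mem (p : QuotM n k) : chartAt (Model n k) p p ∈ sliceTarget p.out := by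
  change (crossGram (p.out : Centered n k) (param p.out (chartAt (Model n k) p p))).PosDef
  rw [param_chartAt_self]
  exact crossGram_self_posDef _

/-- The metric agrees to first order with the Euclidean metric at the center of a chart. -/
lemma exists_chartMetric_bound (p : QuotM n k) : ∃ C : ℝ, 0 ≤ C ∧
    ∀ᶠ y in 𝓝 (chartAt (Model n k) p p), ∀ u v : Model n k,
      ‖chartMetric (quotMetric n k) p y u v - inner ℝ u v‖
        ≤ C * ‖y - chartAt (Model n k) p p‖ ^ 2 * ‖u‖ * ‖v‖ := by
  obtain ⟨C, hC, hb⟩ := exists_vertical_bound p.out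
  refine ⟨C ^ 2, by positivity, ?_⟩
  set y₀ := chartAt (Model n k) p p with hy₀
  have hp : param p.out y₀ = p.out := param_chartAt_self p
  rw [← hp] at hb
  have hb' := (param p.out).continuous.continuousAt.eventually hb
  filter_upwards [hb', (isOpen_sliceTarget p.out).mem_nhds (chartAt_self_mem p)] with y hb hy u v
  rw [chartMetric_apply p hy]
  set Y : R0 n k := ⟨param p.out y, mem_R0_of_target hy⟩ with hY
  obtain ⟨s, hs, a, ha, hu⟩ := exists_slice_add_vertical (Y : Centered n k) (param p.out u)
  obtain ⟨t, ht, c, hc, hv⟩ := exists_slice_add_vertical (Y : Centered n k) (param p.out v)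
  have ha' := hb _ (by rw [hp]; exact param_mem _ u) s hs a ha hu
  have hc' := hb _ (by rw [hp]; exact param_mem _ v) t ht c hc hv
  rw [← map_sub, norm_param, norm_param] at ha' hc'
  have hsc : inner ℝ s c = 0 := by
    rw [slice_eq] at hs
    rw [real_inner_comm]
    exact hs c hc
  have hat : inner ℝ a t = 0 := by
    rw [slice_eq] at ht
    exact ht a ha
  -- The quotient metric at `Y` keeps only the horizontal term `⟨s, t⟩`. The error `⟨a, c⟩` is a
  -- product of two vertical parts, each of first order in `y - y₀`.
  have e1 : inner ℝ u v = inner ℝ s t + inner ℝ a c := by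
    rw [← inner_param_param p.out, hu, hv, inner_add_left, inner_add_right, inner_add_right, hsc,
      hat]
    ring
  rw [e1, hu, hv, map_add, map_add, dproj_vertical Y ha, dproj_vertical Y hc, add_zero, add_zero,
    inner_dproj hs, sub_add_cancel_left, norm_neg]
  calc ‖inner ℝ a c‖ ≤ ‖a‖ * ‖c‖ := norm_inner_le_norm a c
    _ ≤ (C * ‖y - y₀‖ * ‖u‖) * (C * ‖y - y₀‖ * ‖v‖) := by gcongr
    _ = _ := by ring

lemma hasFDerivAt_zero_of_quadratic {E F : Type*} [NormedAddCommGroup E] [NormedSpace ℝ E]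
    [NormedAddCommGroup F] [NormedSpace ℝ F] {f : E → F} {x : E} {C : ℝ}
    (h : ∀ᶠ y in 𝓝 x, ‖f y - f x‖ ≤ C * ‖y - x‖ ^ 2) : HasFDerivAt f (0 : E →L[ℝ] F) x := by
  refine HasFDerivAt.of_isLittleO ?_
  have h1 : (fun y => f y - f x - (0 : E →L[ℝ] F) (y - x)) =O[𝓝 x] fun y => ‖y - x‖ ^ 2 := by
    refine Asymptotics.IsBigO.of_bound C ?_
    filter_upwards [h] with y hy
    simpa using! hy
  refine h1.trans_isLittleO ?_
  have h2 : Filter.Tendsto (fun y => y - x) (𝓝 x) (𝓝 0) := by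
    have : Filter.Tendsto (fun y : E => y - x) (𝓝 x) (𝓝 (x - x)) :=
      (continuous_id.sub continuous_const).continuousAt
    rwa [sub_self] at this
  have h3 : (fun y : E => ‖y‖ ^ 2) =o[𝓝 0] fun y : E => y := Asymptotics.isLittleO_norm_pow_id one_lt_two
  exact h3.comp_tendsto h2

lemma chartMetric_self (p : QuotM n k) (u v : Model n k) :
    chartMetric (quotMetric n k) p (chartAt (Model n k) p p) u v = inner ℝ u v := by
  obtain ⟨C, hC, h⟩ := exists_chartMetric_bound p
  have := h.self_of_nhds u v
  rw [sub_self, norm_zero] at this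
  have h0 : ‖chartMetric (quotMetric n k) p (chartAt (Model n k) p p) u v - inner ℝ u v‖ ≤ 0 := by
    refine this.trans (le_of_eq ?_)
    ring
  exact sub_eq_zero.1 (norm_le_zero_iff.1 h0)

/-- The Christoffel symbols vanish at the center of a chart. -/
lemma christoffel_self (p : QuotM n k) (u v : Model n k) :
    christoffel (quotMetric n k) p (chartAt (Model n k) p p) u v = 0 := by
  obtain ⟨C, hC, h⟩ := exists_chartMetric_bound p
  have h1 : HasFDerivAt (chartMetric (quotMetric n k) p)
      (0 : Model n k →L[ℝ] Model n k →L[ℝ] Model n k →L[ℝ] ℝ) (chartAt (Model n k) p p) := by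
    refine hasFDerivAt_zero_of_quadratic (C := C)
      (F := Model n k →L[ℝ] Model n k →L[ℝ] ℝ) ?_
    filter_upwards [h] with y hy
    refine ContinuousLinearMap.opNorm_le_bound₂ (chartMetric (quotMetric n k) p y
      - chartMetric (quotMetric n k) p (chartAt (Model n k) p p)) (by positivity) fun u v => ?_
    have e := hy u v
    rw [← chartMetric_self p u v] at e
    exact e
  have h2 : HasFDerivAt (fun y => chartMetric (quotMetric n k) p y u v)
      (0 : Model n k →L[ℝ] ℝ) (chartAt (Model n k) p p) := by
    refine hasFDerivAt_zero_of_quadratic (C := C * ‖u‖ * ‖v‖) ?_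
    filter_upwards [h] with y hy
    have e := hy u v
    rw [← chartMetric_self p u v] at e
    refine e.trans (le_of_eq ?_)
    ring
  rw [christoffel, h1.fderiv, h2.fderiv]
  simp

end ChartMetric

/-! ### The Riemannian gradient and Hessian of a rotation invariant function -/

section GradHess
attribute [local instance] Matrix.linftyOpNormedRing Matrix.linftyOpNormedAlgebra

variable {n k : ℕ}

/-- The Riesz isomorphism of a real Hilbert space. -/
def riesz (E : Type*) [NormedAddCommGroup E] [InnerProductSpace ℝ E] [CompleteSpace E] :
    E ≃L[ℝ] (E →L[ℝ] ℝ) where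
  toLinearMap := (innerSL ℝ (E := E)).toLinearMap
  invFun := (InnerProductSpace.toDual ℝ E).symm
  left_inv := (InnerProductSpace.toDual ℝ E).symm_apply_apply
  right_inv := (InnerProductSpace.toDual ℝ E).apply_symm_apply
  continuous_toFun := (innerSL ℝ (E := E)).continuous
  continuous_invFun := (InnerProductSpace.toDual ℝ E).symm.continuous

lemma inverse_innerSL_eq {E : Type*} [NormedAddCommGroup E] [InnerProductSpace ℝ E]
    [CompleteSpace E] {φ : E →L[ℝ] ℝ} {x : E} (h : ∀ v, inner ℝ x v = φ v) :
    (innerSL ℝ (E := E)).inverse φ = x := by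
  have h1 : innerSL ℝ (E := E) = (riesz E : E →L[ℝ] (E →L[ℝ] ℝ)) := rfl
  rw [h1, ContinuousLinearMap.inverse_equiv]
  change (InnerProductSpace.toDual ℝ E).symm φ = x
  rw [LinearIsometryEquiv.symm_apply_eq]
  ext v
  exact (h v).symm

lemma inner_gradient {E : Type*} [NormedAddCommGroup E] [InnerProductSpace ℝ E]
    [CompleteSpace E] (f : E → ℝ) (x v : E) : inner ℝ (gradient f x) v = fderiv ℝ f x v := by
  rw [gradient, InnerProductSpace.toDual_symm_apply]

lemma hasFDerivAt_gradient {E : Type*} [NormedAddCommGroup E] [InnerProductSpace ℝ E]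
    [CompleteSpace E] {f : E → ℝ} {x : E} (hf : ContDiffAt ℝ 2 f x) :
    HasFDerivAt (gradient f) (((riesz E).symm : (E →L[ℝ] ℝ) →L[ℝ] E) ∘L fderiv ℝ (fderiv ℝ f) x) x := by
  have h1 : DifferentiableAt ℝ (fderiv ℝ f) x :=
    (hf.fderiv_right (m := 1) (by norm_num)).differentiableAt (by simp)
  exact ((riesz E).symm : (E →L[ℝ] ℝ) →L[ℝ] E).hasFDerivAt.comp x h1.hasFDerivAt

lemma inner_fderiv_gradient {E : Type*} [NormedAddCommGroup E] [InnerProductSpace ℝ E]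
    [CompleteSpace E] {f : E → ℝ} {x : E} (hf : ContDiffAt ℝ 2 f x) (u v : E) :
    inner ℝ (fderiv ℝ (gradient f) x u) v = fderiv ℝ (fderiv ℝ f) x u v := by
  rw [(hasFDerivAt_gradient hf).fderiv]
  exact InnerProductSpace.toDual_symm_apply

variable {f : Centered n k → ℝ} {F : QuotM n k → ℝ}

lemma RotationInvariant.gradient_rmul (hf : RotationInvariant f) {Z : Centered n k}
    {Q : Matrix (Fin k) (Fin k) ℝ} (hQ : Q ∈ orthogonalGroup (Fin k) ℝ)
    (hd : DifferentiableAt ℝ f (rmul Z Q)) :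
    gradient f (rmul Z Q) = rmul (gradient f Z) Q := by
  refine ext_inner_right ℝ fun x => ?_
  obtain ⟨v, rfl⟩ : ∃ v, x = rmul v Q := ⟨rmul x Qᵀ, by
    rw [rmul_rmul, orth_transpose_mul hQ, rmul_one]⟩
  rw [inner_rmul_rmul hQ, inner_gradient, inner_gradient, hf.fderiv_rmul hQ hd]

/-- Differentiates the equivariance of the gradient, which holds on the open set `R0` only. -/
lemma RotationInvariant.fderiv_gradient_rmul (hf : RotationInvariant f)
    (hC : ∀ Z ∈ R0 n k, ContDiffAt ℝ 2 f Z) {Z : Centered n k} (hZ : Z ∈ R0 n k)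
    {Q : Matrix (Fin k) (Fin k) ℝ} (hQ : Q ∈ orthogonalGroup (Fin k) ℝ) (V : Centered n k) :
    fderiv ℝ (gradient f) (rmul Z Q) (rmul V Q) = rmul (fderiv ℝ (gradient f) Z V) Q := by
  have h1 : HasFDerivAt (gradient f ∘ rmulRight Q)
      (fderiv ℝ (gradient f) (rmul Z Q) ∘L rmulRight Q) Z :=
    HasFDerivAt.comp Z (g := gradient f)
      (hasFDerivAt_gradient (hC _ (rmul_mem_R0 hZ hQ))).differentiableAt.hasFDerivAt
      (rmulRight Q).hasFDerivAt
  have h2 : HasFDerivAt (rmulRight Q ∘ gradient f)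
      (rmulRight Q ∘L fderiv ℝ (gradient f) Z) Z :=
    (rmulRight Q).hasFDerivAt.comp Z
      (hasFDerivAt_gradient (hC _ hZ)).differentiableAt.hasFDerivAt
  have h3 : gradient f ∘ rmulRight Q =ᶠ[𝓝 Z] rmulRight Q ∘ gradient f := by
    filter_upwards [(R0 n k).isOpen.mem_nhds hZ] with Y hY
    exact hf.gradient_rmul hQ ((hC _ (rmul_mem_R0 hY hQ)).differentiableAt (by simp))
  exact DFunLike.congr_fun ((h1.congr_of_eventuallyEq h3.symm).unique h2) V

/-- In the chart at `p` the function `F` is `f ∘ param p.out`, and the center of the chart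
corresponds to `p.out`. -/
lemma mvfderiv_quot (hC : ∀ Z ∈ R0 n k, DifferentiableAt ℝ f Z)
    (hF : ∀ Z : R0 n k, F (cls Z) = f Z) (p : QuotM n k) :
    mvfderiv 𝓘(ℝ, Model n k) F p = fderiv ℝ f (p.out : Centered n k) ∘L param p.out := by
  have hloc : ∀ y ∈ sliceTarget p.out, F (sliceMap p.out y) = f (param p.out y) := by
    intro y hy
    rw [sliceMap_of_mem (mem_R0_of_target hy), hF]
  have hf : HasFDerivAt (fun y => f (param p.out y)) (fderiv ℝ f (p.out : Centered n k) ∘L param p.out)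
      (chartAt (Model n k) p p) := by
    refine HasFDerivAt.comp _ (g := f) ?_ (param p.out).hasFDerivAt
    rw [param_chartAt_self]
    exact (hC _ p.out.2).hasFDerivAt
  have hcont : ContinuousAt F p := by
    have h1 : ContinuousAt (fun q => f (param p.out (chartAt (Model n k) p q))) p :=
      ContinuousAt.comp (g := fun y => f (param p.out y)) hf.continuousAt
        ((chartAt (Model n k) p).continuousAt (mem_chart_source _ p))
    refine h1.congr ?_
    filter_upwards [(isOpen_sliceSource p.out).mem_nhds (mem_chart_source (Model n k) p)] with q hq
    exact (hloc _ (sliceCoord_mem hq)).symm.trans (congrArg F (sliceMap_sliceCoord hq))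
  have h : HasMFDerivAt 𝓘(ℝ, Model n k) 𝓘(ℝ, ℝ) F p
      (fderiv ℝ f (p.out : Centered n k) ∘L param p.out : Model n k →L[ℝ] ℝ) := by
    refine ⟨hcont, ?_⟩
    have h : HasFDerivAt (writtenInExtChartAt 𝓘(ℝ, Model n k) 𝓘(ℝ, ℝ) p F)
        (fderiv ℝ f (p.out : Centered n k) ∘L param p.out) (chartAt (Model n k) p p) := by
      refine hf.congr_of_eventuallyEq ?_
      filter_upwards [(isOpen_sliceTarget p.out).mem_nhds (chartAt_self_mem p)] with y hy
      exact hloc y hy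
    exact h.hasFDerivWithinAt
  rw [mvfderiv, h.mfderiv]
  rfl

/-- The gradient on the quotient, in the coordinates of the tangent space at `p`. -/
lemma riemGrad_quot (hC : ∀ Z ∈ R0 n k, DifferentiableAt ℝ f Z)
    (hF : ∀ Z : R0 n k, F (cls Z) = f Z) (p : QuotM n k) :
    riemGrad (quotMetric n k) F p = coord p.out (gradient f p.out) := by
  have h1 : (innerSL ℝ (E := Model n k)).inverse
      (fderiv ℝ f (p.out : Centered n k) ∘L param p.out) = coord p.out (gradient f p.out) := by
    refine inverse_innerSL_eq fun v => ?_
    rw [inner_coord, inner_gradient]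
    rfl
  rw [← h1, ← mvfderiv_quot hC hF p]
  exact congrArg (fun G : Model n k →L[ℝ] Model n k →L[ℝ] ℝ =>
    G.inverse (mvfderiv 𝓘(ℝ, Model n k) F p)) (quotMetric_eq p)

lemma riemGrad_cls (hf : RotationInvariant f) (hC : ∀ Z ∈ R0 n k, DifferentiableAt ℝ f Z)
    (hF : ∀ Z : R0 n k, F (cls Z) = f Z) (Z : R0 n k) :
    riemGrad (quotMetric n k) F (cls Z) = dproj Z (gradient f Z) := by
  obtain ⟨Q, hQ, h⟩ := exists_out_cls_eq Z
  rw [riemGrad_quot hC hF, dproj_apply hQ h, ← hf.gradient_rmul hQ (hC _ (rmul_mem_R0 Z.2 hQ)), ← h]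

lemma vectorInChart_riemGrad (hf : RotationInvariant f) (hC : ∀ Z ∈ R0 n k, DifferentiableAt ℝ f Z)
    (hF : ∀ Z : R0 n k, F (cls Z) = f Z) (p : QuotM n k) {y : Model n k}
    (hy : y ∈ sliceTarget p.out) :
    vectorInChart (riemGrad (quotMetric n k) F) p y =
      coord p.out (fderiv ℝ (align p.out) (param p.out y) (gradient f (param p.out y))) := by
  have h1 : (chartAt (Model n k) p).symm y = cls ⟨param p.out y, mem_R0_of_target hy⟩ :=
    sliceMap_of_mem (mem_R0_of_target hy)
  rw [vectorInChart, h1]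
  rw [← mfderiv_chart_dproj p (Y := ⟨param p.out y, mem_R0_of_target hy⟩) (det_ne_zero_of_posDef hy),
    riemGrad_cls hf hC hF]

/-- The Hessian on the quotient, in the coordinates of the tangent space at `p`. -/
lemma riemHess_quot (hf : RotationInvariant f) (hC : ∀ Z ∈ R0 n k, ContDiffAt ℝ 2 f Z)
    (hF : ∀ Z : R0 n k, F (cls Z) = f Z) (p : QuotM n k) (ξ : Model n k) :
    riemHess (quotMetric n k) F p ξ =
      coord p.out (fderiv ℝ (gradient f) p.out (param p.out ξ)) := by
  have hd : ∀ Z ∈ R0 n k, DifferentiableAt ℝ f Z := fun Z hZ => (hC Z hZ).differentiableAt (by simp)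
  set W := p.out with hW
  set y₀ := chartAt (Model n k) p p with hy₀
  have hp : param W y₀ = W := param_chartAt_self p
  have hal : DifferentiableAt ℝ (fderiv ℝ (align W)) (param W y₀) := by
    rw [hp]
    have := ((contDiffAt_align W (mem_R0.1 W.2)).of_le (m := 2)
      (WithTop.coe_le_coe.2 (le_top : (2 : ℕ∞) ≤ ⊤))).fderiv_right (m := 1) (by norm_num)
    exact this.differentiableAt (by simp)
  have hA : HasFDerivAt (fun y => fderiv ℝ (align W) (param W y))
      (fderiv ℝ (fderiv ℝ (align W)) (param W y₀) ∘L param W) y₀ :=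
    HasFDerivAt.comp y₀ (g := fderiv ℝ (align W)) hal.hasFDerivAt (param W).hasFDerivAt
  have hG : HasFDerivAt (fun y => gradient f (param W y))
      (fderiv ℝ (gradient f) W ∘L param W) y₀ := by
    refine HasFDerivAt.comp y₀ (g := gradient f) ?_ (param W).hasFDerivAt
    rw [hp]
    exact (hasFDerivAt_gradient (hC _ W.2)).differentiableAt.hasFDerivAt
  -- The gradient of an invariant function is horizontal, and at every nearby point of the slice the
  -- derivative of `align W` fixes horizontal vectors at `W`. So the second derivative of the
  -- alignment does not contribute to the Hessian.
  have hconst : fderiv ℝ (fderiv ℝ (align W)) (param W y₀) (param W ξ) (gradient f W) = 0 := by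
    have hgs : gradient f W ∈ slice (W : Centered n k) := by
      rw [slice_eq]
      intro v hv
      rw [real_inner_comm, inner_gradient, hf.fderiv_vertical (hd _ W.2) hv]
    have h1 : HasFDerivAt (fun y => fderiv ℝ (align W) (param W y) (gradient f W))
        ((fderiv ℝ (fderiv ℝ (align W)) (param W y₀) ∘L param W).flip (gradient f W)) y₀ := by
      have := hA.clm_apply (hasFDerivAt_const (gradient f W) y₀)
      simpa using this
    have h2 : (fun y => fderiv ℝ (align W) (param W y) (gradient f W)) =ᶠ[𝓝 y₀]
        fun _ => gradient f W := by
      filter_upwards [(isOpen_sliceTarget W).mem_nhds (chartAt_self_mem p)] with y hy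
      exact fderiv_align_of_mem_slice W (param_mem W y) hy hgs
    have h3 := (h1.congr_of_eventuallyEq h2.symm).unique (hasFDerivAt_const _ _)
    exact DFunLike.congr_fun h3 ξ
  -- Product rule for the derivative of the alignment applied to the gradient; the second summand is
  -- the one that `hconst` removes.
  have hV : HasFDerivAt (vectorInChart (riemGrad (quotMetric n k) F) p)
      (coord W ∘L (fderiv ℝ (align W) (param W y₀) ∘L (fderiv ℝ (gradient f) W ∘L param W) +
        (fderiv ℝ (fderiv ℝ (align W)) (param W y₀) ∘L param W).flip (gradient f (param W y₀)))) y₀ := by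
    refine ((coord W).hasFDerivAt.comp y₀ (hA.clm_apply hG)).congr_of_eventuallyEq ?_
    filter_upwards [(isOpen_sliceTarget W).mem_nhds (chartAt_self_mem p)] with y hy
    exact vectorInChart_riemGrad hf hd hF p hy
  have h0 : riemHess (quotMetric n k) F p ξ =
      (fderiv ℝ (vectorInChart (riemGrad (quotMetric n k) F) p) y₀ ξ
        + christoffel (quotMetric n k) p y₀ ξ (vectorInChart (riemGrad (quotMetric n k) F) p y₀) :
        Model n k) := rfl
  rw [h0, christoffel_self, add_zero, hV.fderiv]
  change coord W (fderiv ℝ (align W) (param W y₀) (fderiv ℝ (gradient f) W (param W ξ)) +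
    fderiv ℝ (fderiv ℝ (align W)) (param W y₀) (param W ξ) (gradient f (param W y₀))) = _
  rw [hp] at hconst ⊢
  rw [hconst, add_zero, coord_fderiv_align_self]

/-- The Hessian on the quotient, as a linear map in the coordinates of the tangent space at `p`. -/
def hessMap (f : Centered n k → ℝ) (p : QuotM n k) : Model n k →L[ℝ] Model n k :=
  coord p.out ∘L fderiv ℝ (gradient f) (p.out : Centered n k) ∘L param p.out

/-- Both the second derivative of `f` and the inner product are unchanged by the rotation from `Z`
to the chart's representative. -/
lemma inner_hessMap (hf : RotationInvariant f) (hC : ∀ Z ∈ R0 n k, ContDiffAt ℝ 2 f Z) (Z : R0 n k)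
    {V V' : Centered n k} (hV : V ∈ slice (Z : Centered n k)) (hV' : V' ∈ slice (Z : Centered n k)) :
    inner ℝ (hessMap f (cls Z) (dproj Z V)) (dproj Z V') =
      fderiv ℝ (fderiv ℝ f) (Z : Centered n k) V V' := by
  obtain ⟨Q, hQ, h⟩ := exists_out_cls_eq Z
  change inner ℝ (coord (cls Z).out (fderiv ℝ (gradient f) (cls Z).out
    (param (cls Z).out (dproj Z V)))) _ = _
  rw [inner_coord, param_dproj hQ h hV, param_dproj hQ h hV', h,
    hf.fderiv_gradient_rmul hC Z.2 hQ, inner_rmul_rmul hQ, inner_fderiv_gradient (hC _ Z.2)]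

lemma inner_dproj_gradient (Z : R0 n k)
    {V : Centered n k} (hV : V ∈ slice (Z : Centered n k)) :
    inner ℝ (dproj Z (gradient f Z)) (dproj Z V) = fderiv ℝ f (Z : Centered n k) V := by
  rw [real_inner_comm, inner_dproj hV, real_inner_comm, inner_gradient]

end GradHess

/-! ### Lines are geodesics -/

section Lines
attribute [local instance] Matrix.linftyOpNormedRing Matrix.linftyOpNormedAlgebra

variable {n k : ℕ}

lemma tangentBundle_mk_eq {p q : QuotM n k} (h : p = q) {x y : Model n k} (hxy : x = y) :
    (⟨p, x⟩ : TangentBundle 𝓘(ℝ, Model n k) (QuotM n k)) = ⟨q, y⟩ := by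
  subst h hxy
  rfl

lemma tangentBundle_mk_inj {p q : QuotM n k} {x y : Model n k}
    (h : (⟨p, x⟩ : TangentBundle 𝓘(ℝ, Model n k) (QuotM n k)) = ⟨q, y⟩) : p = q ∧ x = y := by
  cases h
  exact ⟨rfl, rfl⟩

/-- A curve in the chart at its point `γ t`. -/
def curveInChart (γ : ℝ → QuotM n k) (t : ℝ) : ℝ → Model n k :=
  fun τ => chartAt (Model n k) (γ t) (γ τ)

lemma contDiffAt_curveInChart {γ : ℝ → QuotM n k} {t : ℝ}
    (h : ContMDiffAt 𝓘(ℝ, ℝ) 𝓘(ℝ, Model n k) 2 γ t) : ContDiffAt ℝ 2 (curveInChart γ t) t := by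
  rw [contMDiffAt_iff_target] at h
  exact h.2.contDiffAt

lemma mfderiv_curve {γ : ℝ → QuotM n k} {t : ℝ}
    (h : ContMDiffAt 𝓘(ℝ, ℝ) 𝓘(ℝ, Model n k) 2 γ t) :
    (mfderiv 𝓘(ℝ, ℝ) 𝓘(ℝ, Model n k) γ t : ℝ →L[ℝ] Model n k) 1 = deriv (curveInChart γ t) t := by
  have h1 := (contDiffAt_curveInChart h).differentiableAt (by simp)
  have h2 : HasMFDerivAt 𝓘(ℝ, ℝ) 𝓘(ℝ, Model n k) γ t
      (fderiv ℝ (curveInChart γ t) t : ℝ →L[ℝ] Model n k) := by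
    refine ⟨h.continuousAt, ?_⟩
    have h3 : HasFDerivAt (writtenInExtChartAt 𝓘(ℝ, ℝ) 𝓘(ℝ, Model n k) t γ)
        (fderiv ℝ (curveInChart γ t) t) t := h1.hasFDerivAt
    exact h3.hasFDerivWithinAt
  have h4 : fderiv ℝ (curveInChart γ t) t 1 = deriv (curveInChart γ t) t := fderiv_apply_one_eq_deriv
  rw [h2.mfderiv]
  exact h4

/-- The projection of the line `Z + t V`, as long as it stays in `ℝ₀^{n×k}`. -/
def lineCurve (Z : R0 n k) (V : Centered n k) (t : ℝ) : QuotM n k :=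
  open Classical in if h : (Z : Centered n k) + t • V ∈ R0 n k then cls ⟨_, h⟩ else cls Z

lemma lineCurve_of_mem {Z : R0 n k} {V : Centered n k} {t : ℝ}
    (h : (Z : Centered n k) + t • V ∈ R0 n k) : lineCurve Z V t = cls ⟨_, h⟩ := dif_pos h

lemma continuous_line (Z V : Centered n k) : Continuous fun t : ℝ => Z + t • V := by fun_prop

lemma eventually_line_mem {Z : R0 n k} {V : Centered n k} {t : ℝ}
    (h : (Z : Centered n k) + t • V ∈ R0 n k) :
    ∀ᶠ τ in 𝓝 t, (Z : Centered n k) + τ • V ∈ R0 n k :=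
  (continuous_line (Z : Centered n k) V).continuousAt.eventually ((R0 n k).isOpen.mem_nhds h)

lemma continuousAt_lineCurve {Z : R0 n k} {V : Centered n k} {t : ℝ}
    (h : (Z : Centered n k) + t • V ∈ R0 n k) : ContinuousAt (lineCurve Z V) t := by
  have h1 : ContinuousOn (lineCurve Z V) {τ | (Z : Centered n k) + τ • V ∈ R0 n k} := by
    rw [continuousOn_iff_continuous_domRestrict]
    have : {τ | (Z : Centered n k) + τ • V ∈ R0 n k}.domRestrict (lineCurve Z V) =
        fun τ => cls ⟨(Z : Centered n k) + τ.1 • V, τ.2⟩ := by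
      ext τ
      exact lineCurve_of_mem τ.2
    rw [this]
    exact isQuotientMap_cls.continuous.comp
      (((continuous_line (Z : Centered n k) V).comp continuous_subtype_val).subtype_mk _)
  exact h1.continuousAt (eventually_line_mem h)

/-- `(Z + tV)ᵀV = ZᵀV + t VᵀV`, and `VᵀV` is symmetric. -/
lemma line_mem_slice {Z : R0 n k} {V : Centered n k} (hV : V ∈ slice (Z : Centered n k)) (t : ℝ) :
    V ∈ slice ((Z : Centered n k) + t • V) := by
  rw [mem_slice_iff] at *
  have e : crossGram ((Z : Centered n k) + t • V) V
      = crossGram (Z : Centered n k) V + t • crossGram V V := by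
    simp [crossGram, Matrix.add_mul]
  rw [e, transpose_add, hV, transpose_smul, transpose_crossGram]

/-- A rotation carries the line into the slice through the chart's representative, where the
alignment is the identity near `τ = t`; the coordinates are then affine in `τ`. -/
lemma curveInChart_line {Z : R0 n k} {V : Centered n k} (hV : V ∈ slice (Z : Centered n k)) {t : ℝ}
    (h : (Z : Centered n k) + t • V ∈ R0 n k) :
    curveInChart (lineCurve Z V) t =ᶠ[𝓝 t] fun τ =>
      coord (cls ⟨_, h⟩).out (align (cls ⟨_, h⟩).out ((Z : Centered n k) + t • V))
        + (τ - t) • dproj ⟨_, h⟩ V := by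
  obtain ⟨Q, hQ, hW⟩ := exists_out_cls_eq ⟨_, h⟩
  set W := (cls ⟨(Z : Centered n k) + t • V, h⟩).out with hWdef
  have hVs : rmul V Q ∈ slice (W : Centered n k) := by
    rw [hW]
    exact rmul_mem_slice (line_mem_slice hV t) Q
  have hline : ∀ τ : ℝ, rmul ((Z : Centered n k) + τ • V) Q = W + (τ - t) • rmul V Q := by
    intro τ
    rw [hW]
    simp only [← rmulRight_apply, map_add, map_smul]
    module
  have hc : ContinuousAt (fun τ : ℝ => (W : Centered n k) + (τ - t) • rmul V Q) t := by fun_prop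
  have hc0 : (W : Centered n k) + (t - t) • rmul V Q = W := by simp
  have hpos := eventually_crossGram_posDef W (crossGram_self_posDef W)
  rw [← hc0] at hpos
  filter_upwards [eventually_line_mem h, hc.eventually hpos] with τ h1 h2
  rw [hc0] at h2
  have h3 : ∀ s : ℝ, align W ((Z : Centered n k) + s • V) = align W (W + (s - t) • rmul V Q) := by
    intro s
    rw [← hline, align_rmul W _ hQ]
  have h4 : curveInChart (lineCurve Z V) t τ = coord W (align W ((Z : Centered n k) + τ • V)) := by
    rw [curveInChart, lineCurve_of_mem h1, lineCurve_of_mem h]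
    rfl
  have h5 := h2 (Submodule.add_mem _ (self_mem_slice _) (Submodule.smul_mem _ (τ - t) hVs))
  rw [h4, h3 τ, h3 t, align_of_posDef h5, hc0, align_self, map_add, map_smul, dproj_apply hQ hW V]

lemma contMDiffAt_line {Z : R0 n k} {V : Centered n k} (hV : V ∈ slice (Z : Centered n k)) {t : ℝ}
    (h : (Z : Centered n k) + t • V ∈ R0 n k) :
    ContMDiffAt 𝓘(ℝ, ℝ) 𝓘(ℝ, Model n k) 2 (lineCurve Z V) t := by
  rw [contMDiffAt_iff_target]
  refine ⟨continuousAt_lineCurve h, ContDiffAt.contMDiffAt ?_⟩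
  refine ContDiffAt.congr_of_eventuallyEq ?_ (curveInChart_line hV h)
  fun_prop

/-- At each time the curve is affine in the chart centered at its own position, and the Christoffel
symbol vanishes there. -/
lemma isGeodesicOn_line {Z : R0 n k} {V : Centered n k} (hV : V ∈ slice (Z : Centered n k))
    {s : Set ℝ} (h : ∀ t ∈ s, (Z : Centered n k) + t • V ∈ R0 n k) :
    IsGeodesicOn (quotMetric n k) (lineCurve Z V) s := by
  intro t ht
  refine ⟨contMDiffAt_line hV (h t ht), ?_⟩
  have h1 := curveInChart_line hV (h t ht)
  have h2 : deriv (curveInChart (lineCurve Z V) t) =ᶠ[𝓝 t] fun _ => dproj ⟨_, h t ht⟩ V := by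
    refine h1.deriv.trans (Filter.Eventually.of_forall fun τ => ?_)
    have h3 : HasDerivAt (fun τ : ℝ => coord (cls ⟨_, h t ht⟩).out (align (cls ⟨_, h t ht⟩).out
        ((Z : Centered n k) + t • V)) + (τ - t) • dproj ⟨_, h t ht⟩ V)
        ((1 : ℝ) • dproj ⟨_, h t ht⟩ V) τ :=
      (((hasDerivAt_id τ).sub_const t).smul_const _).const_add _
    rw [one_smul] at h3
    exact h3.deriv
  have h4 : deriv (deriv (curveInChart (lineCurve Z V) t)) t = 0 := by
    rw [h2.deriv_eq, deriv_const]
  change deriv (deriv (curveInChart (lineCurve Z V) t)) t +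
    christoffel (quotMetric n k) (lineCurve Z V t)
      (chartAt (Model n k) (lineCurve Z V t) (lineCurve Z V t)) _ _ = 0
  rw [h4, christoffel_self, add_zero]

lemma isExp_line {Z : R0 n k} {V : Centered n k} (hV : V ∈ slice (Z : Centered n k))
    (h : ∀ t ∈ Icc (0 : ℝ) 1, (Z : Centered n k) + t • V ∈ R0 n k)
    (h1 : (Z : Centered n k) + V ∈ R0 n k) :
    IsExp (quotMetric n k) ⟨cls Z, dcls Z V⟩ (cls ⟨(Z : Centered n k) + V, h1⟩) := by
  have e0 : (⟨(Z : Centered n k) + (0 : ℝ) • V, h 0 (by simp)⟩ : R0 n k) = Z :=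
    Subtype.ext (by simp)
  have e1 : (⟨(Z : Centered n k) + (1 : ℝ) • V, h 1 (by simp)⟩ : R0 n k)
      = ⟨(Z : Centered n k) + V, h1⟩ := Subtype.ext (by simp)
  refine ⟨lineCurve Z V, isGeodesicOn_line hV h, ?_, ?_⟩
  · have h0 := h 0 (by simp)
    have hd : (mfderiv 𝓘(ℝ, ℝ) 𝓘(ℝ, Model n k) (lineCurve Z V) 0 : ℝ →L[ℝ] Model n k) 1
        = dproj Z V := by
      rw [mfderiv_curve (contMDiffAt_line hV h0), (curveInChart_line hV h0).deriv_eq]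
      have h3 : HasDerivAt (fun τ : ℝ => coord (cls ⟨_, h0⟩).out (align (cls ⟨_, h0⟩).out
          ((Z : Centered n k) + (0 : ℝ) • V)) + (τ - 0) • dproj ⟨_, h0⟩ V)
          ((1 : ℝ) • dproj ⟨_, h0⟩ V) 0 :=
        (((hasDerivAt_id (0 : ℝ)).sub_const 0).smul_const _).const_add _
      rw [one_smul] at h3
      rw [h3.deriv, e0]
    rw [dcls_eq]
    exact tangentBundle_mk_eq ((lineCurve_of_mem h0).trans (congrArg cls e0)) hd
  · rw [lineCurve_of_mem (h 1 (by simp)), e1]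

end Lines

/-! ### Uniqueness of geodesics, through the Gram matrices `Z Zᵀ` -/

section Gram

variable {n k : ℕ}

/-- `a bᵀ`, in vectorized form. -/
def outer (a b : Centered n k) : Vec n n :=
  WithLp.toLp 2 fun p => (mat (a : Vec n k) * (mat (b : Vec n k))ᵀ) p.1 p.2

lemma mat_outer (a b : Centered n k) : mat (outer a b) = mat (a : Vec n k) * (mat (b : Vec n k))ᵀ :=
  rfl

/-- `(a, b) ↦ a bᵀ` as a continuous bilinear map. -/
def outerL : Centered n k →L[ℝ] Centered n k →L[ℝ] Vec n n :=
  LinearMap.toContinuousLinearMap (LinearMap.toContinuousLinearMap.toLinearMap ∘ₗ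
    LinearMap.mk₂ ℝ outer
      (fun a b c => mat_injective (by simp [mat_outer, Matrix.add_mul]))
      (fun a b c => mat_injective (by simp [mat_outer]))
      (fun a b c => mat_injective (by simp [mat_outer, Matrix.mul_add]))
      (fun a b c => mat_injective (by simp [mat_outer])))

lemma outerL_apply (a b : Centered n k) : outerL a b = outer a b := rfl

lemma isBoundedBilinearMap_outer (n k : ℕ) :
    IsBoundedBilinearMap ℝ fun p : Centered n k × Centered n k => outer p.1 p.2 :=
  ContinuousLinearMap.isBoundedBilinearMap (outerL : Centered n k →L[ℝ] Centered n k →L[ℝ] Vec n n)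

lemma exists_outer_le (n k : ℕ) : ∃ c : ℝ, 0 < c ∧ ∀ a b : Centered n k, ‖outer a b‖ ≤ c * ‖a‖ * ‖b‖ :=
  (isBoundedBilinearMap_outer n k).bound

lemma outer_add_left (a b c : Centered n k) : outer (a + b) c = outer a c + outer b c := by
  simp only [← outerL_apply, map_add, _root_.add_apply]

lemma outer_add_right (a b c : Centered n k) : outer a (b + c) = outer a b + outer a c := by
  simp only [← outerL_apply, map_add]

lemma outer_sub_left (a b c : Centered n k) : outer (a - b) c = outer a c - outer b c := by
  simp only [← outerL_apply, map_sub, _root_.sub_apply]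

lemma outer_sub_right (a b c : Centered n k) : outer a (b - c) = outer a b - outer a c := by
  simp only [← outerL_apply, map_sub]

lemma outer_rmul {Q : Matrix (Fin k) (Fin k) ℝ} (hQ : Q ∈ orthogonalGroup (Fin k) ℝ)
    (a b : Centered n k) : outer (rmul a Q) (rmul b Q) = outer a b :=
  mat_injective (by
    rw [mat_outer, mat_outer, mat_rmul, mat_rmul, transpose_mul, Matrix.mul_assoc,
      ← Matrix.mul_assoc Q, orth_mul_transpose hQ, Matrix.one_mul])

lemma inner_vec_eq_trace {m l : ℕ} (a b : Vec m l) :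
    inner ℝ a b = ((mat a)ᵀ * mat b).trace := by
  rw [PiLp.inner_apply, Fintype.sum_prod_type_right]
  simp only [Matrix.trace, Matrix.diag, Matrix.mul_apply, Matrix.transpose_apply]
  exact Finset.sum_congr rfl fun j _ => Finset.sum_congr rfl fun i _ => mul_comm _ _

/-- `aᵀ b`, in vectorized form. -/
def crossVec (a b : Centered n k) : Vec k k := WithLp.toLp 2 fun p => crossGram a b p.1 p.2

lemma mat_crossVec (a b : Centered n k) : mat (crossVec a b) = crossGram a b := rfl

/-- `(a, b) ↦ aᵀ b` as a continuous bilinear map. -/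
def crossVecL : Centered n k →L[ℝ] Centered n k →L[ℝ] Vec k k :=
  LinearMap.toContinuousLinearMap (LinearMap.toContinuousLinearMap.toLinearMap ∘ₗ
    LinearMap.mk₂ ℝ crossVec
      (fun a b c => mat_injective (by simp [mat_crossVec, crossGram, Matrix.add_mul]))
      (fun a b c => mat_injective (by simp [mat_crossVec, crossGram]))
      (fun a b c => mat_injective (by simp [mat_crossVec, crossGram, Matrix.mul_add]))
      (fun a b c => mat_injective (by simp [mat_crossVec, crossGram])))

lemma exists_crossVec_le (n k : ℕ) :
    ∃ c : ℝ, 0 < c ∧ ∀ a b : Centered n k, ‖crossVec a b‖ ≤ c * ‖a‖ * ‖b‖ :=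
  (ContinuousLinearMap.isBoundedBilinearMap
    (crossVecL : Centered n k →L[ℝ] Centered n k →L[ℝ] Vec k k)).bound

lemma inner_outer_outer (a b c d : Centered n k) :
    inner ℝ (outer a b) (outer c d) = (crossGram a c * crossGram d b).trace := by
  rw [inner_vec_eq_trace, mat_outer, mat_outer, transpose_mul, transpose_transpose, Matrix.mul_assoc,
    Matrix.trace_mul_comm, crossGram, crossGram]
  simp only [Matrix.mul_assoc]

lemma inner_crossVec (a b c d : Centered n k) :
    inner ℝ (crossVec a b) (crossVec c d) = (crossGram b a * crossGram c d).trace := by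
  rw [inner_vec_eq_trace, mat_crossVec, mat_crossVec, transpose_crossGram]

/-- A symmetrized product `m eᵀ + e mᵀ` controls `m eᵀ` up to the skew part of `mᵀ e`. -/
lemma norm_outer_le (m e : Centered n k) :
    2 * ‖outer m e‖ ^ 2 ≤ ‖outer m e + outer e m‖ ^ 2 + ‖crossVec m e - crossVec e m‖ ^ 2 := by
  have h1 : ‖outer e m‖ ^ 2 = ‖outer m e‖ ^ 2 := by
    rw [← real_inner_self_eq_norm_sq, ← real_inner_self_eq_norm_sq, inner_outer_outer,
      inner_outer_outer, Matrix.trace_mul_comm]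
  -- The mixed terms of the two expanded squares are equal, so they cancel in the sum.
  have h2 : inner ℝ (outer m e) (outer e m) = inner ℝ (crossVec m e) (crossVec e m) := by
    rw [inner_outer_outer, inner_crossVec, ← trace_transpose, transpose_mul, transpose_crossGram]
  have h3 : ‖crossVec e m‖ ^ 2 = ‖crossVec m e‖ ^ 2 := by
    rw [← real_inner_self_eq_norm_sq, ← real_inner_self_eq_norm_sq, inner_crossVec, inner_crossVec,
      Matrix.trace_mul_comm]
  rw [norm_add_sq_real, norm_sub_sq_real, h1, h2, h3]
  nlinarith [sq_nonneg ‖crossVec m e‖]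

/-- The bound for symmetric `mᵀ e`. -/
lemma norm_outer_le_of_mem_slice {m e : Centered n k} (h : e ∈ slice m) :
    ‖outer m e‖ ≤ ‖outer m e + outer e m‖ := by
  have h1 : crossVec m e - crossVec e m = 0 := by
    rw [sub_eq_zero]
    refine mat_injective ?_
    rw [mem_slice_iff, transpose_crossGram] at h
    rw [mat_crossVec, mat_crossVec]
    exact h.symm
  have h2 := norm_outer_le m e
  rw [h1, norm_zero] at h2
  refine le_of_sq_le_sq ?_ (norm_nonneg _)
  nlinarith [sq_nonneg ‖outer m e‖]

/-- The mixed term `tr(e yᵀw eᵀ)` is nonnegative because `yᵀw` is positive definite. -/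
lemma norm_outer_le_add {y w : Centered n k} (h : (crossGram y w).PosDef) (e : Centered n k) :
    ‖outer y e‖ ≤ ‖outer (w + y) e‖ := by
  have h1 : 0 ≤ inner ℝ (outer w e) (outer y e) := by
    have h2 := h.posSemidef.mul_mul_conjTranspose_same (mat (e : Vec n k))
    rw [conjTranspose_eq_transpose_of_trivial] at h2
    rw [real_inner_comm, inner_outer_outer, Matrix.trace_mul_comm, crossGram, Matrix.mul_assoc,
      Matrix.trace_mul_comm]
    exact h2.trace_nonneg
  refine le_of_sq_le_sq ?_ (norm_nonneg _)
  rw [outer_add_left, norm_add_sq_real]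
  nlinarith [sq_nonneg ‖outer w e‖]

lemma outer_eq_zero {y e : Centered n k} (hy : y ∈ R0 n k) (h : outer y e = 0) : e = 0 := by
  have h1 : mat (y : Vec n k) * (mat (e : Vec n k))ᵀ = 0 := by
    rw [← mat_outer, h, map_zero]
  have h2 : crossGram y y * (mat (e : Vec n k))ᵀ = 0 := by
    rw [crossGram, Matrix.mul_assoc, h1, Matrix.mul_zero]
  have h3 : (mat (e : Vec n k))ᵀ = 0 := by
    have := congrArg (fun B => (crossGram y y)⁻¹ * B) h2
    simp only [Matrix.mul_zero] at this
    rwa [← Matrix.mul_assoc, Matrix.nonsing_inv_mul _ (mem_R0.1 hy).isUnit, Matrix.one_mul] at this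
  refine centered_ext ?_
  rw [← transpose_transpose (mat (e : Vec n k)), h3]
  simp

/-- Full rank makes `e ↦ y eᵀ` injective, hence bounded below with some constant `1/K`; doubling `K`
pays for the perturbation from `y` to `y'`. -/
lemma exists_outer_bound {y : Centered n k} (hy : y ∈ R0 n k) :
    ∃ κ : ℝ, 0 ≤ κ ∧ ∀ᶠ y' in 𝓝 y, ∀ e : Centered n k, ‖e‖ ≤ κ * ‖outer y' e‖ := by
  have hker : LinearMap.ker (outerL y : Centered n k →ₗ[ℝ] Vec n n) = ⊥ := by
    rw [LinearMap.ker_eq_bot']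
    intro e he
    exact outer_eq_zero hy he
  obtain ⟨K, hK, hanti⟩ := LinearMap.exists_antilipschitzWith _ hker
  have hb : ∀ e : Centered n k, ‖e‖ ≤ K * ‖outer y e‖ := fun e => by
    have := hanti.le_mul_dist e 0
    simpa using! this
  obtain ⟨c, hc0, hc⟩ := exists_outer_le n k
  refine ⟨2 * K, by positivity, ?_⟩
  have hev : ∀ᶠ y' in 𝓝 y, (K : ℝ) * (c * ‖y - y'‖) < 1 / 2 := by
    have : ContinuousAt (fun y' : Centered n k => (K : ℝ) * (c * ‖y - y'‖)) y := by fun_prop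
    refine this.eventually (gt_mem_nhds ?_)
    simp
  filter_upwards [hev] with y' hy' e
  have h1 : ‖outer y e‖ ≤ ‖outer y' e‖ + c * ‖y - y'‖ * ‖e‖ := by
    have h2 : outer y e = outer y' e + outer (y - y') e := by
      rw [outer_sub_left]
      abel
    rw [h2]
    exact (norm_add_le _ _).trans (by gcongr; exact hc _ _)
  have h3 := hb e
  have h4 : (K : ℝ) * (c * ‖y - y'‖) * ‖e‖ ≤ 1 / 2 * ‖e‖ := by gcongr
  have h5 : (K : ℝ) * ‖outer y e‖ ≤ K * (‖outer y' e‖ + c * ‖y - y'‖ * ‖e‖) := by gcongr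
  nlinarith

/-- Two full rank matrices with the same Gram matrix differ by a rotation. -/
lemma cls_eq_of_outer_eq {Y W : R0 n k} (h : outer (W : Centered n k) W = outer (Y : Centered n k) Y) :
    cls W = cls Y := by
  have hu := (mem_R0.1 W.2).isUnit
  have hm : mat ((W : Centered n k) : Vec n k) * (mat ((W : Centered n k) : Vec n k))ᵀ
      = mat ((Y : Centered n k) : Vec n k) * (mat ((Y : Centered n k) : Vec n k))ᵀ := by
    rw [← mat_outer, ← mat_outer, h]
  set S := (crossGram (W : Centered n k) W)⁻¹ with hS
  have hST : Sᵀ = S := by rw [hS, transpose_nonsing_inv, transpose_crossGram]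
  have hSW : S * crossGram (W : Centered n k) W = 1 := Matrix.nonsing_inv_mul _ hu
  have hWS : crossGram (W : Centered n k) W * S = 1 := Matrix.mul_nonsing_inv _ hu
  rw [cls_eq_iff]
  -- The only candidate: `Y = WQ` forces `Q = (WᵀW)⁻¹WᵀY`.
  refine ⟨S * crossGram (W : Centered n k) Y, ?_, ?_⟩
  · rw [mem_orthogonalGroup_iff, transpose_mul, hST, transpose_crossGram]
    have e : crossGram (W : Centered n k) Y * crossGram (Y : Centered n k) W
        = crossGram (W : Centered n k) W * crossGram (W : Centered n k) W := by
      simp only [crossGram, Matrix.mul_assoc]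
      rw [← Matrix.mul_assoc (mat ((Y : Centered n k) : Vec n k)), ← hm, Matrix.mul_assoc]
    calc S * crossGram (W : Centered n k) Y * (crossGram (Y : Centered n k) W * S)
        = S * (crossGram (W : Centered n k) Y * crossGram (Y : Centered n k) W) * S := by
          simp only [Matrix.mul_assoc]
      _ = (S * crossGram (W : Centered n k) W) * (crossGram (W : Centered n k) W * S) := by
          rw [e]
          simp only [Matrix.mul_assoc]
      _ = 1 := by rw [hSW, hWS, Matrix.one_mul]
  · set P := rmul (W : Centered n k) (S * crossGram (W : Centered n k) Y) with hP
    -- `YPᵀ = YYᵀ W(WᵀW)⁻¹Wᵀ`, which equals `WWᵀ = YYᵀ` once `YYᵀ` is replaced by `WWᵀ`.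
    have h1 : outer (Y : Centered n k) (Y - P) = 0 := by
      refine mat_injective ?_
      rw [outer_sub_right, map_sub, mat_outer, mat_outer, map_zero, hP, mat_rmul, transpose_mul,
        transpose_mul, hST, transpose_crossGram, crossGram]
      rw [← Matrix.mul_assoc, ← Matrix.mul_assoc, ← Matrix.mul_assoc, ← hm]
      have e : mat ((W : Centered n k) : Vec n k) * (mat ((W : Centered n k) : Vec n k))ᵀ *
          mat ((W : Centered n k) : Vec n k) * S * (mat ((W : Centered n k) : Vec n k))ᵀ
          = mat ((W : Centered n k) : Vec n k) * (crossGram (W : Centered n k) W * S) *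
            (mat ((W : Centered n k) : Vec n k))ᵀ := by
        simp only [crossGram, Matrix.mul_assoc]
      rw [e, hWS, Matrix.mul_one, sub_self]
    exact sub_eq_zero.1 (outer_eq_zero Y.2 h1)

/-- `(Wᵀy)(yᵀW) = (WᵀW)²` is invertible. As `y` is not assumed to have full rank, this is what keeps
a line in `ℝ₀^{n×k}`. -/
lemma mem_R0_of_outer_eq {W : R0 n k} {y : Centered n k}
    (h : outer (W : Centered n k) W = outer y y) : y ∈ R0 n k := by
  have hm : mat ((W : Centered n k) : Vec n k) * (mat ((W : Centered n k) : Vec n k))ᵀ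
      = mat (y : Vec n k) * (mat (y : Vec n k))ᵀ := by
    rw [← mat_outer, ← mat_outer, h]
  refine mem_R0_of_gram (W := W) fun h0 => ?_
  have e : crossGram (W : Centered n k) y * crossGram y W
      = crossGram (W : Centered n k) W * crossGram (W : Centered n k) W := by
    simp only [crossGram, Matrix.mul_assoc]
    rw [← Matrix.mul_assoc (mat (y : Vec n k)), ← hm, Matrix.mul_assoc]
  have := congrArg Matrix.det e
  rw [det_mul, det_mul, h0, zero_mul] at this
  exact mul_ne_zero (mem_R0.1 W.2) (mem_R0.1 W.2) this.symm

end Gram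

/-! ### The Gram matrix along a geodesic -/

section GeodesicUniqueness

variable {n k : ℕ}

/-- The Gram matrix `Z Zᵀ` of a class. -/
def gram : QuotM n k → Vec n n :=
  Quotient.lift (fun Z : R0 n k => outer (Z : Centered n k) Z) fun Z₁ Z₂ h => by
    obtain ⟨Q, hQ, h⟩ := cls_eq_iff.1 (Quotient.sound h)
    simp only [h, outer_rmul hQ]

lemma gram_cls (Z : R0 n k) : gram (cls Z) = outer (Z : Centered n k) Z := rfl

/-- Embeds the quotient in one linear space, where geodesics can be compared without following them
through charts. -/
lemma gram_injective : Function.Injective (gram : QuotM n k → Vec n n) := by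
  intro p q h
  obtain ⟨W, rfl⟩ := cls_surjective p
  obtain ⟨Y, rfl⟩ := cls_surjective q
  exact cls_eq_of_outer_eq h

lemma gram_of_mem_source {W : R0 n k} {q : QuotM n k} (hq : q ∈ sliceSource W) :
    gram q = outer (param W (sliceCoord W q)) (param W (sliceCoord W q)) := by
  have h := sliceMap_of_mem (mem_R0_of_target (sliceCoord_mem hq))
  rw [sliceMap_sliceCoord hq] at h
  conv_lhs => rw [h]
  rfl

lemma hasDerivAt_outer {a b : ℝ → Centered n k} {a' b' : Centered n k} {t : ℝ}
    (ha : HasDerivAt a a' t) (hb : HasDerivAt b b' t) :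
    HasDerivAt (fun τ => outer (a τ) (b τ)) (outer a' (b t) + outer (a t) b') t := by
  have h0 : HasDerivAt (fun τ => (a τ, b τ)) (a', b') t := ha.prodMk hb
  have h1 := (isBoundedBilinearMap_outer n k).hasFDerivAt (a t, b t)
  have h := HasFDerivAt.comp_hasDerivAt (f := fun τ => (a τ, b τ)) t h1 h0
  rw [add_comm]
  exact h

lemma contDiffAt_outer {a b : ℝ → Centered n k} {t : ℝ} {m : WithTop ℕ∞}
    (ha : ContDiffAt ℝ m a t) (hb : ContDiffAt ℝ m b t) :
    ContDiffAt ℝ m (fun τ => outer (a τ) (b τ)) t :=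
  (isBoundedBilinearMap_outer n k).contDiff.contDiffAt.comp t (ha.prodMk hb)

lemma contDiffAt_deriv {E : Type*} [NormedAddCommGroup E] [NormedSpace ℝ E] {f : ℝ → E} {t : ℝ}
    {m l : WithTop ℕ∞} (h : ContDiffAt ℝ m f t) (hl : l + 1 ≤ m) : ContDiffAt ℝ l (deriv f) t := by
  have h1 : ContDiffAt ℝ l (fun τ => fderiv ℝ f τ 1) t :=
    (h.fderiv_right hl).clm_apply contDiffAt_const
  exact h1

lemma deriv_outer_self {y : ℝ → Centered n k} {t : ℝ} (h : ContDiffAt ℝ 2 y t) :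
    deriv (fun τ => outer (y τ) (y τ)) t = outer (deriv y t) (y t) + outer (y t) (deriv y t) ∧
    deriv (deriv fun τ => outer (y τ) (y τ)) t =
      outer (deriv (deriv y) t) (y t) + (2 : ℝ) • outer (deriv y t) (deriv y t)
        + outer (y t) (deriv (deriv y) t) := by
  have h1 : ∀ᶠ τ in 𝓝 t, HasDerivAt (fun τ => outer (y τ) (y τ))
      (outer (deriv y τ) (y τ) + outer (y τ) (deriv y τ)) τ := by
    filter_upwards [h.eventually (by simp)] with τ hτ
    have := (hτ.differentiableAt (by simp)).hasDerivAt
    exact hasDerivAt_outer this this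
  have h2 : HasDerivAt y (deriv y t) t := (h.differentiableAt (by simp)).hasDerivAt
  have h3 : HasDerivAt (deriv y) (deriv (deriv y) t) t :=
    ((contDiffAt_deriv h (l := 1) (by norm_num)).differentiableAt (by simp)).hasDerivAt
  refine ⟨h1.self_of_nhds.deriv, ?_⟩
  have h4 : deriv (fun τ => outer (y τ) (y τ)) =ᶠ[𝓝 t]
      fun τ => outer (deriv y τ) (y τ) + outer (y τ) (deriv y τ) := by
    filter_upwards [h1] with τ hτ using hτ.deriv
  rw [h4.deriv_eq, ((hasDerivAt_outer h3 h2).fun_add (hasDerivAt_outer h2 h3)).deriv, two_smul]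
  abel

/-- The Gram matrix along a geodesic. -/
lemma gram_geodesic {γ : ℝ → QuotM n k} {s : Set ℝ} (hγ : IsGeodesicOn (quotMetric n k) γ s) {t : ℝ}
    (ht : t ∈ s) : ContDiffAt ℝ 2 (fun τ => gram (γ τ)) t ∧
      deriv (fun τ => gram (γ τ)) t =
        outer (param (γ t).out (deriv (curveInChart γ t) t)) (γ t).out
          + outer ((γ t).out : Centered n k) (param (γ t).out (deriv (curveInChart γ t) t)) ∧
      deriv (deriv fun τ => gram (γ τ)) t =
        (2 : ℝ) • outer (param (γ t).out (deriv (curveInChart γ t) t))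
          (param (γ t).out (deriv (curveInChart γ t) t)) := by
  obtain ⟨hs, hacc⟩ := hγ t ht
  -- The geodesic equation is read in the chart centered at `γ t`, where the Christoffel symbol
  -- vanishes.
  have hacc' : deriv (deriv (curveInChart γ t)) t = 0 := by
    have h : deriv (deriv (curveInChart γ t)) t + christoffel (quotMetric n k) (γ t)
      (chartAt (Model n k) (γ t) (γ t)) (deriv (curveInChart γ t) t)
      (deriv (curveInChart γ t) t) = 0 := hacc
    rwa [christoffel_self, add_zero] at h
  have hc := contDiffAt_curveInChart hs
  set W := (γ t).out with hW
  set c := curveInChart γ t with hcdef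
  have hy : ContDiffAt ℝ 2 (fun τ => param W (c τ)) t := (param W).contDiff.contDiffAt.comp t hc
  have hy0 : param W (c t) = W := param_chartAt_self (γ t)
  have hd : ∀ {τ : ℝ}, DifferentiableAt ℝ c τ → deriv (fun τ => param W (c τ)) τ
      = param W (deriv c τ) := fun h =>
    ((param W).hasFDerivAt.comp_hasDerivAt _ h.hasDerivAt).deriv
  have hd1 : deriv (fun τ => param W (c τ)) t = param W (deriv c t) :=
    hd (hc.differentiableAt (by simp))
  have hd2 : deriv (deriv fun τ => param W (c τ)) t = 0 := by
    have h1 : deriv (fun τ => param W (c τ)) =ᶠ[𝓝 t] fun τ => param W (deriv c τ) := by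
      filter_upwards [hc.eventually (by simp)] with τ hτ using hd (hτ.differentiableAt (by simp))
    have h2 : HasDerivAt (deriv c) (deriv (deriv c) t) t :=
      ((contDiffAt_deriv hc (l := 1) (by norm_num)).differentiableAt (by simp)).hasDerivAt
    have h3 := ((param W).hasFDerivAt.comp_hasDerivAt t h2).deriv
    rw [hacc', map_zero] at h3
    exact h1.deriv_eq.trans h3
  have hg : (fun τ => gram (γ τ)) =ᶠ[𝓝 t] fun τ => outer (param W (c τ)) (param W (c τ)) := by
    filter_upwards [hs.continuousAt.eventually
      ((isOpen_sliceSource W).mem_nhds (mem_chart_source (Model n k) (γ t)))] with τ hτ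
    exact gram_of_mem_source hτ
  obtain ⟨e1, e2⟩ := deriv_outer_self hy
  refine ⟨(contDiffAt_outer hy hy).congr_of_eventuallyEq hg, ?_, ?_⟩
  · rw [hg.deriv_eq, e1, hd1, hy0]
  · rw [hg.deriv.deriv_eq, e2, hd1, hd2]
    simp only [← outerL_apply, map_zero, _root_.zero_apply, zero_add, add_zero]

/-- The acceleration of the Gram matrix is a Lipschitz function of the Gram matrix and its velocity. -/
lemma exists_gram_estimate (n k : ℕ) : ∃ c : ℝ, 0 < c ∧ ∀ (y w V x : Centered n k) (κ R : ℝ), 0 ≤ κ →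
    (∀ e, ‖e‖ ≤ κ * ‖outer y e‖) → (crossGram y w).PosDef → V ∈ slice y → x ∈ slice w → ‖x‖ ≤ R →
    ‖outer x x - outer V V‖ ≤ c * (R + ‖V‖) * κ * (1 + c * R * κ) *
      (‖outer w w - outer y y‖
        + ‖(outer x w + outer w x) - (outer V y + outer y V)‖) := by
  obtain ⟨c, hc0, hc⟩ := exists_outer_le n k
  obtain ⟨c', hc0', hc'⟩ := exists_crossVec_le n k
  refine ⟨4 * (c + c'), by positivity, ?_⟩
  intro y w V x κ R hκ hy hp hV hx hR
  have hR0 : 0 ≤ R := (norm_nonneg x).trans hR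
  set d₀ := ‖outer w w - outer y y‖ with hd₀
  set d₁ := ‖(outer x w + outer w x) - (outer V y + outer y V)‖ with hd₁
  -- Polarization: the symmetrized product of `w + y` and `w - y` is `2(wwᵀ - yyᵀ)`, and `(w + y)ᵀ(w
  -- - y)` is symmetric since `yᵀw` is, so `norm_outer_le_of_mem_slice` applies.
  have hE : ‖w - y‖ ≤ κ * (2 * d₀) := by
    have h1 : w - y ∈ slice (w + y) := by
      have h2 : (crossGram y w)ᵀ = crossGram y w := ((posDef_iff_dot _).1 hp).1
      rw [transpose_crossGram] at h2
      have h3 : crossGram (w + y) (w - y) = crossGram w w - crossGram y y := by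
        have h4 : crossGram (w + y) (w - y) =
            crossGram w w - crossGram w y + (crossGram y w - crossGram y y) := by
          simp [crossGram, Matrix.add_mul, Matrix.mul_sub]
          abel
        rw [h4, h2]
        abel
      rw [mem_slice_iff, h3, transpose_sub, transpose_crossGram, transpose_crossGram]
    have h5 := norm_outer_le_of_mem_slice h1
    have h6 : outer (w + y) (w - y) + outer (w - y) (w + y) = (2 : ℝ) • (outer w w - outer y y) := by
      simp only [outer_add_left, outer_add_right, outer_sub_left, outer_sub_right]
      module
    rw [h6, norm_smul, Real.norm_two] at h5
    exact (hy _).trans (by gcongr; exact (norm_outer_le_add hp _).trans h5)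
  -- `norm_outer_le` for `y` and `x - V`: the symmetrized product is the difference of the Gram
  -- velocities up to terms in `w - y`.
  have hF : ‖x - V‖ ≤ κ * (d₁ + 2 * (c + c') * R * ‖w - y‖) := by
    have h1 := norm_outer_le y (x - V)
    have h2 : outer y (x - V) + outer (x - V) y =
        ((outer x w + outer w x) - (outer V y + outer y V))
          - (outer x (w - y) + outer (w - y) x) := by
      simp only [outer_sub_left, outer_sub_right]
      abel
    have h3 : ‖outer y (x - V) + outer (x - V) y‖ ≤ d₁ + 2 * c * R * ‖w - y‖ := by
      rw [h2]
      refine (norm_sub_le _ _).trans ?_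
      have h4 : ‖outer x (w - y)‖ ≤ c * R * ‖w - y‖ := (hc _ _).trans (by gcongr)
      have h5 : ‖outer (w - y) x‖ ≤ c * R * ‖w - y‖ := by
        refine (hc _ _).trans ?_
        calc c * ‖w - y‖ * ‖x‖ ≤ c * ‖w - y‖ * R := by gcongr
          _ = _ := by ring
      have h6 := norm_add_le (outer x (w - y)) (outer (w - y) x)
      linarith
    -- `V` is horizontal at `y` and `x` at `w`, so the skew part of `yᵀ(x - V)` is also linear in `w
    -- - y`.
    have h7 : crossVec y (x - V) - crossVec (x - V) y = crossVec x (w - y) - crossVec (w - y) x := by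
      refine mat_injective ?_
      simp only [map_sub, mat_crossVec]
      have a1 := mem_slice_iff.1 hV
      have a2 := mem_slice_iff.1 hx
      rw [transpose_crossGram] at a1 a2
      have b1 : crossGram y (x - V) = crossGram y x - crossGram y V := by
        simp [crossGram, Matrix.mul_sub]
      have b2 : crossGram (x - V) y = crossGram x y - crossGram V y := by
        simp [crossGram, Matrix.sub_mul]
      have b3 : crossGram x (w - y) = crossGram x w - crossGram x y := by
        simp [crossGram, Matrix.mul_sub]
      have b4 : crossGram (w - y) x = crossGram w x - crossGram y x := by
        simp [crossGram, Matrix.sub_mul]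
      rw [b1, b2, b3, b4, a1, a2]
      abel
    have h8 : ‖crossVec y (x - V) - crossVec (x - V) y‖ ≤ 2 * c' * R * ‖w - y‖ := by
      rw [h7]
      refine (norm_sub_le _ _).trans ?_
      have h4 : ‖crossVec x (w - y)‖ ≤ c' * R * ‖w - y‖ := (hc' _ _).trans (by gcongr)
      have h5 : ‖crossVec (w - y) x‖ ≤ c' * R * ‖w - y‖ := by
        refine (hc' _ _).trans ?_
        calc c' * ‖w - y‖ * ‖x‖ ≤ c' * ‖w - y‖ * R := by gcongr
          _ = _ := by ring
      linarith
    refine (hy _).trans ?_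
    gcongr
    have h9 : 0 ≤ d₁ := norm_nonneg _
    have h10 := norm_nonneg (outer y (x - V) + outer (x - V) y)
    have h11 := norm_nonneg (crossVec y (x - V) - crossVec (x - V) y)
    have h12 : ‖outer y (x - V)‖ ≤ ‖outer y (x - V) + outer (x - V) y‖
        + ‖crossVec y (x - V) - crossVec (x - V) y‖ := by
      refine le_of_sq_le_sq ?_ (by positivity)
      nlinarith [sq_nonneg ‖outer y (x - V)‖]
    linarith
  have h1 : outer x x - outer V V = outer (x - V) x + outer V (x - V) := by
    simp only [outer_sub_left, outer_sub_right]
    abel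
  have h2 : ‖outer x x - outer V V‖ ≤ c * (R + ‖V‖) * ‖x - V‖ := by
    rw [h1]
    have h4 : ‖outer (x - V) x‖ ≤ c * ‖x - V‖ * R := (hc _ _).trans (by gcongr)
    have h5 := hc V (x - V)
    refine (norm_add_le _ _).trans ?_
    linarith
  have hd₀' : 0 ≤ d₀ := norm_nonneg _
  have hd₁' : 0 ≤ d₁ := norm_nonneg _
  have hV0 : 0 ≤ R + ‖V‖ := add_nonneg hR0 (norm_nonneg V)
  have h3 : ‖x - V‖ ≤ κ * (1 + 4 * (c + c') * R * κ) * (d₀ + d₁) := by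
    refine hF.trans ?_
    have h4 : 2 * (c + c') * R * ‖w - y‖ ≤ 2 * (c + c') * R * (κ * (2 * d₀)) := by gcongr
    calc κ * (d₁ + 2 * (c + c') * R * ‖w - y‖) ≤ κ * (d₁ + 2 * (c + c') * R * (κ * (2 * d₀))) := by
          gcongr
      _ = κ * (d₁ + 4 * (c + c') * R * κ * d₀) := by ring
      _ ≤ κ * ((d₀ + d₁) + 4 * (c + c') * R * κ * (d₀ + d₁)) := by
          gcongr <;> linarith
      _ = _ := by ring
  calc ‖outer x x - outer V V‖ ≤ c * (R + ‖V‖) * ‖x - V‖ := h2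
    _ ≤ (4 * (c + c')) * (R + ‖V‖) * (κ * (1 + 4 * (c + c') * R * κ) * (d₀ + d₁)) := by
        gcongr
        linarith
    _ = _ := by ring

end GeodesicUniqueness

/-! ### Geodesics are projections of horizontal lines -/

section GeodesicLine

variable {n k : ℕ}

lemma norm_sq_eq_trace_outer (x : Centered n k) : ‖x‖ ^ 2 = (mat (outer x x)).trace := by
  rw [← real_inner_self_eq_norm_sq, inner_eq_trace, crossGram, mat_outer, Matrix.trace_mul_comm]

lemma norm_rmul {Q : Matrix (Fin k) (Fin k) ℝ} (hQ : Q ∈ orthogonalGroup (Fin k) ℝ)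
    (x : Centered n k) : ‖rmul x Q‖ = ‖x‖ := by
  rw [@norm_eq_sqrt_real_inner _ _ _ (rmul x Q), inner_rmul_rmul hQ, ← norm_eq_sqrt_real_inner]

lemma deriv_outer_line (Z V : Centered n k) (t : ℝ) :
    ContDiffAt ℝ 2 (fun τ : ℝ => outer (Z + τ • V) (Z + τ • V)) t ∧
    deriv (fun τ : ℝ => outer (Z + τ • V) (Z + τ • V)) t =
      outer V (Z + t • V) + outer (Z + t • V) V ∧
    deriv (deriv fun τ : ℝ => outer (Z + τ • V) (Z + τ • V)) t = (2 : ℝ) • outer V V := by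
  have hy : ContDiffAt ℝ 2 (fun τ : ℝ => Z + τ • V) t := by fun_prop
  have hd : deriv (fun τ : ℝ => Z + τ • V) = fun _ => V := by
    ext1 τ
    have h := ((hasDerivAt_id τ).smul_const V).const_add Z
    rw [one_smul] at h
    exact h.deriv
  obtain ⟨e1, e2⟩ := deriv_outer_self hy
  rw [hd] at e1 e2
  refine ⟨contDiffAt_outer hy hy, e1, ?_⟩
  rw [e2, deriv_const]
  simp only [← outerL_apply, map_zero, _root_.zero_apply, zero_add, add_zero]

/-- A twice differentiable function whose second derivative is bounded by the function and its
derivative vanishes if its initial data vanish. -/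
lemma eq_zero_of_deriv_deriv_le {E : Type*} [NormedAddCommGroup E] [NormedSpace ℝ E] {D : ℝ → E}
    {a b K : ℝ} (hK : 0 ≤ K) (hD : ∀ t ∈ Icc a b, ContDiffAt ℝ 2 D t) (h0 : D a = 0)
    (h1 : deriv D a = 0)
    (hb : ∀ t ∈ Ico a b, ‖deriv (deriv D) t‖ ≤ K * (‖D t‖ + ‖deriv D t‖)) :
    ∀ t ∈ Icc a b, D t = 0 ∧ deriv D t = 0 := by
  have hd : ∀ t ∈ Icc a b, HasDerivAt (fun t => (D t, deriv D t)) (deriv D t, deriv (deriv D) t) t :=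
    fun t ht => ((hD t ht).differentiableAt (by simp)).hasDerivAt.prodMk
      ((contDiffAt_deriv (hD t ht) (l := 1) (by norm_num)).differentiableAt (by simp)).hasDerivAt
  -- Grönwall for the pair `(D, D')` in the maximum norm: `‖D'‖` is at most the norm of the pair and
  -- `‖D''‖` at most `2K` times it, so `2K + 1` serves for both.
  have h := eq_zero_of_abs_deriv_le_mul_abs_self_of_eq_zero_right (f := fun t => (D t, deriv D t))
    (f' := fun t => (deriv D t, deriv (deriv D) t)) (K := 2 * K + 1) (a := a) (b := b)
    (fun t ht => (hd t ht).continuousAt.continuousWithinAt)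
    (fun t ht => (hd t ⟨ht.1, ht.2.le⟩).hasDerivWithinAt) (by simp [h0, h1]) (by
      intro t ht
      have e1 : ‖D t‖ ≤ ‖(D t, deriv D t)‖ := norm_fst_le (D t, deriv D t)
      have e2 : ‖deriv D t‖ ≤ ‖(D t, deriv D t)‖ := norm_snd_le (D t, deriv D t)
      have e3 := hb t ht
      have e4 : K * (‖D t‖ + ‖deriv D t‖) ≤ K * (‖(D t, deriv D t)‖ + ‖(D t, deriv D t)‖) := by
        gcongr
      have e5 : 0 ≤ K * ‖(D t, deriv D t)‖ := by positivity
      have e6 := norm_nonneg (D t, deriv D t)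
      rw [Prod.norm_mk (deriv D t)]
      refine max_le ?_ ?_ <;> linarith)
  exact fun t ht => Prod.mk.inj (h t ht)

/-- The representative `X = (γ t).out` need not depend continuously on `t`, but `det(YᵀX) det(XᵀY) =
det(Yᵀ(XXᵀ)Y)` involves the Gram matrix only. -/
lemma eventually_gram_det {Y : ℝ → Centered n k} {γ : ℝ → QuotM n k} {t₀ : ℝ}
    (hY : ContinuousAt Y t₀) (hg : ContinuousAt (fun t => gram (γ t)) t₀)
    (h : gram (γ t₀) = outer (Y t₀) (Y t₀)) (h0 : Y t₀ ∈ R0 n k) :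
    ∀ᶠ t in 𝓝 t₀, (crossGram (Y t) (γ t).out).det ≠ 0 := by
  have hm : Continuous fun v : Vec n n => mat v := mat.continuous_of_finiteDimensional
  have hm' : Continuous fun v : Centered n k => mat (v : Vec n k) :=
    ((mat : Vec n k →ₗ[ℝ] _).comp (Centered n k).subtype).continuous_of_finiteDimensional
  have hc : ContinuousAt (fun t => ((mat (Y t : Vec n k))ᵀ * mat (gram (γ t))
      * mat (Y t : Vec n k)).det) t₀ := by
    have a1 : ContinuousAt (fun t => mat (Y t : Vec n k)) t₀ := hm'.continuousAt.comp hY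
    have a2 : ContinuousAt (fun t => mat (gram (γ t))) t₀ :=
      ContinuousAt.comp (f := fun t => gram (γ t)) hm.continuousAt hg
    have a3 : Continuous fun q : Matrix (Fin n) (Fin k) ℝ × Matrix (Fin n) (Fin n) ℝ =>
      (q.1ᵀ * q.2 * q.1).det := by fun_prop
    exact ContinuousAt.comp (g := fun q : Matrix (Fin n) (Fin k) ℝ × Matrix (Fin n) (Fin n) ℝ =>
      (q.1ᵀ * q.2 * q.1).det) (f := fun t => (mat (Y t : Vec n k), mat (gram (γ t))))
      a3.continuousAt (a1.prodMk a2)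
  have hne : ((mat (Y t₀ : Vec n k))ᵀ * mat (gram (γ t₀)) * mat (Y t₀ : Vec n k)).det ≠ 0 := by
    have e : (mat (Y t₀ : Vec n k))ᵀ * mat (gram (γ t₀)) * mat (Y t₀ : Vec n k)
        = crossGram (Y t₀) (Y t₀) * crossGram (Y t₀) (Y t₀) := by
      rw [h, mat_outer]
      simp only [crossGram, Matrix.mul_assoc]
    rw [e, det_mul]
    exact mul_ne_zero (mem_R0.1 h0) (mem_R0.1 h0)
  filter_upwards [hc.eventually (isOpen_ne.mem_nhds hne)] with t ht hdet
  refine ht ?_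
  have e : (mat (Y t : Vec n k))ᵀ * mat (gram (γ t)) * mat (Y t : Vec n k)
      = crossGram (Y t) (γ t).out * crossGram ((γ t).out : Centered n k) (Y t) := by
    conv_lhs => rw [← cls_out (γ t), gram_cls, mat_outer]
    simp only [crossGram, Matrix.mul_assoc]
  change ((mat (Y t : Vec n k))ᵀ * mat (gram (γ t)) * mat (Y t : Vec n k)).det = 0
  rw [e, det_mul, hdet, zero_mul]

/-- A geodesic with horizontal initial velocity `V` at `Z` is the projection of the line `Z + t V`. -/
theorem gram_geodesic_eq_line {γ : ℝ → QuotM n k} {Z V : Centered n k} (hV : V ∈ slice Z)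
    (hγ : IsGeodesicOn (quotMetric n k) γ (Icc 0 1)) (h0 : gram (γ 0) = outer Z Z)
    (h1 : deriv (fun t => gram (γ t)) 0 = outer V Z + outer Z V) :
    ∀ t ∈ Icc (0 : ℝ) 1, gram (γ t) = outer (Z + t • V) (Z + t • V) := by
  set g : ℝ → Vec n n := fun t => gram (γ t) with hg
  set Y : ℝ → Centered n k := fun t => Z + t • V with hY
  set B : ℝ → Vec n n := fun t => outer (Y t) (Y t) with hB
  set D : ℝ → Vec n n := fun t => g t - B t with hD
  have hBc : ∀ t, ContDiffAt ℝ 2 B t := fun t => (deriv_outer_line Z V t).1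
  have hgc : ∀ t ∈ Icc (0 : ℝ) 1, ContDiffAt ℝ 2 g t := fun t ht => (gram_geodesic hγ ht).1
  have hDc : ∀ t ∈ Icc (0 : ℝ) 1, ContDiffAt ℝ 2 D t := fun t ht => (hgc t ht).sub (hBc t)
  have hD1 : ∀ t, ContDiffAt ℝ 2 g t → deriv D t = deriv g t - deriv B t := fun t ht =>
    deriv_fun_sub (ht.differentiableAt (by simp)) ((hBc t).differentiableAt (by simp))
  have hD2 : ∀ t ∈ Icc (0 : ℝ) 1, deriv (deriv D) t = deriv (deriv g) t - deriv (deriv B) t := by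
    intro t ht
    have e : deriv D =ᶠ[𝓝 t] fun τ => deriv g τ - deriv B τ := by
      filter_upwards [(hgc t ht).eventually (by simp)] with τ hτ using hD1 τ hτ
    rw [e.deriv_eq]
    exact deriv_fun_sub
      ((contDiffAt_deriv (hgc t ht) (l := 1) (by norm_num)).differentiableAt (by simp))
      ((contDiffAt_deriv (hBc t) (l := 1) (by norm_num)).differentiableAt (by simp))
  have hYc : Continuous Y := continuous_line Z V
  have hgout : ∀ t, g t = outer ((γ t).out : Centered n k) (γ t).out := fun t => by
    rw [← gram_cls, cls_out]
  have hVY : ∀ t, V ∈ slice (Y t) := fun t => by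
    rw [mem_slice_iff] at *
    have e : crossGram (Y t) V = crossGram Z V + t • crossGram V V := by
      simp [hY, crossGram, Matrix.add_mul]
    rw [e, transpose_add, hV, transpose_smul, transpose_crossGram]
  let s : Set ℝ := {t | D t = 0 ∧ deriv D t = 0}
  suffices hs : Icc (0 : ℝ) 1 ⊆ s from fun t ht => sub_eq_zero.1 (hs ht).1
  have hcont : ContinuousOn (fun t => (D t, deriv D t)) (Icc 0 1) := fun t ht =>
    ((hDc t ht).continuousAt.prodMk
      (contDiffAt_deriv (hDc t ht) (l := 1) (by norm_num)).continuousAt).continuousWithinAt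
  -- Continuation along `[0, 1]`: the set where the two Gram curves agree to first order is closed,
  -- contains `0`, and contains a right neighborhood of each of its points before `1`.
  refine IsClosed.Icc_subset_of_forall_mem_nhdsWithin ?_ ?_ ?_
  · have h := hcont.preimage_isClosed_of_isClosed isClosed_Icc (isClosed_singleton (x := (0, 0)))
    convert h using 1
    ext t
    simp only [s, mem_inter_iff, Set.mem_ofPred_eq, mem_preimage, mem_singleton_iff, Prod.mk.injEq]
    exact and_comm
  · have hz : Y 0 = Z := by simp [hY]
    refine ⟨?_, ?_⟩
    · change g 0 - B 0 = 0
      rw [sub_eq_zero, hB]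
      simp only [hz]
      exact h0
    · rw [hD1 0 (hgc 0 (by simp)), h1, (deriv_outer_line Z V 0).2.1]
      change _ - (outer V (Y 0) + outer (Y 0) V) = 0
      rw [hz, sub_self]
  · rintro t₀ ⟨⟨hs0, hs1⟩, ht₀⟩
    have ht₀' : t₀ ∈ Icc (0 : ℝ) 1 := ⟨ht₀.1, ht₀.2.le⟩
    have hgB : g t₀ = outer (Y t₀) (Y t₀) := sub_eq_zero.1 hs0
    -- The agreement at `t₀` gives the line full rank there, hence a constant `κ` that is valid
    -- nearby.
    have hYR : Y t₀ ∈ R0 n k := mem_R0_of_outer_eq ((hgout t₀).symm.trans hgB)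
    obtain ⟨κ, hκ, hκe⟩ := exists_outer_bound hYR
    obtain ⟨c, hc0, hc⟩ := exists_gram_estimate n k
    have htr : ContinuousAt (fun t => (mat (deriv (deriv g) t)).trace) t₀ := by
      have a1 : ContinuousAt (deriv (deriv g)) t₀ :=
        (contDiffAt_deriv (contDiffAt_deriv (hgc t₀ ht₀') (l := 1) (by norm_num)) (l := 0)
          (by norm_num)).continuousAt
      have a2 : Continuous fun v : Vec n n => (mat v).trace :=
        (Matrix.traceLinearMap (Fin n) ℝ ℝ ∘ₗ mat).continuous_of_finiteDimensional
      exact a2.continuousAt.comp a1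
    -- The trace of the Gram acceleration is `2‖X‖²`. Its continuity bounds the speed `‖X‖` near
    -- `t₀`, although `X` is expressed in representatives that may jump.
    set R := (mat (deriv (deriv g) t₀)).trace + 2 with hR
    have ev1 : ∀ᶠ t in 𝓝 t₀, ∀ e, ‖e‖ ≤ κ * ‖outer (Y t) e‖ := hYc.continuousAt.eventually hκe
    have ev2 := eventually_gram_det hYc.continuousAt (hgc t₀ ht₀').continuousAt hgB hYR
    have ev3 : ∀ᶠ t in 𝓝 t₀, (mat (deriv (deriv g) t)).trace < R - 1 :=
      htr.eventually (gt_mem_nhds (by rw [hR]; linarith))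
    obtain ⟨ε, hε, hball⟩ := Metric.eventually_nhds_iff.1 (ev1.and (ev2.and ev3))
    set b := min (t₀ + ε / 2) 1 with hb
    have hb0 : t₀ < b := lt_min (by linarith) ht₀.2
    have hsub : ∀ t ∈ Icc t₀ b, t ∈ Icc (0 : ℝ) 1 := fun t ht =>
      ⟨ht₀.1.trans ht.1, ht.2.trans (min_le_right _ _)⟩
    have hnear : ∀ t ∈ Icc t₀ b, dist t t₀ < ε := fun t ht => by
      rw [Real.dist_eq, abs_of_nonneg (by linarith [ht.1])]
      linarith [ht.2, min_le_left (t₀ + ε / 2) (1 : ℝ)]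
    set R' := max R 0 with hR'
    have key := eq_zero_of_deriv_deriv_le (D := D) (a := t₀) (b := b)
      (K := 2 * (c * (R' + ‖V‖) * κ * (1 + c * R' * κ)))
      (by positivity) (fun t ht => hDc t (hsub t ht)) hs0 hs1 (by
        intro t ht
        have ht1 : t ∈ Icc (0 : ℝ) 1 := hsub t ⟨ht.1, ht.2.le⟩
        obtain ⟨b1, b2, b3⟩ := hball (hnear t ⟨ht.1, ht.2.le⟩)
        obtain ⟨-, g1, g2⟩ := gram_geodesic hγ ht1
        obtain ⟨-, l1, l2⟩ := deriv_outer_line Z V t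
        set X := param (γ t).out (deriv (curveInChart γ t) t) with hX
        have hXs : X ∈ slice ((γ t).out : Centered n k) := param_mem _ _
        -- Rotates the representative so that its product with `Y t` is positive definite, as the
        -- estimate requires; the Gram quantities do not change.
        set Q := polarFactor (crossGram (Y t) (γ t).out) with hQ
        have hQo : Q ∈ orthogonalGroup (Fin k) ℝ := polarFactor_mem b2
        have hXR : ‖X‖ ≤ R' := by
          have e1 : (mat (deriv (deriv g) t)).trace = 2 * ‖X‖ ^ 2 := by
            rw [g2, norm_sq_eq_trace_outer, map_smul, trace_smul, smul_eq_mul]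
          refine le_trans ?_ (le_max_left R 0)
          nlinarith [sq_nonneg (‖X‖ - 1)]
        have hest := hc (Y t) (rmul (γ t).out Q) V (rmul X Q) κ R' hκ b1 (by
          rw [crossGram_rmul]
          exact mul_polarFactor b2) (hVY t) (rmul_mem_slice hXs Q) (by rwa [norm_rmul hQo])
        simp only [outer_rmul hQo] at hest
        rw [hD2 t ht1, hD1 t (hgc t ht1), g1, g2, l1, l2]
        change _ ≤ _ * (‖g t - outer (Y t) (Y t)‖ + _)
        rw [hgout t, ← smul_sub, norm_smul, Real.norm_two, mul_assoc]
        gcongr)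
    exact Filter.mem_of_superset (Icc_mem_nhdsGT hb0) key

/-- The exponential map of the quotient. -/
theorem isExp_dcls_iff {Z : R0 n k} {V : Centered n k} (hV : V ∈ slice (Z : Centered n k))
    (q : QuotM n k) : IsExp (quotMetric n k) ⟨cls Z, dcls Z V⟩ q ↔
      (∀ t ∈ Icc (0 : ℝ) 1, (Z : Centered n k) + t • V ∈ R0 n k) ∧
        ∃ h : (Z : Centered n k) + V ∈ R0 n k, q = cls ⟨(Z : Centered n k) + V, h⟩ := by
  constructor
  · rintro ⟨γ, hγ, hv, rfl⟩
    have hm := (hγ 0 (by simp)).1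
    rw [dcls_eq] at hv
    obtain ⟨e0, e1⟩ := tangentBundle_mk_inj hv
    have e2 : deriv (curveInChart γ 0) 0 = dproj Z V := (mfderiv_curve hm).symm.trans e1
    have hg0 : gram (γ 0) = outer (Z : Centered n k) Z := by rw [e0, gram_cls]
    have hg1 : deriv (fun t => gram (γ t)) 0
        = outer V (Z : Centered n k) + outer (Z : Centered n k) V := by
      obtain ⟨Q, hQ, h⟩ := exists_out_cls_eq Z
      rw [(gram_geodesic hγ (t := 0) (by simp)).2.1, e2, e0, param_dproj hQ h hV, h, outer_rmul hQ,
        outer_rmul hQ]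
    have key := gram_geodesic_eq_line hV hγ hg0 hg1
    -- The comparison of Gram matrices did not assume that the line keeps full rank; this now
    -- follows from it.
    have hmem : ∀ t ∈ Icc (0 : ℝ) 1, (Z : Centered n k) + t • V ∈ R0 n k := fun t ht => by
      have h := key t ht
      rw [← cls_out (γ t), gram_cls] at h
      exact mem_R0_of_outer_eq h
    have h1 : (Z : Centered n k) + V ∈ R0 n k := by simpa using hmem 1 (by simp)
    refine ⟨hmem, h1, gram_injective ?_⟩
    rw [key 1 (by simp), gram_cls, one_smul]
  · rintro ⟨hmem, h1, rfl⟩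
    exact isExp_line hV hmem h1

end GeodesicLine

/-! ### Moments of the Poisson model -/

section Moments
open MeasureTheory ProbabilityTheory
open scoped NNReal Nat

/-- The term `m = 0` vanishes, and shifting the index reduces the sum to `r` times the total mass.
-/
lemma hasSum_poisson_mul (r : ℝ≥0) :
    HasSum (fun m : ℕ => Real.exp (-r) * r ^ m / m ! * (m : ℝ)) r := by
  have h := (hasSum_one_poissonMeasure r).mul_left (r : ℝ)
  rw [mul_one] at h
  have h1 : HasSum (fun m : ℕ => Real.exp (-r) * r ^ (m + 1) / (m + 1)! * ((m + 1 : ℕ) : ℝ)) r := by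
    have e : (fun m : ℕ => Real.exp (-r) * r ^ (m + 1) / (m + 1)! * ((m + 1 : ℕ) : ℝ)) =
        fun m : ℕ => (r : ℝ) * (Real.exp (-r) * r ^ m / m !) := by
      ext m
      rw [Nat.factorial_succ]
      push_cast
      field_simp
      try ring
    rw [e]
    exact h
  have := (hasSum_nat_add_iff (f := fun m : ℕ => Real.exp (-r) * r ^ m / m ! * (m : ℝ)) 1).1 h1
  simpa using this

lemma hasSum_poisson_mul_sq (r : ℝ≥0) :
    HasSum (fun m : ℕ => Real.exp (-r) * r ^ m / m ! * (m : ℝ) ^ 2) (r * (r + 1)) := by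
  have h := ((hasSum_poisson_mul r).add (hasSum_one_poissonMeasure r)).mul_left (r : ℝ)
  have h1 : HasSum (fun m : ℕ => Real.exp (-r) * r ^ (m + 1) / (m + 1)! * ((m + 1 : ℕ) : ℝ) ^ 2)
      (r * (r + 1)) := by
    have e : (fun m : ℕ => Real.exp (-r) * r ^ (m + 1) / (m + 1)! * ((m + 1 : ℕ) : ℝ) ^ 2) =
        fun m : ℕ => (r : ℝ) *
          (Real.exp (-r) * r ^ m / m ! * (m : ℝ) + Real.exp (-r) * r ^ m / m !) := by
      ext m
      rw [Nat.factorial_succ]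
      push_cast
      field_simp
      try ring
    rw [e]
    exact h
  have := (hasSum_nat_add_iff (f := fun m : ℕ => Real.exp (-r) * r ^ m / m ! * (m : ℝ) ^ 2) 1).1 h1
  simpa using this

lemma integrable_poisson_sq (r : ℝ≥0) :
    Integrable (fun m : ℕ => (m : ℝ) ^ 2) (poissonMeasure r) := by
  rw [integrable_poissonMeasure_iff]
  simpa using (hasSum_poisson_mul_sq r).summable

lemma integrable_poisson_id (r : ℝ≥0) : Integrable (fun m : ℕ => (m : ℝ)) (poissonMeasure r) := by
  rw [integrable_poissonMeasure_iff]
  simpa using (hasSum_poisson_mul r).summable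

lemma integral_poisson_id (r : ℝ≥0) : ∫ m : ℕ, (m : ℝ) ∂poissonMeasure r = r := by
  rw [integral_poissonMeasure]
  exact (hasSum_poisson_mul r).tsum_eq

lemma integral_poisson_sq (r : ℝ≥0) : ∫ m : ℕ, (m : ℝ) ^ 2 ∂poissonMeasure r = r * (r + 1) := by
  rw [integral_poissonMeasure]
  exact (hasSum_poisson_mul_sq r).tsum_eq

lemma integral_poisson_sub (r : ℝ≥0) : ∫ m : ℕ, ((m : ℝ) - r) ∂poissonMeasure r = 0 := by
  rw [integral_sub (integrable_poisson_id r) (integrable_const _), integral_poisson_id]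
  simp

lemma integrable_poisson_sub_sq (r : ℝ≥0) :
    Integrable (fun m : ℕ => ((m : ℝ) - r) ^ 2) (poissonMeasure r) := by
  have h : (fun m : ℕ => ((m : ℝ) - r) ^ 2) = fun m : ℕ => (m : ℝ) ^ 2 - 2 * r * m + (r : ℝ) ^ 2 := by
    ext m
    ring
  rw [h]
  exact ((integrable_poisson_sq r).sub ((integrable_poisson_id r).const_mul _)).add
    (integrable_const _)

lemma integral_poisson_sub_sq (r : ℝ≥0) :
    ∫ m : ℕ, ((m : ℝ) - r) ^ 2 ∂poissonMeasure r = r := by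
  have h : (fun m : ℕ => ((m : ℝ) - r) ^ 2) = fun m : ℕ => (m : ℝ) ^ 2 - 2 * r * m + (r : ℝ) ^ 2 := by
    ext m
    ring
  have h2 : Integrable (fun m : ℕ => 2 * (r : ℝ) * m) (poissonMeasure r) :=
    (integrable_poisson_id r).const_mul _
  have h3 : Integrable (fun m : ℕ => (m : ℝ) ^ 2 - 2 * r * m) (poissonMeasure r) :=
    (integrable_poisson_sq r).sub h2
  rw [h, integral_add h3 (integrable_const _),
    integral_sub (integrable_poisson_sq r) h2, integral_const_mul, integral_poisson_id,
    integral_poisson_sq]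
  simp
  ring

variable {n k T : ℕ}

/-- The centered counts. -/
def residual (A : Data n T) (z : Vec n k) (α : Vec T n) (s : Fin T × NodePair n) : ℝ :=
  (A s : ℝ) - Real.exp (linPred z α s)

lemma residual_eq (A : Data n T) (z : Vec n k) (α : Vec T n) (s : Fin T × NodePair n) :
    residual A z α s = (A s : ℝ) - (Real.toNNReal (Real.exp (linPred z α s)) : ℝ) := by
  rw [residual, Real.coe_toNNReal _ (Real.exp_pos _).le]

lemma memLp_residual (z : Vec n k) (α : Vec T n) (s : Fin T × NodePair n) :
    MemLp (fun A => residual A z α s) 2 (dataLaw z α) := by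
  have hm : AEStronglyMeasurable (fun A : Data n T => residual A z α s) (dataLaw z α) := by
    have h : Measurable fun A : Data n T => (A s : ℝ) := (measurable_of_countable _).comp (measurable_pi_apply s)
    exact (h.sub_const _).aestronglyMeasurable
  rw [memLp_two_iff_integrable_sq hm]
  simp only [residual_eq]
  exact integrable_comp_eval (μ := fun s => poissonMeasure (Real.toNNReal (Real.exp (linPred z α s))))
    (i := s) (integrable_poisson_sub_sq _)

lemma integrable_residual_mul (z : Vec n k) (α : Vec T n) (s s' : Fin T × NodePair n) :
    Integrable (fun A => residual A z α s * residual A z α s') (dataLaw z α) :=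
  (memLp_residual z α s).integrable_mul (memLp_residual z α s')

lemma integral_residual (z : Vec n k) (α : Vec T n) (s : Fin T × NodePair n) :
    ∫ A, residual A z α s ∂dataLaw z α = 0 := by
  simp only [residual_eq]
  have h := integral_comp_eval
    (μ := fun s => poissonMeasure (Real.toNNReal (Real.exp (linPred z α s)))) (i := s)
    (f := fun m : ℕ => (m : ℝ) - (Real.toNNReal (Real.exp (linPred z α s)) : ℝ))
    (measurable_of_countable _).aestronglyMeasurable
  exact h.trans (integral_poisson_sub _)

lemma integral_residual_mul (z : Vec n k) (α : Vec T n) (s s' : Fin T × NodePair n) :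
    ∫ A, residual A z α s * residual A z α s' ∂dataLaw z α =
      Matrix.diagonal (fun s => Real.exp (linPred z α s)) s s' := by
  by_cases hs : s = s'
  · subst hs
    rw [Matrix.diagonal_apply_eq]
    simp only [residual_eq, ← sq]
    have h := integral_comp_eval
      (μ := fun s => poissonMeasure (Real.toNNReal (Real.exp (linPred z α s)))) (i := s)
      (f := fun m : ℕ => ((m : ℝ) - (Real.toNNReal (Real.exp (linPred z α s)) : ℝ)) ^ 2)
      (measurable_of_countable _).aestronglyMeasurable
    refine (h.trans (integral_poisson_sub_sq _)).trans ?_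
    exact Real.coe_toNNReal _ (Real.exp_pos _).le
  · rw [Matrix.diagonal_apply_ne _ hs]
    have hi := iIndepFun_pi (μ := fun s => poissonMeasure (Real.toNNReal (Real.exp (linPred z α s))))
      (X := fun s (m : ℕ) => (m : ℝ) - Real.exp (linPred z α s))
      (fun s => (measurable_of_countable _).aemeasurable)
    have h := (hi.indepFun hs).integral_fun_mul_eq_mul_integral
      (memLp_residual z α s).1 (memLp_residual z α s').1
    refine h.trans ?_
    have h0 := integral_residual z α s
    refine mul_eq_zero_of_left ?_ _
    exact h0

/-- The covariance of linear functions of the centered counts. -/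
lemma integral_mulVec_residual {ι κ : Type*} (z : Vec n k) (α : Vec T n)
    (M : Matrix ι (Fin T × NodePair n) ℝ) (N : Matrix κ (Fin T × NodePair n) ℝ) (a : ι) (b : κ) :
    ∫ A, (M *ᵥ residual A z α) a * (N *ᵥ residual A z α) b ∂dataLaw z α =
      (M * Matrix.diagonal (fun s => Real.exp (linPred z α s)) * Nᵀ) a b := by
  have e : ∀ A : Data n T, (M *ᵥ residual A z α) a * (N *ᵥ residual A z α) b =
      ∑ s, ∑ s', M a s * N b s' * (residual A z α s * residual A z α s') := by
    intro A
    simp only [mulVec, dotProduct, Finset.sum_mul_sum]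
    exact Finset.sum_congr rfl fun s _ => Finset.sum_congr rfl fun s' _ => by ring
  simp only [e]
  rw [integral_finsetSum _ fun s _ => integrable_finsetSum _ fun s' _ =>
    (integrable_residual_mul z α s s').const_mul _]
  simp_rw [integral_finsetSum _ fun s' _ => (integrable_residual_mul z α _ s').const_mul _,
    integral_const_mul, integral_residual_mul]
  rw [Matrix.mul_apply]
  simp only [Matrix.mul_apply, Matrix.transpose_apply, Finset.sum_mul]
  rw [Finset.sum_comm]
  exact Finset.sum_congr rfl fun s _ => Finset.sum_congr rfl fun s' _ => by ring

end Moments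

/-! ### Second-order calculus of profile functions -/

section Profile
variable {E₁ E₂ : Type*} [NormedAddCommGroup E₁] [NormedSpace ℝ E₁]
  [NormedAddCommGroup E₂] [InnerProductSpace ℝ E₂] [FiniteDimensional ℝ E₂]

/-- The gradient in the second variable. -/
def partialGradient (L : E₁ × E₂ → ℝ) (x : E₁ × E₂) : E₂ :=
  (InnerProductSpace.toDual ℝ E₂).symm (fderiv ℝ L x ∘L .inr ℝ E₁ E₂)

lemma inner_partialGradient (L : E₁ × E₂ → ℝ) (x : E₁ × E₂) (β : E₂) :
    inner ℝ (partialGradient L x) β = fderiv ℝ L x (0, β) := by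
  rw [partialGradient, InnerProductSpace.toDual_symm_apply]
  rfl

lemma contDiff_partialGradient {L : E₁ × E₂ → ℝ} (hL : ContDiff ℝ ∞ L) :
    ContDiff ℝ ∞ (partialGradient L) := by
  have h : ContDiff ℝ ∞ (fderiv ℝ L) := hL.fderiv_right (by simp)
  exact (InnerProductSpace.toDual ℝ E₂).symm.toContinuousLinearEquiv.contDiff.comp
    (h.clm_comp contDiff_const)

lemma inner_fderiv_partialGradient {L : E₁ × E₂ → ℝ} (hL : ContDiff ℝ ∞ L) (x h : E₁ × E₂)
    (β : E₂) :
    inner ℝ (fderiv ℝ (partialGradient L) x h) β = fderiv ℝ (fderiv ℝ L) x h (0, β) := by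
  have h1 := (((contDiff_partialGradient hL).differentiable (by simp)) x).hasFDerivAt.inner ℝ
    (hasFDerivAt_const β x)
  have h2 : HasFDerivAt (fun y => fderiv ℝ L y (0, β))
      ((fderiv ℝ (fderiv ℝ L) x).flip (0, β)) x := by
    have h : ContDiff ℝ ∞ (fderiv ℝ L) := hL.fderiv_right (by simp)
    have := (h.differentiable (by simp) x).hasFDerivAt.clm_apply
      (hasFDerivAt_const ((0, β) : E₁ × E₂) x)
    refine this.congr_fderiv ?_
    ext <;> simp
  simp only [inner_partialGradient] at h1
  have := DFunLike.congr_fun (h1.unique h2) h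
  simpa [fderivInnerCLM_apply] using this

/-- If `a z` is the only critical point of `L (z, ·)` for every `z` and the second derivative of
`L (z₀, ·)` is nondegenerate at `a z₀`, then the profile function `z ↦ L (z, a z)` is smooth at `z₀`,
with the derivatives given by the envelope theorem. -/
theorem profile_calculus [CompleteSpace E₁] {L : E₁ × E₂ → ℝ} (hL : ContDiff ℝ ∞ L) {a : E₁ → E₂} {z₀ : E₁}
    (huniq : ∀ z α, (∀ β, fderiv ℝ L (z, α) (0, β) = 0) → α = a z)
    (hcrit : ∀ β, fderiv ℝ L (z₀, a z₀) (0, β) = 0)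
    (hnd : ∀ β, (∀ β', fderiv ℝ (fderiv ℝ L) (z₀, a z₀) (0, β) (0, β') = 0) → β = 0) :
    ContDiffAt ℝ ∞ (fun z => L (z, a z)) z₀ ∧
    (∀ v, fderiv ℝ (fun z => L (z, a z)) z₀ v = fderiv ℝ L (z₀, a z₀) (v, 0)) ∧
    ∀ u, ∃ γ, (∀ β, fderiv ℝ (fderiv ℝ L) (z₀, a z₀) (u, γ) (0, β) = 0) ∧
      ∀ v, fderiv ℝ (fderiv ℝ fun z => L (z, a z)) z₀ u v =
        fderiv ℝ (fderiv ℝ L) (z₀, a z₀) (u, γ) (v, 0) := by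
  have hF := contDiff_partialGradient hL
  have hd2 : ContDiff ℝ ∞ (fderiv ℝ L) := hL.fderiv_right (by simp)
  have hF0 : partialGradient L (z₀, a z₀) = 0 :=
    ext_inner_right ℝ fun β => by rw [inner_partialGradient, hcrit, inner_zero_left]
  -- In finite dimension nondegeneracy gives the invertibility needed for the implicit function
  -- theorem.
  have hinv : (fderiv ℝ (partialGradient L) (z₀, a z₀) ∘L .inr ℝ E₁ E₂).IsInvertible := by
    set D := fderiv ℝ (partialGradient L) (z₀, a z₀) ∘L .inr ℝ E₁ E₂ with hD
    have hinj : Function.Injective D.toLinearMap := by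
      rw [injective_iff_map_eq_zero]
      intro β hβ
      refine hnd β fun β' => ?_
      rw [← inner_fderiv_partialGradient hL]
      have hβ : fderiv ℝ (partialGradient L) (z₀, a z₀) (0, β) = 0 := hβ
      rw [hβ, inner_zero_left]
    refine ⟨(LinearEquiv.ofInjectiveEndo D.toLinearMap hinj).toContinuousLinearEquiv, ?_⟩
    ext β
    rfl
  have hFc : ContDiffAt ℝ ∞ (partialGradient L) (z₀, a z₀) := hF.contDiffAt
  set ψ := hFc.implicitFunction (by simp) hinv with hψ
  have hψ0 : ψ z₀ = a z₀ := hFc.implicitFunction_apply_self (by simp) hinv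
  have hψc : ContDiffAt ℝ ∞ ψ z₀ := hFc.contDiffAt_implicitFunction (by simp) hinv
  have hψF : ∀ᶠ z in 𝓝 z₀, partialGradient L (z, ψ z) = 0 := by
    filter_upwards [hFc.eventually_apply_implicitFunction (by simp) hinv] with z hz
    exact hz.trans hF0
  -- The implicit function yields critical points near `z₀`; by uniqueness they are the values of
  -- `a`, so `a` is smooth near `z₀`.
  have hψa : ∀ᶠ z in 𝓝 z₀, ψ z = a z := by
    filter_upwards [hψF] with z hz
    refine huniq z _ fun β => ?_
    rw [← inner_partialGradient, hz, inner_zero_left]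
  have hpψ : (fun z => L (z, a z)) =ᶠ[𝓝 z₀] fun z => L (z, ψ z) := by
    filter_upwards [hψa] with z hz
    rw [hz]
  have hdiffψ : ∀ᶠ z in 𝓝 z₀, DifferentiableAt ℝ ψ z := by
    filter_upwards [(hψc.of_le (m := 1) (by exact_mod_cast le_top)).eventually (by simp)] with z hz
    exact hz.differentiableAt (by simp)
  have hpd : ∀ᶠ z in 𝓝 z₀, fderiv ℝ (fun z => L (z, a z)) z = fderiv ℝ L (z, ψ z) ∘L .inl ℝ E₁ E₂ := by
    filter_upwards [hpψ.eventuallyEq_nhds, hdiffψ, hψF] with z h1 h2 h3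
    rw [h1.fderiv_eq]
    have h4 : HasFDerivAt (fun z => L (z, ψ z))
        (fderiv ℝ L (z, ψ z) ∘L (ContinuousLinearMap.prod (.id ℝ E₁) (fderiv ℝ ψ z))) z :=
      HasFDerivAt.comp z (g := L) (hL.differentiable (by simp) _).hasFDerivAt
        ((hasFDerivAt_id z).prodMk h2.hasFDerivAt)
    rw [h4.fderiv]
    ext v
    -- Envelope theorem: the motion of the critical point does not contribute to first order.
    have h5 : fderiv ℝ L (z, ψ z) (0, fderiv ℝ ψ z v) = 0 := by
      rw [← inner_partialGradient, h3, inner_zero_left]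
    change fderiv ℝ L (z, ψ z) (v, fderiv ℝ ψ z v) = fderiv ℝ L (z, ψ z) (v, 0)
    have h6 : ((v, fderiv ℝ ψ z v) : E₁ × E₂) = (v, 0) + (0, fderiv ℝ ψ z v) := by simp
    rw [h6, map_add, h5, add_zero]
  have hψd := (hψc.differentiableAt (by simp)).hasFDerivAt
  have hx : HasFDerivAt (fun z => ((z, ψ z) : E₁ × E₂))
      (ContinuousLinearMap.prod (.id ℝ E₁) (fderiv ℝ ψ z₀)) z₀ :=
    (hasFDerivAt_id z₀).prodMk hψd
  refine ⟨(hL.contDiffAt.comp z₀ (contDiffAt_id.prodMk hψc)).congr_of_eventuallyEq hpψ, fun v => ?_,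
    fun u => ⟨fderiv ℝ ψ z₀ u, fun β => ?_, fun v => ?_⟩⟩
  · rw [hpd.self_of_nhds, hψ0]
    rfl
  · rw [← inner_fderiv_partialGradient hL]
    have h1 : HasFDerivAt (fun z => partialGradient L (z, ψ z)) (fderiv ℝ (partialGradient L)
        (z₀, ψ z₀) ∘L (ContinuousLinearMap.prod (.id ℝ E₁) (fderiv ℝ ψ z₀))) z₀ :=
      HasFDerivAt.comp z₀ (g := partialGradient L) (hF.differentiable (by simp) _).hasFDerivAt hx
    have h2 : HasFDerivAt (fun z => partialGradient L (z, ψ z)) (0 : E₁ →L[ℝ] E₂) z₀ :=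
      (hasFDerivAt_const (0 : E₂) z₀).congr_of_eventuallyEq hψF
    have h3 := DFunLike.congr_fun (h1.unique h2) u
    rw [hψ0] at h3
    have h3 : fderiv ℝ (partialGradient L) (z₀, a z₀) (u, fderiv ℝ ψ z₀ u) = 0 := h3
    rw [h3, inner_zero_left]
  · rw [Filter.EventuallyEq.fderiv_eq hpd]
    have h1 : HasFDerivAt (fun z => fderiv ℝ L (z, ψ z)) (fderiv ℝ (fderiv ℝ L)
        (z₀, ψ z₀) ∘L (ContinuousLinearMap.prod (.id ℝ E₁) (fderiv ℝ ψ z₀))) z₀ :=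
      HasFDerivAt.comp z₀ (g := fderiv ℝ L) (hd2.differentiable (by simp) _).hasFDerivAt hx
    have h2 := h1.clm_comp (hasFDerivAt_const (ContinuousLinearMap.inl ℝ E₁ E₂) z₀)
    rw [h2.fderiv, hψ0]
    simp

end Profile

/-! ### Derivatives of the log-likelihood -/

section LogLik
variable {n k T : ℕ}

/-- The derivative of the linear predictor in the direction `v` of `Z_v`. -/
def linZ (z v : Vec n k) (s : Fin T × NodePair n) : ℝ :=
  ∑ l, (v (s.2.1.1, l) * z (s.2.1.2, l) + z (s.2.1.1, l) * v (s.2.1.2, l))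

/-- The derivative of the linear predictor in the direction `β` of `α_v`. -/
def linAlpha (β : Vec T n) (s : Fin T × NodePair n) : ℝ := β (s.1, s.2.1.1) + β (s.1, s.2.1.2)

/-- The log-likelihood as a function of all the parameters. -/
def jointLogLik (A : Data n T) (x : Vec n k × Vec T n) : ℝ := logLik A x.1 x.2

lemma jointLogLik_eq (A : Data n T) : (jointLogLik A : Vec n k × Vec T n → ℝ) = fun x =>
    ∑ s, ((A s : ℝ) * linPred x.1 x.2 s - Real.exp (linPred x.1 x.2 s)) := by
  ext x
  rw [Fintype.sum_prod_type]
  rfl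

lemma contDiff_linPred (s : Fin T × NodePair n) :
    ContDiff ℝ ∞ fun x : Vec n k × Vec T n => linPred x.1 x.2 s := by
  unfold linPred
  fun_prop

lemma contDiff_jointLogLik (A : Data n T) :
    ContDiff ℝ ∞ (jointLogLik A : Vec n k × Vec T n → ℝ) := by
  rw [jointLogLik_eq]
  exact ContDiff.sum fun s _ => (contDiff_const.mul (contDiff_linPred s)).sub (contDiff_linPred s).exp

lemma fderiv_linPred (x h : Vec n k × Vec T n) (s : Fin T × NodePair n) :
    fderiv ℝ (fun x : Vec n k × Vec T n => linPred x.1 x.2 s) x h =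
      linZ x.1 h.1 s + linAlpha h.2 s := by
  have hd : HasFDerivAt (fun x : Vec n k × Vec T n => linPred x.1 x.2 s) _ x :=
    ((contDiff_linPred s).differentiable (by simp) x).hasFDerivAt
  have h1 : HasDerivAt (fun t : ℝ => x + t • h) h 0 := by
    simpa using ((hasDerivAt_id (0 : ℝ)).smul_const h).const_add x
  have h2 : HasDerivAt ((fun x : Vec n k × Vec T n => linPred x.1 x.2 s) ∘ fun t : ℝ => x + t • h)
      (fderiv ℝ (fun x : Vec n k × Vec T n => linPred x.1 x.2 s) x h) 0 := by
    refine HasFDerivAt.comp_hasDerivAt 0 ?_ h1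
    simpa using! hd
  refine h2.unique ?_
  have hc : ∀ c d : ℝ, HasDerivAt (fun t : ℝ => c + t * d) d 0 := fun c d => by
    simpa using ((hasDerivAt_id (0 : ℝ)).mul_const d).const_add c
  have h3 : HasDerivAt (fun t : ℝ => (x.2 (s.1, s.2.1.1) + t * h.2 (s.1, s.2.1.1)) +
      (x.2 (s.1, s.2.1.2) + t * h.2 (s.1, s.2.1.2)) +
      ∑ l, (x.1 (s.2.1.1, l) + t * h.1 (s.2.1.1, l)) * (x.1 (s.2.1.2, l) + t * h.1 (s.2.1.2, l)))
      _ 0 :=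
    ((hc _ _).add (hc _ _)).add (HasDerivAt.fun_sum fun l _ => (hc _ _).mul (hc _ _))
  have h4 := h3.congr_deriv (g' := linZ x.1 h.1 s + linAlpha h.2 s) (by
    simp [linZ, linAlpha]
    ring)
  exact h4

lemma fderiv_jointLogLik (A : Data n T) (x h : Vec n k × Vec T n) :
    fderiv ℝ (jointLogLik A) x h =
      ∑ s, residual A x.1 x.2 s * (linZ x.1 h.1 s + linAlpha h.2 s) := by
  have h1 : ∀ s, HasFDerivAt (fun x : Vec n k × Vec T n => linPred x.1 x.2 s) _ x := fun s =>
    ((contDiff_linPred s).differentiable (by simp) x).hasFDerivAt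
  have h2 := HasFDerivAt.fun_sum fun s (_ : s ∈ Finset.univ) =>
    ((h1 s).const_mul (A s : ℝ)).fun_sub (h1 s).exp
  rw [jointLogLik_eq, h2.fderiv, _root_.sum_apply]
  refine Finset.sum_congr rfl fun s _ => ?_
  rw [← fderiv_linPred, residual]
  simp only [_root_.sub_apply, _root_.smul_apply, smul_eq_mul]
  ring

/-- The mixed second derivatives with one direction in the nuisance parameters. -/
lemma fderiv_fderiv_jointLogLik (A : Data n T) (x h : Vec n k × Vec T n) (β : Vec T n) :
    fderiv ℝ (fderiv ℝ (jointLogLik A)) x h (0, β) =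
      -∑ s, Real.exp (linPred x.1 x.2 s) * (linZ x.1 h.1 s + linAlpha h.2 s) * linAlpha β s := by
  have hL := contDiff_jointLogLik (k := k) A
  have hd2 : ContDiff ℝ ∞ (fderiv ℝ (jointLogLik A : Vec n k × Vec T n → ℝ)) :=
    hL.fderiv_right (by simp)
  have h2 := (hd2.differentiable (by simp) x).hasFDerivAt.clm_apply
    (hasFDerivAt_const ((0, β) : Vec n k × Vec T n) x)
  have h1 : ∀ s, HasFDerivAt (fun x : Vec n k × Vec T n => linPred x.1 x.2 s) _ x := fun s =>
    ((contDiff_linPred s).differentiable (by simp) x).hasFDerivAt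
  -- The coefficient `linAlpha β s` does not depend on the point, so only the exponential is
  -- differentiated and the counts drop out.
  have e : (fun y : Vec n k × Vec T n => fderiv ℝ (jointLogLik A) y (0, β)) =
      fun y => ∑ s, ((A s : ℝ) - Real.exp (linPred y.1 y.2 s)) * linAlpha β s := by
    ext y
    rw [fderiv_jointLogLik]
    simp [linZ, residual]
  rw [e] at h2
  have h3 := HasFDerivAt.fun_sum fun s (_ : s ∈ Finset.univ) =>
    ((h1 s).exp.const_sub (A s : ℝ)).mul_const (linAlpha β s)
  have h4 := DFunLike.congr_fun (h2.unique h3) h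
  simp only [_root_.sum_apply, _root_.smul_apply, _root_.neg_apply, fderiv_linPred,
    _root_.add_apply, smul_eq_mul, ContinuousLinearMap.comp_apply, ContinuousLinearMap.flip_apply,
    _root_.zero_apply, map_zero, zero_add] at h4
  rw [h4, ← Finset.sum_neg_distrib]
  exact Finset.sum_congr rfl fun s _ => by ring

end LogLik

/-! ### Scores, information matrices and Hessian blocks -/

lemma clm_apply_eq_sum {ι : Type*} [Fintype ι] [DecidableEq ι] (φ : EuclideanSpace ℝ ι →L[ℝ] ℝ)
    (v : EuclideanSpace ℝ ι) : φ v = ∑ a, v a * φ (EuclideanSpace.single a 1) := by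
  conv_lhs => rw [← (EuclideanSpace.basisFun ι ℝ).sum_repr v]
  simp

section Scores
variable {n k T : ℕ}

/-- The Jacobian of the linear predictor with respect to `Z_v`. -/
def jacZ (T : ℕ) (z : Vec n k) : Matrix (Fin T × NodePair n) (Fin n × Fin k) ℝ :=
  Matrix.of fun s a => linZ z (EuclideanSpace.single a 1) s

/-- The Jacobian of the linear predictor with respect to `α_v`. -/
def jacAlpha (n T : ℕ) : Matrix (Fin T × NodePair n) (Fin T × Fin n) ℝ :=
  Matrix.of fun s b => linAlpha (EuclideanSpace.single b 1) s

lemma jacZ_mulVec (z v : Vec n k) (s : Fin T × NodePair n) :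
    (jacZ T z *ᵥ WithLp.ofLp v) s = linZ z v s := by
  have h := clm_apply_eq_sum
    (fderiv ℝ (fun x : Vec n k × Vec T n => linPred x.1 x.2 s) (z, 0) ∘L .inl ℝ _ _) v
  simp only [ContinuousLinearMap.comp_apply, ContinuousLinearMap.inl_apply, fderiv_linPred] at h
  simp only [linAlpha, PiLp.zero_apply, add_zero] at h
  rw [h, mulVec, dotProduct]
  exact Finset.sum_congr rfl fun a _ => mul_comm _ _

lemma jacAlpha_mulVec (β : Vec T n) (s : Fin T × NodePair n) :
    (jacAlpha n T *ᵥ WithLp.ofLp β) s = linAlpha β s := by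
  -- The dependence on `α` does not involve `Z`, so `k = 0` is chosen to make the inner products
  -- empty sums.
  have h := clm_apply_eq_sum
    (fderiv ℝ (fun x : Vec n 0 × Vec T n => linPred x.1 x.2 s) (0, 0) ∘L .inr ℝ _ _) β
  simp only [ContinuousLinearMap.comp_apply, ContinuousLinearMap.inr_apply, fderiv_linPred] at h
  simp only [linZ, Finset.univ_eq_empty, Finset.sum_empty, zero_add] at h
  rw [h, mulVec, dotProduct]
  exact Finset.sum_congr rfl fun a _ => mul_comm _ _

lemma scoreZ_eq_fderiv (A : Data n T) (z : Vec n k) (α : Vec T n) (a : Fin n × Fin k) :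
    scoreZ A z α a = fderiv ℝ (jointLogLik A) (z, α) (EuclideanSpace.single a 1, 0) := by
  have h := ((contDiff_jointLogLik A).differentiable (by simp) (z, α)).hasFDerivAt.comp
    (g := jointLogLik A) z (hasFDerivAt_prodMk_left (𝕜 := ℝ) z α)
  exact (h.hasLineDerivAt (EuclideanSpace.single a 1)).lineDeriv

lemma scoreAlpha_eq_fderiv (A : Data n T) (z : Vec n k) (α : Vec T n) (b : Fin T × Fin n) :
    scoreAlpha A z α b = fderiv ℝ (jointLogLik A) (z, α) (0, EuclideanSpace.single b 1) := by
  have h := ((contDiff_jointLogLik A).differentiable (by simp) (z, α)).hasFDerivAt.comp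
    (g := jointLogLik A) α (hasFDerivAt_prodMk_right z α)
  exact (h.hasLineDerivAt (EuclideanSpace.single b 1)).lineDeriv

lemma scoreZ_eq (A : Data n T) (z : Vec n k) (α : Vec T n) :
    scoreZ A z α = (jacZ T z)ᵀ *ᵥ residual A z α := by
  ext a
  rw [scoreZ_eq_fderiv, fderiv_jointLogLik, mulVec, dotProduct]
  refine Finset.sum_congr rfl fun s _ => ?_
  simp [linAlpha, jacZ, mul_comm]

lemma scoreAlpha_eq (A : Data n T) (z : Vec n k) (α : Vec T n) :
    scoreAlpha A z α = (jacAlpha n T)ᵀ *ᵥ residual A z α := by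
  ext a
  rw [scoreAlpha_eq_fderiv, fderiv_jointLogLik, mulVec, dotProduct]
  refine Finset.sum_congr rfl fun s _ => ?_
  simp [linZ, jacAlpha, mul_comm]

/-- The covariance matrix of the counts. -/
def countCov (z : Vec n k) (α : Vec T n) : Matrix (Fin T × NodePair n) (Fin T × NodePair n) ℝ :=
  Matrix.diagonal fun s => Real.exp (linPred z α s)

lemma infoZAlpha_eq (z : Vec n k) (α : Vec T n) :
    infoZAlpha z α = (jacZ T z)ᵀ * countCov z α * jacAlpha n T := by
  ext a b
  simp only [infoZAlpha, Matrix.of_apply, scoreZ_eq, scoreAlpha_eq]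
  rw [integral_mulVec_residual, transpose_transpose]
  rfl

lemma infoAlpha_eq (z : Vec n k) (α : Vec T n) :
    infoAlpha z α = (jacAlpha n T)ᵀ * countCov z α * jacAlpha n T := by
  ext a b
  simp only [infoAlpha, Matrix.of_apply, scoreAlpha_eq]
  rw [integral_mulVec_residual, transpose_transpose]
  rfl

lemma transpose_countCov (z : Vec n k) (α : Vec T n) : (countCov z α)ᵀ = countCov z α :=
  diagonal_transpose _

lemma eq_zero_of_countCov {z : Vec n k} {α : Vec T n} {y : Fin T × NodePair n → ℝ}
    (h : y ⬝ᵥ countCov z α *ᵥ y = 0) : y = 0 := by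
  have e : y ⬝ᵥ countCov z α *ᵥ y = ∑ s, Real.exp (linPred z α s) * y s ^ 2 := by
    rw [countCov, dotProduct]
    refine Finset.sum_congr rfl fun s _ => ?_
    rw [mulVec_diagonal]
    ring
  rw [e, Finset.sum_eq_zero_iff_of_nonneg fun s _ => by positivity] at h
  ext s
  have := h s (Finset.mem_univ s)
  simpa [(Real.exp_pos _).ne'] using this

/-- The pairs `(i, i)` belong to the model and give `2β_{it}`. -/
lemma eq_zero_of_linAlpha {β : Vec T n} (h : ∀ s, linAlpha β s = 0) : β = 0 := by
  ext ⟨t, i⟩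
  have := h (t, ⟨(i, i), le_rfl⟩)
  simp only [linAlpha] at this
  simpa using this

/-- Its quadratic form is a positively weighted sum of squares of the entries of `jacAlpha β`, and
`jacAlpha` is injective. -/
lemma isUnit_infoAlpha (z : Vec n k) (α : Vec T n) : IsUnit (infoAlpha z α) := by
  rw [← Matrix.mulVec_injective_iff_isUnit, ← Matrix.coe_mulVecLin, injective_iff_map_eq_zero]
  intro β hβ
  rw [Matrix.mulVecLin_apply] at hβ
  have h : (jacAlpha n T *ᵥ β) ⬝ᵥ countCov z α *ᵥ (jacAlpha n T *ᵥ β) = 0 := by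
    have := congrArg (fun x => β ⬝ᵥ x) hβ
    simp only [dotProduct_zero, infoAlpha_eq] at this
    rw [← this, ← mulVec_mulVec, ← mulVec_mulVec, dotProduct_mulVec β, vecMul_transpose]
  have h0 : WithLp.toLp 2 β = (0 : Vec T n) := by
    refine eq_zero_of_linAlpha fun s => ?_
    rw [← jacAlpha_mulVec]
    exact congrFun (eq_zero_of_countCov h) s
  simpa using! congrArg WithLp.ofLp h0

lemma hasFDerivAt_fderiv_apply (A : Data n T) (x w : Vec n k × Vec T n) :
    HasFDerivAt (fun y => fderiv ℝ (jointLogLik A) y w)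
      ((fderiv ℝ (fderiv ℝ (jointLogLik A)) x).flip w) x := by
  have hd2 : ContDiff ℝ ∞ (fderiv ℝ (jointLogLik A : Vec n k × Vec T n → ℝ)) :=
    (contDiff_jointLogLik A).fderiv_right (by simp)
  have h2 := (hd2.differentiable (by simp) x).hasFDerivAt.clm_apply (hasFDerivAt_const w x)
  refine h2.congr_fderiv ?_
  ext <;> simp

lemma hessZZ_eq (A : Data n T) (z : Vec n k) (α : Vec T n) (a b : Fin n × Fin k) :
    hessZZ A z α a b = fderiv ℝ (fderiv ℝ (jointLogLik A)) (z, α)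
      (EuclideanSpace.single b 1, 0) (EuclideanSpace.single a 1, 0) := by
  have h := (hasFDerivAt_fderiv_apply A (z, α) (EuclideanSpace.single a 1, 0)).comp
    (g := fun y => fderiv ℝ (jointLogLik A) y (EuclideanSpace.single a 1, 0)) z
    (hasFDerivAt_prodMk_left (𝕜 := ℝ) z α)
  simp only [hessZZ, Matrix.of_apply, scoreZ_eq_fderiv]
  exact (h.hasLineDerivAt (EuclideanSpace.single b 1)).lineDeriv

lemma hessZAlpha_eq (A : Data n T) (z : Vec n k) (α : Vec T n) (a : Fin n × Fin k)
    (b : Fin T × Fin n) :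
    hessZAlpha A z α a b = fderiv ℝ (fderiv ℝ (jointLogLik A)) (z, α)
      (0, EuclideanSpace.single b 1) (EuclideanSpace.single a 1, 0) := by
  have h := (hasFDerivAt_fderiv_apply A (z, α) (EuclideanSpace.single a 1, 0)).comp
    (g := fun y => fderiv ℝ (jointLogLik A) y (EuclideanSpace.single a 1, 0)) α
    (hasFDerivAt_prodMk_right z α)
  simp only [hessZAlpha, Matrix.of_apply, scoreZ_eq_fderiv]
  exact (h.hasLineDerivAt (EuclideanSpace.single b 1)).lineDeriv

lemma hessAlphaZ_eq (A : Data n T) (z : Vec n k) (α : Vec T n) (a : Fin T × Fin n)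
    (b : Fin n × Fin k) :
    hessAlphaZ A z α a b = fderiv ℝ (fderiv ℝ (jointLogLik A)) (z, α)
      (EuclideanSpace.single b 1, 0) (0, EuclideanSpace.single a 1) := by
  have h := (hasFDerivAt_fderiv_apply A (z, α) (0, EuclideanSpace.single a 1)).comp
    (g := fun y => fderiv ℝ (jointLogLik A) y (0, EuclideanSpace.single a 1)) z
    (hasFDerivAt_prodMk_left (𝕜 := ℝ) z α)
  simp only [hessAlphaZ, Matrix.of_apply, scoreAlpha_eq_fderiv]
  exact (h.hasLineDerivAt (EuclideanSpace.single b 1)).lineDeriv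

lemma hessAlphaAlpha_eq (A : Data n T) (z : Vec n k) (α : Vec T n) (a b : Fin T × Fin n) :
    hessAlphaAlpha A z α a b = fderiv ℝ (fderiv ℝ (jointLogLik A)) (z, α)
      (0, EuclideanSpace.single b 1) (0, EuclideanSpace.single a 1) := by
  have h := (hasFDerivAt_fderiv_apply A (z, α) (0, EuclideanSpace.single a 1)).comp
    (g := fun y => fderiv ℝ (jointLogLik A) y (0, EuclideanSpace.single a 1)) α
    (hasFDerivAt_prodMk_right z α)
  simp only [hessAlphaAlpha, Matrix.of_apply, scoreAlpha_eq_fderiv]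
  exact (h.hasLineDerivAt (EuclideanSpace.single b 1)).lineDeriv

/-- The predictor is affine in `α`, so observed and expected information agree in this block. -/
lemma hessAlphaAlpha_eq_neg (A : Data n T) (z : Vec n k) (α : Vec T n) :
    hessAlphaAlpha A z α = -infoAlpha z α := by
  ext a b
  rw [hessAlphaAlpha_eq, fderiv_fderiv_jointLogLik, infoAlpha_eq, Matrix.mul_assoc, neg_apply,
    Matrix.mul_apply]
  congr 1
  refine Finset.sum_congr rfl fun s _ => ?_
  rw [countCov, diagonal_mul]
  simp [linZ, jacAlpha]
  ring

/-- The second derivative of the log-likelihood in terms of the Hessian blocks. -/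
lemma fderiv_fderiv_left (A : Data n T) (z : Vec n k) (α : Vec T n) (u v : Vec n k) (γ : Vec T n) :
    fderiv ℝ (fderiv ℝ (jointLogLik A)) (z, α) (u, γ) (v, 0) =
      v.ofLp ⬝ᵥ (hessZZ A z α *ᵥ u.ofLp + hessZAlpha A z α *ᵥ γ.ofLp) := by
  set B := fderiv ℝ (fderiv ℝ (jointLogLik A)) (z, α) with hB
  have h1 := clm_apply_eq_sum (B (u, γ) ∘L .inl ℝ _ _) v
  refine h1.trans ?_
  rw [dotProduct]
  refine Finset.sum_congr rfl fun a _ => congrArg _ ?_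
  have h2 := clm_apply_eq_sum (B.flip (EuclideanSpace.single a 1, 0) ∘L .inl ℝ _ _) u
  have h3 := clm_apply_eq_sum (B.flip (EuclideanSpace.single a 1, 0) ∘L .inr ℝ _ _) γ
  have h4 : B (u, γ) (EuclideanSpace.single a 1, 0) =
      B.flip (EuclideanSpace.single a 1, 0) (u, 0) +
        B.flip (EuclideanSpace.single a 1, 0) (0, γ) := by
    rw [← map_add, Prod.mk_add_mk, add_zero, zero_add]
    rfl
  refine h4.trans ?_
  rw [Pi.add_apply, mulVec, mulVec, dotProduct, dotProduct]
  refine congrArg₂ (· + ·) (h2.trans ?_) (h3.trans ?_)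
  · exact Finset.sum_congr rfl fun b _ => by rw [hessZZ_eq, mul_comm]; rfl
  · exact Finset.sum_congr rfl fun b _ => by rw [hessZAlpha_eq, mul_comm]; rfl

lemma fderiv_fderiv_right (A : Data n T) (z : Vec n k) (α : Vec T n) (u : Vec n k) (γ β : Vec T n) :
    fderiv ℝ (fderiv ℝ (jointLogLik A)) (z, α) (u, γ) (0, β) =
      β.ofLp ⬝ᵥ (hessAlphaZ A z α *ᵥ u.ofLp + hessAlphaAlpha A z α *ᵥ γ.ofLp) := by
  set B := fderiv ℝ (fderiv ℝ (jointLogLik A)) (z, α) with hB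
  have h1 := clm_apply_eq_sum (B (u, γ) ∘L .inr ℝ _ _) β
  refine h1.trans ?_
  rw [dotProduct]
  refine Finset.sum_congr rfl fun a _ => congrArg _ ?_
  have h2 := clm_apply_eq_sum (B.flip (0, EuclideanSpace.single a 1) ∘L .inl ℝ _ _) u
  have h3 := clm_apply_eq_sum (B.flip (0, EuclideanSpace.single a 1) ∘L .inr ℝ _ _) γ
  have h4 : B (u, γ) (0, EuclideanSpace.single a 1) =
      B.flip (0, EuclideanSpace.single a 1) (u, 0) +
        B.flip (0, EuclideanSpace.single a 1) (0, γ) := by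
    rw [← map_add, Prod.mk_add_mk, add_zero, zero_add]
    rfl
  refine h4.trans ?_
  rw [Pi.add_apply, mulVec, mulVec, dotProduct, dotProduct]
  refine congrArg₂ (· + ·) (h2.trans ?_) (h3.trans ?_)
  · exact Finset.sum_congr rfl fun b _ => by rw [hessAlphaZ_eq, mul_comm]; rfl
  · exact Finset.sum_congr rfl fun b _ => by rw [hessAlphaAlpha_eq, mul_comm]; rfl

/-- The efficient score as a function of the centered counts. -/
def effScoreMatrix (z : Vec n k) (α : Vec T n) : Matrix (Fin n × Fin k) (Fin T × NodePair n) ℝ :=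
  (jacZ T z)ᵀ - infoZAlpha z α * (infoAlpha z α)⁻¹ * (jacAlpha n T)ᵀ

lemma Seff_eq (A : Data n T) (z : Vec n k) (α : Vec T n) :
    Seff A z α = effScoreMatrix z α *ᵥ residual A z α := by
  rw [Seff, scoreZ_eq, scoreAlpha_eq, effScoreMatrix, sub_mulVec, mulVec_mulVec]

lemma Ieff_eq (z : Vec n k) (α : Vec T n) :
    Ieff z α = effScoreMatrix z α * countCov z α * (effScoreMatrix z α)ᵀ := by
  ext a b
  simp only [Ieff, Matrix.of_apply, Seff_eq]
  rw [integral_mulVec_residual]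
  rfl

end Scores

/-! ### The column space of the efficient information -/

section ColumnSpace
variable {n k T : ℕ}

lemma transpose_infoAlpha (z : Vec n k) (α : Vec T n) : (infoAlpha z α)ᵀ = infoAlpha z α := by
  rw [infoAlpha_eq, transpose_mul, transpose_mul, transpose_transpose, transpose_countCov,
    Matrix.mul_assoc]

/-- The linear functions of `Z_v` that are confounded with the nuisance parameters. -/
lemma transpose_effScoreMatrix_mulVec_eq_zero_iff (z : Vec n k) (α : Vec T n)
    (w : Fin n × Fin k → ℝ) :
    (effScoreMatrix z α)ᵀ *ᵥ w = 0 ↔ ∃ β, jacZ T z *ᵥ w = jacAlpha n T *ᵥ β := by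
  -- The residual of the weighted least squares projection of `jacZ w` to the range of `jacAlpha`;
  -- it vanishes exactly on that range.
  have hN : (effScoreMatrix z α)ᵀ *ᵥ w = jacZ T z *ᵥ w -
      jacAlpha n T *ᵥ ((infoAlpha z α)⁻¹ *ᵥ ((infoZAlpha z α)ᵀ *ᵥ w)) := by
    rw [effScoreMatrix, transpose_sub, transpose_mul, transpose_mul, transpose_transpose,
      transpose_transpose, transpose_nonsing_inv, transpose_infoAlpha, sub_mulVec, mulVec_mulVec,
      mulVec_mulVec, Matrix.mul_assoc]
  rw [hN, sub_eq_zero]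
  constructor
  · exact fun h => ⟨_, h⟩
  · rintro ⟨β, h⟩
    have hu := (Matrix.isUnit_iff_isUnit_det _).1 (isUnit_infoAlpha z α)
    rw [infoZAlpha_eq, transpose_mul, transpose_mul, transpose_transpose, transpose_countCov,
      ← mulVec_mulVec, ← mulVec_mulVec, h, mulVec_mulVec β, mulVec_mulVec β, ← Matrix.mul_assoc,
      ← infoAlpha_eq, mulVec_mulVec β, Matrix.nonsing_inv_mul _ hu, one_mulVec]

/-- With `K = WᵀZ(ZᵀZ)⁻¹` the equations give `ZᵀW = -ZᵀZ K`, which makes `K` skew, and `VᵀW = -VᵀZ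
K`, a symmetric matrix times a skew one. -/
lemma trace_transpose_mul_eq_zero {m p : Type*} [Fintype m] [Fintype p] [DecidableEq p]
    {Z V W : Matrix m p ℝ} (hG : (Zᵀ * Z).det ≠ 0)
    (hZ : Zᵀ * (W * (Zᵀ * Z) + Z * (Wᵀ * Z)) = 0) (hV : Vᵀ * (W * (Zᵀ * Z) + Z * (Wᵀ * Z)) = 0)
    (hB : (Vᵀ * Z)ᵀ = Vᵀ * Z) : (Vᵀ * W).trace = 0 := by
  set G := Zᵀ * Z with hGdef
  have hGt : Gᵀ = G := by rw [hGdef, transpose_mul, transpose_transpose]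
  have hu : IsUnit G.det := hG.isUnit
  set K := Wᵀ * Z * G⁻¹ with hK
  have key : ∀ Y : Matrix m p ℝ, Yᵀ * (W * G + Z * (Wᵀ * Z)) = 0 → Yᵀ * W = -(Yᵀ * Z * K) := by
    intro Y h
    have h1 : Yᵀ * (W * G) * G⁻¹ = Yᵀ * W := by
      rw [← Matrix.mul_assoc Yᵀ W G, Matrix.mul_nonsing_inv_cancel_right _ _ hu]
    have h2 := congrArg (· * G⁻¹) h
    simp only [Matrix.mul_add, Matrix.add_mul, h1, Matrix.zero_mul] at h2
    rw [eq_neg_of_add_eq_zero_left h2, hK]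
    simp only [Matrix.mul_assoc]
  have h1 : Zᵀ * W = -(G * K) := key Z hZ
  have h2 : Vᵀ * W = -(Vᵀ * Z * K) := key V hV
  have hKt : Kᵀ = -K := by
    rw [hK, transpose_mul, transpose_nonsing_inv, hGt, transpose_mul, transpose_transpose, h1,
      Matrix.mul_neg, ← Matrix.mul_assoc, Matrix.nonsing_inv_mul _ hu, Matrix.one_mul, hK]
  have h3 : (Vᵀ * Z * K).trace = -(Vᵀ * Z * K).trace := by
    conv_lhs => rw [← trace_transpose, transpose_mul, hB, hKt, Matrix.neg_mul, trace_neg, trace_mul_comm]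
  rw [h2, trace_neg]
  linarith

lemma dotProduct_eq_trace (v w : Vec n k) : v.ofLp ⬝ᵥ w.ofLp = ((mat v)ᵀ * mat w).trace := by
  rw [dotProduct, Fintype.sum_prod_type_right]
  rfl

/-- Confounding means `wzᵀ + zwᵀ = b1ᵀ + 1bᵀ`. Multiplying by the centered `z` on the right removes
`b1ᵀ`, and by a centered `Yᵀ` on the left removes the rest; `trace_transpose_mul_eq_zero` then
applies. -/
lemma dotProduct_eq_zero_of_confounded (hT : 0 < T) (Z : R0 n k) {V : Centered n k}
    (hV : V ∈ slice (Z : Centered n k)) {w : Vec n k} {β : Vec T n}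
    (h : ∀ s : Fin T × NodePair n, linZ ((Z : Centered n k) : Vec n k) w s = linAlpha β s) :
    (V : Vec n k).ofLp ⬝ᵥ w.ofLp = 0 := by
  set z : Vec n k := ((Z : Centered n k) : Vec n k) with hz
  let t : Fin T := ⟨0, hT⟩
  have hM : ∀ i j, (mat w * (mat z)ᵀ + mat z * (mat w)ᵀ) i j = β (t, i) + β (t, j) := by
    have h1 : ∀ i j, i ≤ j →
        (mat w * (mat z)ᵀ + mat z * (mat w)ᵀ) i j = β (t, i) + β (t, j) := fun i j hij => by
      refine Eq.trans ?_ (h (t, ⟨(i, j), hij⟩))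
      rw [Matrix.add_apply, Matrix.mul_apply, Matrix.mul_apply, ← Finset.sum_add_distrib]
      rfl
    intro i j
    rcases le_total i j with hij | hij
    · exact h1 i j hij
    · rw [add_comm (β _), ← h1 j i hij, Matrix.add_apply, Matrix.add_apply, Matrix.mul_apply,
        Matrix.mul_apply, Matrix.mul_apply, Matrix.mul_apply, add_comm]
      simp only [Matrix.transpose_apply, mul_comm]
  have hE : ∀ Y : Centered n k, (mat (Y : Vec n k))ᵀ *
      (mat w * ((mat z)ᵀ * mat z) + mat z * ((mat w)ᵀ * mat z)) = 0 := by
    intro Y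
    have hY : ∀ l, ∑ i, mat (Y : Vec n k) i l = 0 := Y.2
    have hZ0 : ∀ l, ∑ i, mat z i l = 0 := (Z : Centered n k).2
    have e : mat w * ((mat z)ᵀ * mat z) + mat z * ((mat w)ᵀ * mat z) =
        (mat w * (mat z)ᵀ + mat z * (mat w)ᵀ) * mat z := by
      rw [Matrix.add_mul, Matrix.mul_assoc, Matrix.mul_assoc]
    ext a b
    rw [e, Matrix.mul_apply]
    have e2 : ∀ i, ((mat w * (mat z)ᵀ + mat z * (mat w)ᵀ) * mat z) i b =
        ∑ j, β (t, j) * mat z j b := fun i => by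
      rw [Matrix.mul_apply]
      simp only [hM, add_mul, Finset.sum_add_distrib]
      rw [← Finset.mul_sum, hZ0, mul_zero, zero_add]
    simp only [e2, Matrix.transpose_apply]
    rw [← Finset.sum_mul, hY, zero_mul, Matrix.zero_apply]
  rw [dotProduct_eq_trace]
  refine trace_transpose_mul_eq_zero (Z := mat z) (mem_R0.1 Z.2) (hE _) (hE V) ?_
  have h1 := transpose_crossGram (Z : Centered n k) V
  have h2 := transpose_crossGram V (Z : Centered n k)
  rw [mem_slice_iff] at hV
  rw [hV] at h1
  exact h2.trans h1

/-- A common shift of the `l`-th coordinates changes `⟨z_i, z_j⟩` to first order by `z_{il} +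
z_{jl}`, which `α` absorbs. Orthogonality to these directions is centering. -/
lemma confounded_column (z : Vec n k) (l : Fin k) (s : Fin T × NodePair n) :
    linZ z (WithLp.toLp 2 fun p => if p.2 = l then 1 else 0) s =
      linAlpha (WithLp.toLp 2 fun p => z (p.2, l)) s := by
  simp [linZ, linAlpha, Finset.sum_add_distrib]
  ring

lemma confounded_vertical (Z : Centered n k) {Ω : Matrix (Fin k) (Fin k) ℝ} (hΩ : Ω ∈ skew k)
    (s : Fin T × NodePair n) : linZ (Z : Vec n k) (rmul Z Ω : Vec n k) s = linAlpha 0 s := by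
  have hΩ : Ωᵀ = -Ω := hΩ
  have h1 : mat (rmul Z Ω : Vec n k) * (mat (Z : Vec n k))ᵀ +
      mat (Z : Vec n k) * (mat (rmul Z Ω : Vec n k))ᵀ = 0 := by
    rw [mat_rmul, transpose_mul, hΩ]
    simp [Matrix.mul_assoc]
  have h2 := congrFun (congrFun h1 s.2.1.1) s.2.1.2
  rw [Matrix.add_apply, Matrix.mul_apply, Matrix.mul_apply, ← Finset.sum_add_distrib] at h2
  refine Eq.trans h2 ?_
  simp [linAlpha]

/-- The column space of the efficient information is the horizontal space. -/
theorem mem_span_Ieff_iff (hT : 0 < T) (Z : R0 n k) (α : Vec T n) (v : Fin n × Fin k → ℝ) :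
    v ∈ Submodule.span ℝ (range (Ieff ((Z : Centered n k) : Vec n k) α).col) ↔
      ∃ V ∈ slice (Z : Centered n k), (V : Vec n k).ofLp = v := by
  set z : Vec n k := ((Z : Centered n k) : Vec n k) with hz
  have hconf : ∀ {w : Vec n k} {β : Vec T n}, (∀ s, linZ z w s = linAlpha β s) →
      (effScoreMatrix z α)ᵀ *ᵥ w.ofLp = 0 := fun {w β} h =>
    (transpose_effScoreMatrix_mulVec_eq_zero_iff z α _).2
      ⟨β.ofLp, funext fun s => by rw [jacZ_mulVec, jacAlpha_mulVec, h]⟩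
  constructor
  · intro hv
    rw [← Matrix.range_mulVecLin] at hv
    obtain ⟨y, rfl⟩ := hv
    rw [Matrix.mulVecLin_apply, Ieff_eq, Matrix.mul_assoc, ← mulVec_mulVec]
    set x := (countCov z α * (effScoreMatrix z α)ᵀ) *ᵥ y
    have horth : ∀ w : Fin n × Fin k → ℝ, (effScoreMatrix z α)ᵀ *ᵥ w = 0 →
        w ⬝ᵥ effScoreMatrix z α *ᵥ x = 0 := fun w hw => by
      rw [dotProduct_mulVec, ← mulVec_transpose, hw, zero_dotProduct]
    have hcent : WithLp.toLp 2 (effScoreMatrix z α *ᵥ x) ∈ Centered n k := by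
      intro l
      have h1 := horth _ (hconf (confounded_column z l))
      rw [dotProduct, Fintype.sum_prod_type] at h1
      change ∑ i, (effScoreMatrix z α *ᵥ x) (i, l) = 0
      simpa using h1
    refine ⟨⟨_, hcent⟩, ?_, rfl⟩
    rw [slice_eq, Submodule.mem_orthogonal]
    rintro _ ⟨Ω, hΩ, rfl⟩
    have h1 := horth _ (hconf (confounded_vertical (Z : Centered n k) hΩ))
    rw [dotProduct_comm] at h1
    exact h1
  · rintro ⟨V, hV, rfl⟩
    -- A functional `⟨·, w⟩` separating `V` from the column space satisfies `wᵀ I_eff w = 0`. So `w`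
    -- is confounded, and then `V` is orthogonal to it.
    by_contra hn
    obtain ⟨φ, hφ, hle⟩ := Submodule.exists_le_ker_of_notMem hn
    let w : Fin n × Fin k → ℝ := fun a => φ (Pi.single a 1)
    have hφw : ∀ y, φ y = y ⬝ᵥ w := fun y => by
      rw [LinearMap.pi_apply_eq_sum_univ φ y, dotProduct]
      refine Finset.sum_congr rfl fun a _ => ?_
      simp only [w, smul_eq_mul]
      congr 2
      ext b
      simp [Pi.single_apply, eq_comm]
    have h1 : ((effScoreMatrix z α)ᵀ *ᵥ w) ⬝ᵥ countCov z α *ᵥ ((effScoreMatrix z α)ᵀ *ᵥ w) = 0 := by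
      have h2 : Ieff z α *ᵥ w ∈ LinearMap.ker φ := hle (by
        rw [← Matrix.range_mulVecLin]
        exact ⟨w, rfl⟩)
      rw [LinearMap.mem_ker, hφw, Ieff_eq, ← mulVec_mulVec, ← mulVec_mulVec, dotProduct_comm,
        dotProduct_mulVec, ← mulVec_transpose] at h2
      exact h2
    obtain ⟨β, hβ⟩ := (transpose_effScoreMatrix_mulVec_eq_zero_iff z α w).1 (eq_zero_of_countCov h1)
    refine hφ ?_
    rw [hφw]
    refine dotProduct_eq_zero_of_confounded hT Z hV (w := WithLp.toLp 2 w) (β := WithLp.toLp 2 β)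
      fun s => ?_
    rw [← jacZ_mulVec, ← jacAlpha_mulVec]
    exact congrFun hβ s

end ColumnSpace

/-! ### The profile log-likelihood -/

section ProfileLogLik
variable {n k T : ℕ}

lemma linPred_eq_add (z : Vec n k) (α α' : Vec T n) (s : Fin T × NodePair n) :
    linPred z α' s = linPred z α s + linAlpha (α' - α) s := by
  simp only [linPred, linAlpha, PiLp.sub_apply]
  ring

/-- The log-likelihood around a critical point of the nuisance parameters. -/
lemma jointLogLik_eq_sub {A : Data n T} {z : Vec n k} {α : Vec T n}
    (h : ∀ β, fderiv ℝ (jointLogLik A) (z, α) (0, β) = 0) (α' : Vec T n) :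
    jointLogLik A (z, α') = jointLogLik A (z, α) - ∑ s, Real.exp (linPred z α s) *
      (Real.exp (linAlpha (α' - α) s) - (linAlpha (α' - α) s + 1)) := by
  have h1 := h (α' - α)
  rw [fderiv_jointLogLik] at h1
  have h2 : ∑ s, residual A z α s * linAlpha (α' - α) s = 0 := by
    simpa [linZ] using h1
  rw [jointLogLik_eq]
  simp only
  rw [← add_zero (∑ s, _ - ∑ s, _), ← h2, ← sub_eq_zero]
  simp only [← Finset.sum_sub_distrib, ← Finset.sum_add_distrib]
  refine Finset.sum_eq_zero fun s _ => ?_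
  rw [linPred_eq_add z α α', Real.exp_add, residual]
  ring

/-- Concavity in the form `exp x ≥ 1 + x`; strictness for `x ≠ 0` gives uniqueness in
`eq_of_isMaxOn`. -/
lemma isMaxOn_of_critical {A : Data n T} {z : Vec n k} {α : Vec T n}
    (h : ∀ β, fderiv ℝ (jointLogLik A) (z, α) (0, β) = 0) :
    IsMaxOn (fun α' => logLik A z α') univ α := by
  intro α' _
  have h1 := jointLogLik_eq_sub h α'
  have h2 : 0 ≤ ∑ s, Real.exp (linPred z α s) *
      (Real.exp (linAlpha (α' - α) s) - (linAlpha (α' - α) s + 1)) :=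
    Finset.sum_nonneg fun s _ =>
      mul_nonneg (Real.exp_pos _).le (sub_nonneg.2 (Real.add_one_le_exp _))
  change jointLogLik A (z, α') ≤ jointLogLik A (z, α)
  linarith

lemma eq_of_isMaxOn {A : Data n T} {z : Vec n k} {α α' : Vec T n}
    (h : ∀ β, fderiv ℝ (jointLogLik A) (z, α) (0, β) = 0)
    (h' : IsMaxOn (fun α' => logLik A z α') univ α') : α' = α := by
  have h1 := jointLogLik_eq_sub h α'
  have h2 : jointLogLik A (z, α) ≤ jointLogLik A (z, α') := h' (mem_univ α)
  have hn : ∀ s ∈ Finset.univ, 0 ≤ Real.exp (linPred z α s) *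
      (Real.exp (linAlpha (α' - α) s) - (linAlpha (α' - α) s + 1)) := fun s _ =>
    mul_nonneg (Real.exp_pos _).le (sub_nonneg.2 (Real.add_one_le_exp _))
  have h3 := (Finset.sum_eq_zero_iff_of_nonneg hn).1
    (le_antisymm (by linarith) (Finset.sum_nonneg hn))
  refine sub_eq_zero.1 (eq_zero_of_linAlpha fun s => ?_)
  by_contra hs
  have h4 := h3 s (Finset.mem_univ s)
  have h5 := mul_pos (Real.exp_pos (linPred z α s)) (sub_pos.2 (Real.add_one_lt_exp hs))
  linarith

lemma critical_of_isMaxOn {A : Data n T} {z : Vec n k} {α : Vec T n}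
    (h : IsMaxOn (fun α' => logLik A z α') univ α) (β : Vec T n) :
    fderiv ℝ (jointLogLik A) (z, α) (0, β) = 0 := by
  have h1 := ((contDiff_jointLogLik A).differentiable (by simp) (z, α)).hasFDerivAt.comp
    (g := jointLogLik A) α (hasFDerivAt_prodMk_right z α)
  have h2 : IsLocalMax (jointLogLik A ∘ fun α' => (z, α')) α := h.isLocalMax Filter.univ_mem
  exact DFunLike.congr_fun (h2.hasFDerivAt_eq_zero h1) β

lemma alphaHat_eq {A : Data n T} {z : Vec n k} {α : Vec T n}
    (h : ∀ β, fderiv ℝ (jointLogLik A) (z, α) (0, β) = 0) : alphaHat A z = α :=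
  eq_of_isMaxOn h (Classical.epsilon_spec ⟨α, isMaxOn_of_critical h⟩)

variable {A : Data n T} {z : Vec n k}

lemma alphaHat_critical (h : ∃ α : Vec T n, IsMaxOn (fun α' => logLik A z α') univ α)
    (β : Vec T n) : fderiv ℝ (jointLogLik A) (z, alphaHat A z) (0, β) = 0 :=
  critical_of_isMaxOn (Classical.epsilon_spec h) β

lemma profile_calculus_logLik (h : ∃ α : Vec T n, IsMaxOn (fun α' => logLik A z α') univ α) :
    ContDiffAt ℝ ∞ (profileLogLik A) z ∧
    (∀ v, fderiv ℝ (profileLogLik A) z v =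
      fderiv ℝ (jointLogLik A) (z, alphaHat A z) (v, 0)) ∧
    ∀ u, ∃ γ, (∀ β, fderiv ℝ (fderiv ℝ (jointLogLik A)) (z, alphaHat A z) (u, γ) (0, β) = 0) ∧
      ∀ v, fderiv ℝ (fderiv ℝ (profileLogLik A)) z u v =
        fderiv ℝ (fderiv ℝ (jointLogLik A)) (z, alphaHat A z) (u, γ) (v, 0) := by
  refine profile_calculus (contDiff_jointLogLik A) (fun z α hα => (alphaHat_eq hα).symm)
    (alphaHat_critical h) fun β hβ => ?_
  have h1 := hβ β
  rw [fderiv_fderiv_jointLogLik, neg_eq_zero, Finset.sum_eq_zero_iff_of_nonneg] at h1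
  · refine eq_zero_of_linAlpha fun s => ?_
    have h2 := h1 s (Finset.mem_univ s)
    simpa [linZ, (Real.exp_pos _).ne'] using h2
  · intro s _
    simp only [linZ, PiLp.zero_apply, zero_mul, mul_zero, add_zero, Finset.sum_const_zero, zero_add]
    rw [mul_assoc]
    exact mul_nonneg (Real.exp_pos _).le (mul_self_nonneg _)

/-- The nuisance score vanishes at `α̂`, so the efficient score there is the plain score of the
envelope theorem. -/
lemma fderiv_profileLogLik (h : ∃ α : Vec T n, IsMaxOn (fun α' => logLik A z α') univ α)
    (v : Vec n k) :
    fderiv ℝ (profileLogLik A) z v = v.ofLp ⬝ᵥ Seff A z (alphaHat A z) := by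
  have h0 : scoreAlpha A z (alphaHat A z) = 0 := by
    ext b
    rw [scoreAlpha_eq_fderiv, alphaHat_critical h]
    rfl
  rw [(profile_calculus_logLik h).2.1, Seff, h0, mulVec_zero, sub_zero]
  refine (clm_apply_eq_sum
    (fderiv ℝ (jointLogLik A) (z, alphaHat A z) ∘L .inl ℝ _ _) v).trans ?_
  exact Finset.sum_congr rfl fun a _ => by rw [scoreZ_eq_fderiv]; rfl

/-- Solving the linearized equation `L̈_{α,Z} u + L̈_{α,α} γ = 0` for `γ`, the derivative of `α̂`,
produces the Schur complement. -/
lemma fderiv_fderiv_profileLogLik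
    (h : ∃ α : Vec T n, IsMaxOn (fun α' => logLik A z α') univ α) (u v : Vec n k) :
    fderiv ℝ (fderiv ℝ (profileLogLik A)) z u v =
      v.ofLp ⬝ᵥ Heff A z (alphaHat A z) *ᵥ u.ofLp := by
  obtain ⟨γ, h1, h2⟩ := (profile_calculus_logLik h).2.2 u
  set α := alphaHat A z
  have hu : IsUnit (hessAlphaAlpha A z α).det := by
    rw [← Matrix.isUnit_iff_isUnit_det, hessAlphaAlpha_eq_neg]
    exact (isUnit_infoAlpha z α).neg
  have h3 : hessAlphaZ A z α *ᵥ u.ofLp + hessAlphaAlpha A z α *ᵥ γ.ofLp = 0 := by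
    have := h1 (WithLp.toLp 2 (hessAlphaZ A z α *ᵥ u.ofLp + hessAlphaAlpha A z α *ᵥ γ.ofLp))
    rw [fderiv_fderiv_right] at this
    exact dotProduct_self_eq_zero.1 this
  have h4 : γ.ofLp = -((hessAlphaAlpha A z α)⁻¹ *ᵥ hessAlphaZ A z α *ᵥ u.ofLp) := by
    rw [eq_neg_of_add_eq_zero_left h3, mulVec_neg, neg_neg, mulVec_mulVec,
      Matrix.nonsing_inv_mul _ hu, one_mulVec]
  rw [h2, fderiv_fderiv_left, h4, Heff, sub_mulVec, mulVec_neg, ← sub_eq_add_neg, mulVec_mulVec,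
    mulVec_mulVec, Matrix.mul_assoc]

end ProfileLogLik

/-! ### Derivatives of a restriction to a linear subspace -/

section Restriction
variable {E : Type*} [NormedAddCommGroup E] [NormedSpace ℝ E] {S : Submodule ℝ E} {p : E → ℝ} {Z : S}

lemma contDiffAt_restrict (h : ContDiffAt ℝ ∞ p Z) : ContDiffAt ℝ ∞ (fun Y : S => p Y) Z :=
  ContDiffAt.comp Z (g := p) (f := S.subtypeL) h S.subtypeL.contDiff.contDiffAt

lemma fderiv_restrict (h : DifferentiableAt ℝ p Z) :
    fderiv ℝ (fun Y : S => p Y) Z = fderiv ℝ p Z ∘L S.subtypeL :=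
  (HasFDerivAt.comp Z (g := p) (f := S.subtypeL) h.hasFDerivAt S.subtypeL.hasFDerivAt).fderiv

lemma fderiv_fderiv_restrict (h : ContDiffAt ℝ 2 p Z) (V V' : S) :
    fderiv ℝ (fderiv ℝ fun Y : S => p Y) Z V V' = fderiv ℝ (fderiv ℝ p) Z V V' := by
  have h1 : ∀ᶠ Y : S in 𝓝 Z, fderiv ℝ (fun Y : S => p Y) Y = fderiv ℝ p Y ∘L S.subtypeL := by
    have h2 : ∀ᶠ y in 𝓝 (Z : E), ContDiffAt ℝ 2 p y := h.eventually (by simp)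
    filter_upwards [continuous_subtype_val.continuousAt.eventually h2] with Y hY
    exact fderiv_restrict (hY.differentiableAt (by simp))
  have hd : DifferentiableAt ℝ (fderiv ℝ p) (Z : E) :=
    (h.fderiv_right (m := 1) (by norm_num)).differentiableAt (by simp)
  have h2 := (HasFDerivAt.comp Z (g := fderiv ℝ p) (f := S.subtypeL) hd.hasFDerivAt
    S.subtypeL.hasFDerivAt).clm_comp (hasFDerivAt_const S.subtypeL Z)
  rw [Filter.EventuallyEq.fderiv_eq h1]
  refine (congrArg (fun D => D V V') h2.fderiv).trans ?_
  simp

end Restriction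

/-! ### The Newton equation on the quotient -/

section Newton
variable {n k T : ℕ} {A : Data n T}

lemma rotationInvariant_profileLogLik (A : Data n T) :
    RotationInvariant fun Z : Centered n k => profileLogLik A (Z : Vec n k) := by
  intro Z Q hQ
  have e : ∀ α, logLik A (rmul Z Q : Vec n k) α = logLik A (Z : Vec n k) α :=
    logLik_rotate A hQ (mat_rmul Z Q)
  simp only [profileLogLik, alphaHat, e]

lemma eq_zero_of_inner_dproj (Z : R0 n k) {y : Model n k}
    (h : ∀ V ∈ slice (Z : Centered n k), inner ℝ y (dproj Z V) = 0) : y = 0 := by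
  obtain ⟨V, hV, rfl⟩ := dproj_surjOn Z y
  exact inner_self_eq_zero.1 (h V hV)

lemma contDiffAt_profileLogLik
    (hA : ∀ Z : R0 n k, ∃ α : Vec T n,
      IsMaxOn (fun α' => logLik A ((Z : Centered n k) : Vec n k) α') univ α) :
    ∀ Z ∈ R0 n k,
    ContDiffAt ℝ 2 (fun Z : Centered n k => profileLogLik A (Z : Vec n k)) Z := fun Z hZ =>
  (contDiffAt_restrict (profile_calculus_logLik (hA ⟨Z, hZ⟩)).1).of_le
    (WithTop.coe_le_coe.2 (le_top : (2 : ℕ∞) ≤ ⊤))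

lemma inner_hess_profile
    (hA : ∀ Z : R0 n k, ∃ α : Vec T n,
      IsMaxOn (fun α' => logLik A ((Z : Centered n k) : Vec n k) α') univ α)
    (Z : R0 n k) {V V' : Centered n k} (hV : V ∈ slice (Z : Centered n k))
    (hV' : V' ∈ slice (Z : Centered n k)) :
    inner ℝ (hessMap (fun Z : Centered n k => profileLogLik A (Z : Vec n k)) (cls Z) (dproj Z V))
      (dproj Z V') = (V' : Vec n k).ofLp ⬝ᵥ
        Heff A ((Z : Centered n k) : Vec n k) (alphaHat A ((Z : Centered n k) : Vec n k)) *ᵥ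
          (V : Vec n k).ofLp := by
  rw [inner_hessMap (rotationInvariant_profileLogLik A) (contDiffAt_profileLogLik hA) Z hV hV',
    fderiv_fderiv_restrict (p := profileLogLik A) ((profile_calculus_logLik (hA Z)).1.of_le
      (WithTop.coe_le_coe.2 (le_top : (2 : ℕ∞) ≤ ⊤))),
    fderiv_fderiv_profileLogLik (hA Z)]

lemma inner_grad_profile
    (hA : ∀ Z : R0 n k, ∃ α : Vec T n,
      IsMaxOn (fun α' => logLik A ((Z : Centered n k) : Vec n k) α') univ α)
    (Z : R0 n k) {V : Centered n k} (hV : V ∈ slice (Z : Centered n k)) :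
    inner ℝ (dproj Z (gradient (fun Z : Centered n k => profileLogLik A (Z : Vec n k)) Z))
      (dproj Z V) = (V : Vec n k).ofLp ⬝ᵥ
        Seff A ((Z : Centered n k) : Vec n k) (alphaHat A ((Z : Centered n k) : Vec n k)) := by
  rw [inner_dproj_gradient Z hV, fderiv_restrict (p := profileLogLik A)
    ((profile_calculus_logLik (hA Z)).1.differentiableAt (by simp)),
    ← fderiv_profileLogLik (hA Z)]
  rfl

/-- Comparing kernels suffices, as `D` and `M` are endomorphisms in finite dimension. Hence `P` need
not be known to be linear. -/
lemma bijective_iff_isUnit_of_parametrization {E : Type*} [NormedAddCommGroup E]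
    [InnerProductSpace ℝ E] [FiniteDimensional ℝ E] {r : ℕ} {D : E →L[ℝ] E}
    {M : Matrix (Fin r) (Fin r) ℝ} (P : (Fin r → ℝ) → E) (hP : Function.Surjective P)
    (hP0 : ∀ w, P w = 0 ↔ w = 0) (hD : ∀ w w', inner ℝ (D (P w)) (P w') = w' ⬝ᵥ M *ᵥ w) :
    Function.Bijective D ↔ IsUnit M := by
  have h0 : ∀ w, D (P w) = 0 ↔ M *ᵥ w = 0 := by
    intro w
    constructor
    · intro h
      have := hD w (M *ᵥ w)
      rw [h, inner_zero_left] at this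
      exact dotProduct_self_eq_zero.1 this.symm
    · intro h
      refine ext_inner_right ℝ fun y => ?_
      obtain ⟨w', rfl⟩ := hP y
      rw [hD, h, dotProduct_zero, inner_zero_left]
  have h1 : Function.Injective D ↔ Function.Injective M.mulVec := by
    rw [← Matrix.coe_mulVecLin, injective_iff_map_eq_zero, injective_iff_map_eq_zero]
    constructor
    · intro h w hw
      exact (hP0 w).1 (h _ ((h0 w).2 hw))
    · intro h y hy
      obtain ⟨w, rfl⟩ := hP y
      exact (hP0 w).2 (h w ((h0 w).1 hy))
  rw [← Matrix.mulVec_injective_iff_isUnit, ← h1]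
  exact ⟨fun h => h.1, fun h => ⟨h, (LinearMap.injective_iff_surjective (f := D.toLinearMap)).1 h⟩⟩

end Newton

end LatentSpace

end

/-! ### The Newton update in the basis `U` -/

theorem proposition1 {n k T : ℕ} (hT : 0 < T) (A : Data n T)
    (hA : ∀ Z : R0 n k, ∃ α : Vec T n,
      IsMaxOn (fun α' => logLik A ((Z : Centered n k) : Vec n k) α') univ α)
    (Zc : R0 n k) (αc : Vec T n) {r : ℕ} (U : Matrix (Fin n × Fin k) (Fin r) ℝ)
    (hU : IsColumnBasis U (Ieff ((Zc : Centered n k) : Vec n k) αc)) :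
    let z : Vec n k := ((Zc : Centered n k) : Vec n k)
    let H := Heff A z (alphaHat A z)
    let S := Seff A z (alphaHat A z)
    (Function.Bijective (riemHess (quotMetric n k) (profileQuot A) (cls Zc)) ↔
      IsUnit (Uᵀ * H * U)) ∧
    (IsUnit (Uᵀ * H * U) →
      ∃ V : Centered n k, (V : Vec n k) = newtonVector U H S ∧ V ∈ horizontal Zc ∧
        (∀ ν, riemHess (quotMetric n k) (profileQuot A) (cls Zc) ν =
            -riemGrad (quotMetric n k) (profileQuot A) (cls Zc) ↔ ν = dcls Zc V) ∧
        ∀ q : QuotM n k, IsNewtonUpdate (quotMetric n k) (profileQuot A) (cls Zc) q ↔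
          (∀ t ∈ Icc (0 : ℝ) 1, (Zc : Centered n k) + t • V ∈ R0 n k) ∧
          ∃ h : (Zc : Centered n k) + V ∈ R0 n k, q = cls ⟨(Zc : Centered n k) + V, h⟩) := by
  intro z H S
  set f : Centered n k → ℝ := fun Z => profileLogLik A (Z : Vec n k) with hf
  have hinv : RotationInvariant f := rotationInvariant_profileLogLik A
  have hC := contDiffAt_profileLogLik hA
  have hF : ∀ Z : R0 n k, profileQuot A (cls Z) = f Z := fun _ => rfl
  set D : Model n k →L[ℝ] Model n k := hessMap f (cls Zc) with hD
  set g : Model n k := dproj Zc (gradient f Zc) with hg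
  have hHess : (riemHess (quotMetric n k) (profileQuot A) (cls Zc) : Model n k → Model n k) = D :=
    funext fun ξ => riemHess_quot hinv hC hF (cls Zc) ξ
  have hGrad : (riemGrad (quotMetric n k) (profileQuot A) (cls Zc) : Model n k) = g :=
    riemGrad_cls hinv (fun Z hZ => (hC Z hZ).differentiableAt (by simp)) hF Zc
  -- `U` comes from the information at an arbitrary `αc`, while `H` and `S` are taken at `α̂`; this
  -- is harmless because the column space is the horizontal space for every `α`.
  have hspan : ∀ v, (∃ w, U *ᵥ w = v) ↔
      ∃ V ∈ slice (Zc : Centered n k), (V : Vec n k).ofLp = v := fun v => by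
    rw [← mem_span_Ieff_iff hT Zc αc, ← hU.2, ← Matrix.range_mulVecLin]
    rfl
  choose B hBs hBv using fun w => (hspan (U *ᵥ w)).1 ⟨w, rfl⟩
  have hUinj : Function.Injective U.mulVec := Matrix.mulVec_injective_iff.2 hU.1
  have hBsurj : ∀ V ∈ slice (Zc : Centered n k), ∃ w, B w = V := fun V hV => by
    obtain ⟨w, hw⟩ := (hspan _).2 ⟨V, hV, rfl⟩
    refine ⟨w, Subtype.ext (WithLp.ofLp_injective 2 ?_)⟩
    rw [hBv, hw]
  have hdot : ∀ w x, (U *ᵥ w) ⬝ᵥ x = w ⬝ᵥ Uᵀ *ᵥ x := fun w x => by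
    rw [dotProduct_mulVec, vecMul_transpose]
  have hDB : ∀ w w', inner ℝ (D (dproj Zc (B w))) (dproj Zc (B w')) =
      w' ⬝ᵥ (Uᵀ * H * U) *ᵥ w := fun w w' => by
    rw [hD, inner_hess_profile hA Zc (hBs w) (hBs w'), hBv, hBv, hdot, mulVec_mulVec,
      mulVec_mulVec, Matrix.mul_assoc]
  have hgB : ∀ w, inner ℝ g (dproj Zc (B w)) = w ⬝ᵥ Uᵀ *ᵥ S := fun w => by
    rw [hg, inner_grad_profile hA Zc (hBs w), hBv, hdot]
  have hbij : Function.Bijective D ↔ IsUnit (Uᵀ * H * U) := by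
    refine bijective_iff_isUnit_of_parametrization (fun w => dproj Zc (B w)) (fun y => ?_)
      (fun w => ⟨fun h => ?_, ?_⟩) hDB
    · obtain ⟨V, hV, rfl⟩ := dproj_surjOn Zc y
      obtain ⟨w, rfl⟩ := hBsurj V hV
      exact ⟨w, rfl⟩
    · have h1 := hBv w
      rw [dproj_injOn (hBs w) h] at h1
      refine hUinj (h1.symm.trans ?_)
      rw [mulVec_zero]
      rfl
    · rintro rfl
      have h1 : B 0 = 0 := Subtype.ext (WithLp.ofLp_injective 2 (by rw [hBv, mulVec_zero]; rfl))
      simp only [h1, map_zero]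
  refine ⟨?_, fun hM => ?_⟩
  · rw [← hbij, ← hHess]
    rfl
  · have hMdet := (Matrix.isUnit_iff_isUnit_det _).1 hM
    -- The coordinates of the Newton direction: pairing the Newton equation with every horizontal `B
    -- w'` turns it into `UᵀHU w = -UᵀS`.
    set w : Fin r → ℝ := -((Uᵀ * H * U)⁻¹ *ᵥ Uᵀ *ᵥ S) with hw
    have hMw : (Uᵀ * H * U) *ᵥ w = -(Uᵀ *ᵥ S) := by
      rw [hw, mulVec_neg, mulVec_mulVec (Uᵀ *ᵥ S), Matrix.mul_nonsing_inv _ hMdet, one_mulVec]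
    have hsol : D (dproj Zc (B w)) = -g := by
      refine eq_neg_of_add_eq_zero_left (eq_zero_of_inner_dproj Zc fun V' hV' => ?_)
      obtain ⟨w', rfl⟩ := hBsurj V' hV'
      rw [inner_add_left, hDB, hgB, hMw, dotProduct_neg, neg_add_cancel]
    have hnewton : ∀ ν : Model n k, D ν = -g ↔ ν = dproj Zc (B w) := fun ν =>
      ⟨fun h => (hbij.2 hM).1 (h.trans hsol.symm), fun h => h ▸ hsol⟩
    have heq : ∀ ν, riemHess (quotMetric n k) (profileQuot A) (cls Zc) ν =
        -riemGrad (quotMetric n k) (profileQuot A) (cls Zc) ↔ ν = dcls Zc (B w) := fun ν => by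
      have h1 : riemHess (quotMetric n k) (profileQuot A) (cls Zc) ν = D ν := congrFun hHess ν
      have h2 : dcls Zc (B w) = dproj Zc (B w) := DFunLike.congr_fun (dcls_eq Zc) (B w)
      rw [h1, h2]
      refine Iff.trans ?_ (hnewton ν)
      exact ⟨fun h => h.trans (congrArg (fun y : Model n k => -y) hGrad),
        fun h => h.trans (congrArg (fun y : Model n k => -y) hGrad).symm⟩
    refine ⟨B w, ?_, ?_, heq, fun q => ?_⟩
    · refine WithLp.ofLp_injective 2 ?_
      rw [hBv, newtonVector, hw, mulVec_neg, mulVec_mulVec, mulVec_mulVec, Matrix.mul_assoc]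
    · rw [horizontal_eq]
      exact hBs w
    · rw [← isExp_dcls_iff (hBs w)]
      constructor
      · rintro ⟨ν, hν, hq⟩
        rw [(heq ν).1 hν] at hq
        exact hq
      · exact fun hq => ⟨_, (heq _).2 rfl, hq⟩
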